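/- For a finite simple graph $G$ with a perfect matching and $X\subseteq V(G)$ let $\partial_G(X)$ be the set of edges of $G$ with exactly one endpoint in $X$, and let its matching porosity be $\mathrm{mp}(\partial_G(X))=\max_M|M\cap\partial_G(X)|$, the maximum taken over all perfect matchings $M$ of $G$. A perfect matching decomposition of $G$ is a pair $(T,\delta)$ of a finite tree $T$, all of whose vertices have degree $1$ or $3$, and a bijection $\delta$ from the set of leaves (vertices of degree $1$) of $T$ to $V(G)$. For an edge $t_1t_2$ of $T$ let $X_{t_1t_2}\subseteq V(G)$ be the set of the images under $\delta$ of those leaves of $T$ that lie in the component of $T-t_1t_2$ containing $t_1$. The width of $(T,\delta)$ is $\max_{t_1t_2\in E(T)}\mathrm{mp}(\partial_G(X_{t_1t_2}))$, and the perfect matching width $\mathrm{pmw}(G)$ is the minimum width of a perfect matching decomposition of $G$. Theorem. There is an algorithm that computes, for every non-empty finite bipartite graph $B$ with a perfect matching, the number of perfect matchings of $B$ in time $|V(B)|^{\mathcal{O}(\mathrm{pmw}(B)^2)}$. That is: there are a constant $c\in\mathbb{N}$ and a single program $P$ for a random access machine (with addition, truncated subtraction, multiplication, integer division, indirect addressing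 and conditional jumps, under the logarithmic cost measure) such that, for every $n\geq 1$ and every bipartite graph $B$ on the vertices $0,\dots,n-1$ that has a perfect matching, $P$, started with $n$ and the adjacency matrix of $B$ in its memory, halts with the number of perfect matchings of $B$ as output after time at most $n^{c\cdot\mathrm{pmw}(B)^2}$. -/

import Mathlib

/-! ### Perfect matching width -/

namespace PMW

variable {V : Type*}

/-- The edge cut around `X` in `G`: all edges of `G` with exactly one endpoint in `X`. -/
def edgeCut (G : SimpleGraph V) (X : Set V) : Set (Sym2 V) :=
  {e | e ∈ G.edgeSet ∧ ∃ u ∈ X, ∃ v ∉ X, e = s(u, v)}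

/-- The matching porosity of the edge cut around `X`: the maximum number of edges that a perfect
matching of `G` has in the cut. (For finite `V` the supremum is over a bounded family.) -/
noncomputable def matchingPorosity (G : SimpleGraph V) (X : Set V) : ℕ :=
  ⨆ M : {M : G.Subgraph // M.IsPerfectMatching}, (M.1.edgeSet ∩ edgeCut G X).ncard

/-- A perfect matching decomposition over the vertex set `V`: a finite cubic tree `T` (every vertex
is a leaf, that is, has degree one, or has degree three) with a bijection `δ` from the leaves of `T`
to `V`. -/
structure Decomposition (V : Type*) where
  /-- the number of vertices of the tree -/
  m : ℕ
  /-- the tree -/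
  T : SimpleGraph (Fin m)
  isTree : T.IsTree
  cubic : ∀ t, (T.neighborSet t).ncard = 1 ∨ (T.neighborSet t).ncard = 3
  /-- the bijection between the leaves of the tree and the vertices of the graph -/
  δ : {t : Fin m // (T.neighborSet t).ncard = 1} ≃ V

namespace Decomposition

/-- The vertices of the graph that are mapped to the leaves in the component of `T - t₁t₂`
which contains `t₁`. -/
def shore (D : Decomposition V) (t₁ t₂ : Fin D.m) : Set V :=
  {v | (D.T.deleteEdges {s(t₁, t₂)}).Reachable t₁ (D.δ.symm v).1}

/-- The width of a perfect matching decomposition of `G`: the maximum, over the edges `t₁t₂` of the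
tree, of the matching porosity of the cut of `G` that `t₁t₂` induces. -/
noncomputable def width (D : Decomposition V) (G : SimpleGraph V) : ℕ :=
  ⨆ p : {p : Fin D.m × Fin D.m // D.T.Adj p.1 p.2}, matchingPorosity G (D.shore p.1.1 p.1.2)

end Decomposition

/-- The perfect matching width of `G`: the minimum width of a perfect matching decomposition. -/
noncomputable def pmw (G : SimpleGraph V) : ℕ :=
  ⨅ D : Decomposition V, D.width G

/-- The number of perfect matchings of `G`. -/
noncomputable def numPerfectMatchings (G : SimpleGraph V) : ℕ :=
  {M : G.Subgraph | M.IsPerfectMatching}.ncard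

end PMW

/-! ### Random access machines with the logarithmic cost measure -/

namespace RAM

/-- The memory: one natural number in each cell. -/
abbrev Memory : Type := ℕ → ℕ

/-- Instructions. Below, `R[a]` is the content of cell `a`. -/
inductive Instr : Type
  /-- `R[d] := c` -/
  | const (d c : ℕ)
  /-- `R[d] := R[a] + R[b]` -/
  | add (d a b : ℕ)
  /-- `R[d] := R[a] - R[b]`, truncated at zero -/
  | sub (d a b : ℕ)
  /-- `R[d] := R[a] * R[b]` -/
  | mul (d a b : ℕ)
  /-- `R[d] := ⌊R[a] / R[b]⌋`, and `0` if `R[b] = 0` -/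
  | div (d a b : ℕ)
  /-- `R[d] := R[R[a]]` -/
  | load (d a : ℕ)
  /-- `R[R[a]] := R[b]` -/
  | store (a b : ℕ)
  /-- go to line `l` -/
  | jump (l : ℕ)
  /-- go to line `l` if `R[a] = 0`, and to the next line otherwise -/
  | jumpZero (a l : ℕ)

/-- A program is a finite list of instructions; its lines are numbered from `0`. -/
abbrev Program : Type := List Instr

/-- A configuration: the current line and the content of the memory. -/
structure Config : Type where
  /-- the current line -/
  pc : ℕ
  /-- the content of the memory -/
  mem : Memory

/-- The effect of one instruction. -/
def Instr.exec : Instr → Config → Config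
  | .const d c, ⟨p, R⟩ => ⟨p + 1, Function.update R d c⟩
  | .add d a b, ⟨p, R⟩ => ⟨p + 1, Function.update R d (R a + R b)⟩
  | .sub d a b, ⟨p, R⟩ => ⟨p + 1, Function.update R d (R a - R b)⟩
  | .mul d a b, ⟨p, R⟩ => ⟨p + 1, Function.update R d (R a * R b)⟩
  | .div d a b, ⟨p, R⟩ => ⟨p + 1, Function.update R d (R a / R b)⟩
  | .load d a, ⟨p, R⟩ => ⟨p + 1, Function.update R d (R (R a))⟩
  | .store a b, ⟨p, R⟩ => ⟨p + 1, Function.update R (R a) (R b)⟩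
  | .jump l, ⟨_, R⟩ => ⟨l, R⟩
  | .jumpZero a l, ⟨p, R⟩ => ⟨if R a = 0 then l else p + 1, R⟩

/-- The logarithmic cost of one instruction: one plus the total number of binary digits of all
numbers and cell addresses that it handles. -/
def Instr.cost : Instr → Memory → ℕ
  | .const d c, _ => 1 + d.size + c.size
  | .add d a b, R => 1 + d.size + a.size + b.size + (R a).size + (R b).size
  | .sub d a b, R => 1 + d.size + a.size + b.size + (R a).size + (R b).size
  | .mul d a b, R => 1 + d.size + a.size + b.size + (R a).size + (R b).size
  | .div d a b, R => 1 + d.size + a.size + b.size + (R a).size + (R b).size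
  | .load d a, R => 1 + d.size + a.size + (R a).size + (R (R a)).size
  | .store a b, R => 1 + a.size + b.size + (R a).size + (R b).size
  | .jump l, _ => 1 + l.size
  | .jumpZero a l, R => 1 + a.size + l.size + (R a).size

/-- `Runs P C t C'`: from `C` the program `P` reaches, in time exactly `t`, the configuration `C'`,
and it halts there, because its current line is not a line of `P`. -/
inductive Runs (P : Program) : Config → ℕ → Config → Prop
  | halt {C : Config} (h : P[C.pc]? = none) : Runs P C 0 C
  | step {C C' : Config} {i : Instr} {t : ℕ} (h : P[C.pc]? = some i)
      (hrun : Runs P (i.exec C) t C') : Runs P C (i.cost C.mem + t) C'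

/-- Started on line `0` with memory `R`, the program `P` halts within time `T`, with the number
`out` in cell `0`. -/
def OutputsWithin (P : Program) (R : Memory) (out T : ℕ) : Prop :=
  ∃ (t : ℕ) (C : Config), Runs P ⟨0, R⟩ t C ∧ C.mem 0 = out ∧ t ≤ T

open Classical in
/-- The input memory for a graph on the vertices `0, …, n - 1`: cell `0` contains `n`, the next
`n * n` cells contain the adjacency matrix row by row (the entry of `(i, j)` is in cell
`1 + i * n + j`), and all other cells contain `0`. -/
noncomputable def graphInput {n : ℕ} (G : SimpleGraph (Fin n)) : Memory := fun k =>
  if k = 0 then n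
  else if ∃ i j : Fin n, G.Adj i j ∧ k = 1 + i.1 * n + j.1 then 1
  else 0

end RAM

/-!
Why such an algorithm exists.

**One digraph instead of a bipartition.** The perfect matchings of the bipartite double cover of `B` are
the permutations `τ` of the vertices with `u` adjacent to `τ u`. Each of them consists of two perfect
matchings of `B` (`PMW.card_perm_eq_sq`), so it suffices to count these permutations and to take a
square root. One of them, `σ`, is found by an auction (`Alg.mate_spec`, by Hall's theorem). In the
digraph `D` with an arc from `u` to `v` if `u` is adjacent to `σ v`, the permutations along arcs have to
be counted; every vertex has a loop.

**Separators.** Let `k = pmw B`. For a tree cut `X`, each permutation passes between `X` and its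
complement at most `2 * k` times. Egerváry's theorem (`Duality.exists_potentials`) turns this into
potentials whose positive places form a set of at most `2 * k` vertices that separates the strong
components of `D` in `X` from the others (`PMW.exists_separator`). Three cuts at a node of the cubic tree
give balanced separators with `6 * k` vertices (`PMW.exists_balanced_separator`).

**Building the vertex set.** For a set `W` of deleted vertices, comparison of the sets of reachable
vertices, as binary numbers, is a linear preorder of the vertices that is compatible with
reachability and whose ties are the strong components. Consider the sets that are cut out by such a
preorder: a strong component outside `W` (or all vertices outside `W`), without `W'`, up to some vertex
in the preorder for `W'`, with `W` and `W'` of size at most `s`. There are `n ^ O(s)` of them, and a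
permutation along arcs leaves each at most `3 * s` times (`Dig.IsFam.card_exits_le`). By balanced
separators, for `s = 18 * k + 1` the set of all vertices arises from singletons by disjoint unions
inside this family (`Dig.derivable_of_blocks`): a component with a guard `W` is dissected by a separator
of `W`, and each smaller component again has a small guard.

**Counting.** For each set `Z` that is reached in this way, a table stores, for every set `U` of at most
`12 * s` rows and columns, the number of the matchings inside `Z` that leave just `U` uncovered. For a
disjoint union the two tables are multiplied and the arcs between the parts are added one by one
(`Alg.IsTable.merge`). Entries for larger sets `U` are missing, hence some entries are too small; but
the entries that can be completed to a permutation are right, because along a permutation few rows and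
columns are left uncovered. This is the invariant `Alg.IsTable`. It holds for every `s ≥ 1`, no matter
whether `s` is large compared to `k`, and therefore the algorithm can try `s = 1, 2, …` until the set of
all vertices has a table (`Alg.outcome_eq`, `Alg.outcome_ne_zero`).

**Running time.** All data are natural numbers; sets and arrays are encoded by binary digits. A function
is feasible (`RAM.Feas`) if there is code that computes it in time polynomial in a bound for its small
arguments and for the lengths of its other arguments. Feasible functions are closed under the
operations the algorithm is composed of, so that it is enough to write the algorithm as a function
on natural numbers, with `(2 * n + 1) ^ s` as one of its small arguments. Since `1 ≤ k` and `2 ≤ n`, a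
power of `(2 * n + 1) ^ (18 * k + 2)` is at most `n ^ (c * k ^ 2)`.
-/

namespace RAM

/-! ### Polynomial bounds -/

/-- `g` is bounded by a fixed power of the parameter `N`, on all points `x` that are admissible
for `N`. -/
def PolyBdd {α : Type*} (Q : ℕ → α → Prop) (g : α → ℕ) : Prop :=
  ∃ e : ℕ, ∀ N, 2 ≤ N → ∀ x, Q N x → g x ≤ N ^ e

section PolyBdd

variable {α β : Type*} {Q : ℕ → α → Prop} {Q' : ℕ → β → Prop} {f g : α → ℕ}

theorem PolyBdd.mono (hg : PolyBdd Q g) (h : ∀ x, f x ≤ g x) : PolyBdd Q f :=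
  let ⟨e, he⟩ := hg
  ⟨e, fun N hN x hx => (h x).trans (he N hN x hx)⟩

theorem PolyBdd.const (k : ℕ) : PolyBdd Q (fun _ => k) :=
  ⟨k, fun _ hN _ _ => (Nat.lt_two_pow_self (n := k)).le.trans (Nat.pow_le_pow_left hN k)⟩

theorem PolyBdd.add (hf : PolyBdd Q f) (hg : PolyBdd Q g) : PolyBdd Q (fun x => f x + g x) := by
  obtain ⟨a, ha⟩ := hf
  obtain ⟨b, hb⟩ := hg
  refine ⟨a + b + 1, fun N hN x hx => ?_⟩
  have h1 : N ^ a ≤ N ^ (a + b) := Nat.pow_le_pow_right (by omega) (by omega)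
  have h2 : N ^ b ≤ N ^ (a + b) := Nat.pow_le_pow_right (by omega) (by omega)
  have h3 : N ^ (a + b) * 2 ≤ N ^ (a + b + 1) := by
    rw [pow_succ]; exact Nat.mul_le_mul_left _ hN
  have h4 := ha N hN x hx
  have h5 := hb N hN x hx
  show f x + g x ≤ _
  omega

theorem PolyBdd.mul (hf : PolyBdd Q f) (hg : PolyBdd Q g) : PolyBdd Q (fun x => f x * g x) := by
  obtain ⟨a, ha⟩ := hf
  obtain ⟨b, hb⟩ := hg
  exact ⟨a + b, fun N hN x hx => by
    rw [pow_add]; exact Nat.mul_le_mul (ha N hN x hx) (hb N hN x hx)⟩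

/-- Polynomial bounds are stable under a substitution that increases the parameter only
polynomially. -/
theorem PolyBdd.comp {g : β → ℕ} (hg : PolyBdd Q' g) {h : α → β} {e : ℕ}
    (hh : ∀ N, 2 ≤ N → ∀ x, Q N x → Q' (N ^ (e + 1)) (h x)) : PolyBdd Q (fun x => g (h x)) := by
  obtain ⟨a, ha⟩ := hg
  refine ⟨(e + 1) * a, fun N hN x hx => ?_⟩
  rw [pow_mul]
  refine ha _ (hN.trans ?_) _ (hh N hN x hx)
  exact Nat.le_self_pow (by omega) N

theorem PolyBdd.sum {n : α → ℕ} (hn : PolyBdd Q n) {g : α × ℕ → ℕ}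
    (hg : PolyBdd (fun N (x : α × ℕ) => Q N x.1 ∧ x.2 < n x.1) g) :
    PolyBdd Q (fun x => ∑ i ∈ Finset.range (n x), g (x, i)) := by
  obtain ⟨a, ha⟩ := hn
  obtain ⟨b, hb⟩ := hg
  refine ⟨a + b, fun N hN x hx => ?_⟩
  rw [pow_add]
  calc ∑ i ∈ Finset.range (n x), g (x, i) ≤ ∑ _i ∈ Finset.range (n x), N ^ b :=
        Finset.sum_le_sum fun i hi => hb N hN (x, i) ⟨hx, Finset.mem_range.1 hi⟩
    _ = n x * N ^ b := by simp
    _ ≤ _ := Nat.mul_le_mul_right _ (ha N hN x hx)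

end PolyBdd

theorem size_le_self (x : ℕ) : x.size ≤ x := Nat.size_le.2 Nat.lt_two_pow_self

theorem size_add_le (x y : ℕ) : (x + y).size ≤ x.size + y.size + 1 := by
  rw [Nat.size_le]
  have hx := Nat.lt_size_self x
  have hy := Nat.lt_size_self y
  have h1 : 2 ^ x.size ≤ 2 ^ (x.size + y.size) := Nat.pow_le_pow_right (by omega) (by omega)
  have h2 : 2 ^ y.size ≤ 2 ^ (x.size + y.size) := Nat.pow_le_pow_right (by omega) (by omega)
  rw [pow_succ]
  omega

theorem size_mul_le (x y : ℕ) : (x * y).size ≤ x.size + y.size + 1 := by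
  refine le_trans (b := x.size + y.size) ?_ (by omega)
  rw [Nat.size_le, pow_add]
  exact Nat.mul_lt_mul'' (Nat.lt_size_self x) (Nat.lt_size_self y)

theorem size_sub_le (x y : ℕ) : (x - y).size ≤ x.size + y.size + 1 :=
  (Nat.size_le_size (Nat.sub_le x y)).trans (by omega)

theorem size_div_le (x y : ℕ) : (x / y).size ≤ x.size + y.size + 1 :=
  (Nat.size_le_size (Nat.div_le_self x y)).trans (by omega)

/-! ### Composing runs and pieces of code -/

/-- From `C` the program `P` gets to `C'` in time `t`, not necessarily halting there: every halting
run from `C'` extends to one from `C`. -/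
def Reach (P : Program) (C : Config) (t : ℕ) (C' : Config) : Prop :=
  ∀ t' C'', Runs P C' t' C'' → Runs P C (t + t') C''

theorem Reach.refl (P : Program) (C : Config) : Reach P C 0 C := fun t' C'' h => by simpa using h

theorem Reach.trans {P : Program} {C C' C'' : Config} {t t' : ℕ} (h : Reach P C t C')
    (h' : Reach P C' t' C'') : Reach P C (t + t') C'' := fun s D hD => by
  rw [add_assoc]; exact h _ _ (h' _ _ hD)

theorem Reach.one {P : Program} {p : ℕ} {R : Memory} {i : Instr} (h : P[p]? = some i) :
    Reach P ⟨p, R⟩ (i.cost R) (i.exec ⟨p, R⟩) := fun _ _ hr => Runs.step h hr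

/-- The program `P` contains the code `l` from line `o` on. -/
def HasCode (P : Program) (o : ℕ) (l : List Instr) : Prop :=
  ∀ i, i < l.length → P[o + i]? = l[i]?

theorem HasCode.append {P : Program} {o : ℕ} {c c' : List Instr} (h : HasCode P o (c ++ c')) :
    HasCode P o c ∧ HasCode P (o + c.length) c' := by
  constructor
  · intro i hi
    rw [h i (by simp; omega), List.getElem?_append_left hi]
  · intro i hi
    rw [add_assoc, h (c.length + i) (by simp; omega), List.getElem?_append_right (by omega)]
    simp

theorem HasCode.cons {P : Program} {o : ℕ} {i : Instr} {c : List Instr}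
    (h : HasCode P o (i :: c)) : P[o]? = some i ∧ HasCode P (o + 1) c := by
  constructor
  · simpa using h 0 (by simp)
  · intro j hj
    rw [show o + 1 + j = o + (j + 1) by omega, h (j + 1) (by simpa using hj)]
    simp

/-! ### Feasible functions -/

/-- The variables of a feasible function: `s j` are small and `b j` have few digits. -/
def Admissible (N : ℕ) (x : (ℕ → ℕ) × (ℕ → ℕ)) : Prop :=
  (∀ j, x.1 j ≤ N) ∧ ∀ j, (x.2 j).size ≤ N

/-- `f s b` is polynomially bounded when the variables `s` are bounded and the variables `b` have a
bounded number of digits. -/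
def Small (f : (ℕ → ℕ) → (ℕ → ℕ) → ℕ) : Prop := PolyBdd Admissible (fun x => f x.1 x.2)

/-- A function `f s b` of two sequences of variables is feasible if a random access machine can
compute it, wherever the variables are placed in cells below `base`, with the result in the cell
`base` and without a change of the cells below, where both the time and the number of digits of the
result are polynomial in a bound `N` for all `s j` and for the numbers of digits of all `b j`. -/
def Feas (f : (ℕ → ℕ) → (ℕ → ℕ) → ℕ) : Prop :=
  PolyBdd Admissible (fun x => (f x.1 x.2).size) ∧
  ∀ (ρ ρ' : ℕ → ℕ) (base : ℕ), (∀ j, ρ j < base) → (∀ j, ρ' j < base) → ∀ o : ℕ,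
    ∃ (c : List Instr) (G : Memory → Memory) (T : Memory → ℕ),
      (∀ P, HasCode P o c → ∀ R, Reach P ⟨o, R⟩ (T R) ⟨o + c.length, G R⟩) ∧
      (∀ R j, j < base → G R j = R j) ∧
      (∀ R, G R base = f (fun j => R (ρ j)) (fun j => R (ρ' j))) ∧
      PolyBdd (fun N R => Admissible N (fun j => R (ρ j), fun j => R (ρ' j))) T

theorem Small.size {f : (ℕ → ℕ) → (ℕ → ℕ) → ℕ} (h : Small f) :
    PolyBdd Admissible (fun x => (f x.1 x.2).size) :=
  PolyBdd.mono h fun _ => size_le_self _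

theorem Admissible.mono {N M : ℕ} {x : (ℕ → ℕ) × (ℕ → ℕ)} (h : Admissible N x) (hNM : N ≤ M) :
    Admissible M x :=
  ⟨fun j => (h.1 j).trans hNM, fun j => (h.2 j).trans hNM⟩

theorem Small.ren {f : (ℕ → ℕ) → (ℕ → ℕ) → ℕ} (h : Small f) (r r' : ℕ → ℕ) :
    Small (fun s b => f (fun j => s (r j)) (fun j => b (r' j))) :=
  PolyBdd.comp (Q' := Admissible) (e := 0) h
    (h := fun x : (ℕ → ℕ) × (ℕ → ℕ) => (fun j => x.1 (r j), fun j => x.2 (r' j)))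
    fun N _ x hx => ⟨fun j => by simpa using hx.1 _, fun j => by simpa using hx.2 _⟩

theorem Feas.ren {f : (ℕ → ℕ) → (ℕ → ℕ) → ℕ} (h : Feas f) (r r' : ℕ → ℕ) :
    Feas (fun s b => f (fun j => s (r j)) (fun j => b (r' j))) := by
  refine ⟨PolyBdd.comp (Q' := Admissible) (e := 0) h.1
    (h := fun x : (ℕ → ℕ) × (ℕ → ℕ) => (fun j => x.1 (r j), fun j => x.2 (r' j)))
    fun N _ x hx => ⟨fun j => by simpa using hx.1 _, fun j => by simpa using hx.2 _⟩, ?_⟩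
  intro ρ ρ' base hρ hρ' o
  obtain ⟨c, G, T, h1, h2, h3, h4⟩ := h.2 (fun j => ρ (r j)) (fun j => ρ' (r' j)) base
    (fun j => hρ _) (fun j => hρ' _) o
  exact ⟨c, G, T, h1, h2, h3, PolyBdd.comp (e := 0) (h := id) h4
    fun N _ x hx => ⟨fun j => by simpa using hx.1 _, fun j => by simpa using hx.2 _⟩⟩

theorem Small.var (j : ℕ) : Small (fun s _ => s j) :=
  ⟨1, fun N _ x hx => by simpa using hx.1 j⟩

theorem Small.const (k : ℕ) : Small (fun _ _ => k) := PolyBdd.const k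

theorem Feas.const (k : ℕ) : Feas (fun _ _ => k) := by
  refine ⟨PolyBdd.const _, fun ρ ρ' base hρ hρ' o => ?_⟩
  refine ⟨[.const base k], fun R => Function.update R base k, fun _ => 1 + base.size + k.size,
    ?_, ?_, ?_, PolyBdd.const _⟩
  · exact fun P hP R => Reach.one hP.cons.1
  · intro R j hj
    exact Function.update_of_ne (by omega) _ _
  · intro R; simp

/-- A copy of a cell is feasible. -/
theorem feas_copy {f : (ℕ → ℕ) → (ℕ → ℕ) → ℕ}
    (hs : PolyBdd Admissible (fun x => (f x.1 x.2).size))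
    (hf : ∀ (ρ ρ' : ℕ → ℕ) (base : ℕ), (∀ j, ρ j < base) → (∀ j, ρ' j < base) →
      ∃ a < base, ∀ R : Memory, f (fun j => R (ρ j)) (fun j => R (ρ' j)) = R a) : Feas f := by
  refine ⟨hs, fun ρ ρ' base hρ hρ' o => ?_⟩
  obtain ⟨a, ha, hR⟩ := hf ρ ρ' base hρ hρ'
  refine ⟨[.const base 0, .add base a base], fun R => Function.update R base (R a),
    fun R => (1 + base.size + Nat.size 0) +
      (1 + base.size + a.size + base.size + (R a).size + Nat.size 0), ?_, ?_, ?_, ?_⟩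
  · intro P hP R
    obtain ⟨h1, h2⟩ := hP.cons
    have := (Reach.one (R := R) h1).trans (Reach.one h2.cons.1)
    simpa [Instr.exec, Instr.cost, ha.ne, add_assoc] using this
  · intro R j hj
    exact Function.update_of_ne (by omega) _ _
  · intro R; simp [hR]
  · refine (PolyBdd.const _).add (((PolyBdd.const _).add ?_).add (PolyBdd.const _))
    have := PolyBdd.comp (Q := fun N (R : Memory) =>
      Admissible N (fun j => R (ρ j), fun j => R (ρ' j))) (e := 0) hs
      (h := fun R => (fun j => R (ρ j), fun j => R (ρ' j)))
      fun N _ x hx => hx.mono (by simp)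
    simpa [hR] using this

theorem Feas.var (j : ℕ) : Feas (fun s _ => s j) :=
  feas_copy (Small.var j).size fun ρ _ _ hρ _ => ⟨ρ j, hρ j, fun _ => rfl⟩

theorem Feas.bigVar (j : ℕ) : Feas (fun _ b => b j) :=
  feas_copy ⟨1, fun N _ x hx => by simpa using hx.2 j⟩
    fun _ ρ' _ _ hρ' => ⟨ρ' j, hρ' j, fun _ => rfl⟩

/-- A binary operation for which there is an instruction preserves feasibility. -/
theorem feas_binop (op : ℕ → ℕ → ℕ) (ins : ℕ → ℕ → ℕ → Instr)
    (hexec : ∀ d a b p R, (ins d a b).exec ⟨p, R⟩ = ⟨p + 1, Function.update R d (op (R a) (R b))⟩)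
    (hcost : ∀ d a b R, (ins d a b).cost R =
      1 + d.size + a.size + b.size + (R a).size + (R b).size)
    (hsize : ∀ x y, (op x y).size ≤ x.size + y.size + 1)
    {f g : (ℕ → ℕ) → (ℕ → ℕ) → ℕ} (hf : Feas f) (hg : Feas g) :
    Feas (fun s b => op (f s b) (g s b)) := by
  refine ⟨((hf.1.add hg.1).add (PolyBdd.const 1)).mono fun x => hsize _ _,
    fun ρ ρ' base hρ hρ' o => ?_⟩
  obtain ⟨c, G, T, h1, h2, h3, h4⟩ := hf.2 ρ ρ' base hρ hρ' o
  obtain ⟨c', G', T', h1', h2', h3', h4'⟩ := hg.2 ρ ρ' (base + 1)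
    (fun j => (hρ j).trans (by omega)) (fun j => (hρ' j).trans (by omega)) (o + c.length)
  have e1 : ∀ R, (fun j => G R (ρ j)) = fun j => R (ρ j) := fun R => funext fun j => h2 R _ (hρ j)
  have e2 : ∀ R, (fun j => G R (ρ' j)) = fun j => R (ρ' j) :=
    fun R => funext fun j => h2 R _ (hρ' j)
  have e3 : ∀ R, G' (G R) base = f (fun j => R (ρ j)) (fun j => R (ρ' j)) :=
    fun R => by rw [h2' _ _ (by omega), h3]
  have e4 : ∀ R, G' (G R) (base + 1) = g (fun j => R (ρ j)) (fun j => R (ρ' j)) :=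
    fun R => by rw [h3', e1, e2]
  refine ⟨c ++ (c' ++ [ins base base (base + 1)]),
    fun R => Function.update (G' (G R)) base (op (G' (G R) base) (G' (G R) (base + 1))),
    fun R => T R + (T' (G R) + (1 + base.size + base.size + (base + 1).size +
      (G' (G R) base).size + (G' (G R) (base + 1)).size)), ?_, ?_, ?_, ?_⟩
  · intro P hP R
    obtain ⟨p1, p2⟩ := hP.append
    obtain ⟨p2, p3⟩ := p2.append
    have := (h1 P p1 R).trans ((h1' P p2 (G R)).trans (Reach.one p3.cons.1))
    rw [hexec, hcost] at this
    simpa [add_assoc] using this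
  · intro R j hj
    beta_reduce
    rw [Function.update_of_ne (by omega), h2' _ _ (by omega), h2 _ _ hj]
  · intro R
    simp [e3, e4]
  · have key : ∀ {u : (ℕ → ℕ) × (ℕ → ℕ) → ℕ}, PolyBdd Admissible u →
        PolyBdd (fun N (R : Memory) => Admissible N (fun j => R (ρ j), fun j => R (ρ' j)))
          (fun R => u (fun j => R (ρ j), fun j => R (ρ' j))) := fun hu =>
      PolyBdd.comp (e := 0) hu (h := fun R : Memory => (fun j => R (ρ j), fun j => R (ρ' j)))
        fun N _ x hx => hx.mono (by simp)
    simp only [e3, e4]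
    refine h4.add (PolyBdd.add ?_ (((PolyBdd.const _).add (key hf.1)).add (key hg.1)))
    exact PolyBdd.comp (e := 0) h4' (h := G) fun N _ R hR => by
      rw [e1, e2]; exact hR.mono (by simp)

theorem Feas.add {f g : (ℕ → ℕ) → (ℕ → ℕ) → ℕ} (hf : Feas f) (hg : Feas g) :
    Feas (fun s b => f s b + g s b) :=
  feas_binop (· + ·) .add (fun _ _ _ _ _ => rfl) (fun _ _ _ _ => rfl) size_add_le hf hg

theorem Feas.sub {f g : (ℕ → ℕ) → (ℕ → ℕ) → ℕ} (hf : Feas f) (hg : Feas g) :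
    Feas (fun s b => f s b - g s b) :=
  feas_binop (· - ·) .sub (fun _ _ _ _ _ => rfl) (fun _ _ _ _ => rfl) size_sub_le hf hg

theorem Feas.mul {f g : (ℕ → ℕ) → (ℕ → ℕ) → ℕ} (hf : Feas f) (hg : Feas g) :
    Feas (fun s b => f s b * g s b) :=
  feas_binop (· * ·) .mul (fun _ _ _ _ _ => rfl) (fun _ _ _ _ => rfl) size_mul_le hf hg

theorem Feas.div {f g : (ℕ → ℕ) → (ℕ → ℕ) → ℕ} (hf : Feas f) (hg : Feas g) :
    Feas (fun s b => f s b / g s b) :=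
  feas_binop (· / ·) .div (fun _ _ _ _ _ => rfl) (fun _ _ _ _ => rfl) size_div_le hf hg

/-- `loop F x n` is the result of the loop `for i < n do x := F i x`. -/
def loop (F : ℕ → ℕ → ℕ) (x : ℕ) : ℕ → ℕ
  | 0 => x
  | n + 1 => F n (loop F x n)

/-- Extend a placement of variables by a new variable `0` in the cell `a`. -/
def place (a : ℕ) (ρ : ℕ → ℕ) : ℕ → ℕ
  | 0 => a
  | j + 1 => ρ j

theorem place_lt {a base : ℕ} {ρ : ℕ → ℕ} (ha : a < base) (hρ : ∀ j, ρ j < base) (j : ℕ) :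
    place a ρ j < base := by
  cases j
  · exact ha
  · exact hρ _

/-- A loop with a polynomially bounded number of rounds is feasible as soon as its body is feasible
and the numbers of digits of its intermediate results are polynomially bounded. -/
theorem Feas.loop {n x : (ℕ → ℕ) → (ℕ → ℕ) → ℕ} {F : ℕ → ℕ → (ℕ → ℕ) → (ℕ → ℕ) → ℕ}
    (hn : Feas n) (sn : Small n) (hx : Feas x)
    (hF : Feas (fun s b => F (s 0) (b 0) (fun j => s (j + 1)) (fun j => b (j + 1))))
    (hb : ∃ e, ∀ N, 2 ≤ N → ∀ s b, Admissible N (s, b) → ∀ i ≤ n s b,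
      (RAM.loop (fun i a => F i a s b) (x s b) i).size ≤ N ^ e) :
    Feas (fun s b => RAM.loop (fun i a => F i a s b) (x s b) (n s b)) := by
  refine ⟨?_, fun ρ ρ' base hρ hρ' o => ?_⟩
  · obtain ⟨e, he⟩ := hb
    exact ⟨e, fun N hN x hx => he N hN _ _ hx _ le_rfl⟩
  obtain ⟨cn, Gn, Tn, n1, n2, n3, n4⟩ := hn.2 ρ ρ' base hρ hρ' o
  obtain ⟨cx, Gx, Tx, x1, x2, x3, x4⟩ := hx.2 ρ ρ' (base + 1)
    (fun j => (hρ j).trans (by omega)) (fun j => (hρ' j).trans (by omega)) (o + cn.length)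
  -- the first line of the loop
  obtain ⟨l, hl⟩ : ∃ l, l = o + cn.length + cx.length + 1 := ⟨_, rfl⟩
  -- the cell of the index is `base + 2`, that of the accumulator is `base + 1`
  obtain ⟨cF, GF, TF, F1, F2, F3, F4⟩ := hF.2 (place (base + 2) ρ) (place (base + 1) ρ') (base + 4)
    (place_lt (by omega) fun j => (hρ j).trans (by omega))
    (place_lt (by omega) fun j => (hρ' j).trans (by omega)) (l + 2)
  obtain ⟨tail, htail⟩ : ∃ tail : List Instr, tail = [Instr.const (base + 3) 0,
    .add (base + 1) (base + 4) (base + 3), .const (base + 3) 1,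
    .add (base + 2) (base + 2) (base + 3), .jump l, .const (base + 3) 0,
    .add base (base + 1) (base + 3)] := ⟨_, rfl⟩
  let M1 : Memory → Memory := fun M => Function.update M (base + 3) (M base - M (base + 2))
  let M4 : Memory → Memory := fun M => Function.update (Function.update (Function.update
    (Function.update (GF (M1 M)) (base + 3) 0) (base + 1) (GF (M1 M) (base + 4))) (base + 3) 1)
    (base + 2) (GF (M1 M) (base + 2) + 1)
  let S : Memory → ℕ → Memory := fun R i =>
    Nat.rec (Function.update (Gx (Gn R)) (base + 2) 0) (fun _ M => M4 M) i
  have S0 : ∀ R, S R 0 = Function.update (Gx (Gn R)) (base + 2) 0 := fun R => rfl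
  have SS : ∀ R i, S R (i + 1) = M4 (S R i) := fun R i => rfl
  -- the invariant of the loop
  have inv : ∀ R i, (∀ j < base, S R i j = R j) ∧
      S R i base = n (fun j => R (ρ j)) (fun j => R (ρ' j)) ∧
      S R i (base + 1) = RAM.loop (fun i a => F i a (fun j => R (ρ j)) (fun j => R (ρ' j)))
        (x (fun j => R (ρ j)) (fun j => R (ρ' j))) i ∧ S R i (base + 2) = i := by
    intro R i
    induction i with
    | zero =>
      refine ⟨fun j hj => ?_, ?_, ?_, ?_⟩
      · rw [S0, Function.update_of_ne (by omega), x2 _ _ (by omega), n2 _ _ hj]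
      · rw [S0, Function.update_of_ne (by omega), x2 _ _ (by omega), n3]
      · rw [S0, Function.update_of_ne (by omega), x3]
        simp only [n2 _ _ (hρ _), n2 _ _ (hρ' _), RAM.loop]
      · rw [S0, Function.update_self]
    | succ i ih =>
      obtain ⟨i1, i2, i3, i4⟩ := ih
      have a1 : ∀ j < base, M1 (S R i) j = R j := fun j hj => by
        simp only [M1]; rw [Function.update_of_ne (by omega), i1 j hj]
      rw [SS]
      refine ⟨fun j hj => ?_, ?_, ?_, ?_⟩
      · simp only [M4]
        rw [Function.update_of_ne (by omega), Function.update_of_ne (by omega),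
          Function.update_of_ne (by omega), Function.update_of_ne (by omega), F2 _ _ (by omega),
          a1 j hj]
      · simp only [M4]
        rw [Function.update_of_ne (by omega), Function.update_of_ne (by omega),
          Function.update_of_ne (by omega), Function.update_of_ne (by omega), F2 _ _ (by omega)]
        simp only [M1]
        rw [Function.update_of_ne (by omega), i2]
      · simp only [M4]
        rw [Function.update_of_ne (by omega), Function.update_of_ne (by omega),
          Function.update_self, F3]
        simp only [place, RAM.loop, a1 _ (hρ _), a1 _ (hρ' _)]
        congr 1
        · simp only [M1]; rw [Function.update_of_ne (by omega), i4]
        · simp only [M1]; rw [Function.update_of_ne (by omega), i3]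
      · simp only [M4]
        rw [Function.update_self, F2 _ _ (by omega)]
        simp only [M1]
        rw [Function.update_of_ne (by omega), i4]
  -- the cost of the test and of the body
  let C0 : Memory → ℕ := fun M => Instr.cost (.sub (base + 3) base (base + 2)) M +
    Instr.cost (.jumpZero (base + 3) (l + 2 + cF.length + 5)) (M1 M)
  let B : Memory → ℕ := fun M => C0 M + (TF (M1 M) + (Instr.cost (.const (base + 3) 0) M +
    (1 + (base + 1).size + (base + 4).size + (base + 3).size +
      (GF (M1 M) (base + 4)).size + Nat.size 0) + Instr.cost (.const (base + 3) 1) M +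
    (1 + (base + 2).size + (base + 2).size + (base + 3).size +
      (GF (M1 M) (base + 2)).size + Nat.size 1) + Instr.cost (.jump l) M))
  let E : Memory → ℕ := fun M => C0 M + (Instr.cost (.const (base + 3) 0) M +
    (1 + base.size + (base + 1).size + (base + 3).size + (M (base + 1)).size + Nat.size 0))
  let nn : Memory → ℕ := fun R => n (fun j => R (ρ j)) (fun j => R (ρ' j))
  refine ⟨cn ++ (cx ++ (.const (base + 2) 0 :: .sub (base + 3) base (base + 2) ::
      .jumpZero (base + 3) (l + 2 + cF.length + 5) :: (cF ++ tail))),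
    fun R => Function.update (Function.update (M1 (S R (nn R))) (base + 3) 0) base
      (S R (nn R) (base + 1)),
    fun R => Tn R + (Tx (Gn R) + (Instr.cost (.const (base + 2) 0) R +
      ((∑ i ∈ Finset.range (nn R), B (S R i)) + E (S R (nn R))))), ?_, ?_, ?_, ?_⟩
  · intro P hP R
    obtain ⟨p1, hP⟩ := hP.append
    obtain ⟨p2, hP⟩ := hP.append
    obtain ⟨p3, hP⟩ := hP.cons
    rw [← hl] at hP
    obtain ⟨p4, hP⟩ := hP.cons
    obtain ⟨p5, hP⟩ := hP.cons
    obtain ⟨p6, hP⟩ := hP.append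
    rw [htail] at hP
    obtain ⟨q1, hP⟩ := hP.cons
    obtain ⟨q2, hP⟩ := hP.cons
    obtain ⟨q3, hP⟩ := hP.cons
    obtain ⟨q4, hP⟩ := hP.cons
    obtain ⟨q5, hP⟩ := hP.cons
    obtain ⟨q6, hP⟩ := hP.cons
    obtain ⟨q7, hP⟩ := hP.cons
    refine (n1 P p1 R).trans ((x1 P p2 (Gn R)).trans ((Reach.one p3).trans ?_))
    simp only [Instr.exec]
    rw [← hl]
    refine Reach.trans (C' := ⟨l, S R (nn R)⟩) ?_ ?_
    · -- the rounds
      suffices h : ∀ i ≤ nn R, Reach P ⟨l, S R 0⟩ (∑ i ∈ Finset.range i, B (S R i)) ⟨l, S R i⟩ from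
        h _ le_rfl
      intro i
      induction i with
      | zero => intro _; simpa using Reach.refl _ _
      | succ i ih =>
        intro hi
        rw [Finset.sum_range_succ]
        refine (ih (by omega)).trans ?_
        obtain ⟨i1, i2, i3, i4⟩ := inv R i
        have hne : M1 (S R i) (base + 3) ≠ 0 := by
          simp only [M1, Function.update_self, i2, i4]
          simp only [nn] at hi
          omega
        have r1 := (Reach.one (R := S R i) p4).trans (Reach.one p5)
        simp only [Instr.exec] at r1
        rw [if_neg hne] at r1
        have r2 := (Reach.one (R := GF (M1 (S R i))) q1).trans ((Reach.one q2).trans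
          ((Reach.one q3).trans ((Reach.one q4).trans (Reach.one q5))))
        have r3 := r1.trans ((F1 P p6 (M1 (S R i))).trans r2)
        rw [SS]
        convert r3 using 1
        · simp [B, C0, Instr.cost, M1]; ring
        · simp [Instr.exec, M4]
    · -- the exit
      obtain ⟨i1, i2, i3, i4⟩ := inv R (nn R)
      have he : M1 (S R (nn R)) (base + 3) = 0 := by
        simp only [M1, Function.update_self, i2, i4]
        simp [nn]
      have r1 := (Reach.one (R := S R (nn R)) p4).trans (Reach.one p5)
      simp only [Instr.exec] at r1
      rw [if_pos he] at r1
      have r3 := r1.trans ((Reach.one q6).trans (Reach.one q7))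
      convert r3 using 1
      · simp [E, C0, Instr.cost, M1]
      · simp [Instr.exec, M1, htail, hl]; omega
  · intro R j hj
    obtain ⟨i1, i2, i3, i4⟩ := inv R (nn R)
    beta_reduce
    rw [Function.update_of_ne (by omega), Function.update_of_ne (by omega)]
    simp only [M1]
    rw [Function.update_of_ne (by omega), i1 j hj]
  · intro R
    obtain ⟨i1, i2, i3, i4⟩ := inv R (nn R)
    beta_reduce
    rw [Function.update_self, i3]
  · -- the time
    have key : ∀ {u : (ℕ → ℕ) × (ℕ → ℕ) → ℕ}, PolyBdd Admissible u →
        PolyBdd (fun N (R : Memory) => Admissible N (fun j => R (ρ j), fun j => R (ρ' j)))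
          (fun R => u (fun j => R (ρ j), fun j => R (ρ' j))) := fun hu =>
      PolyBdd.comp (e := 0) hu (h := fun R : Memory => (fun j => R (ρ j), fun j => R (ρ' j)))
        fun N _ x hx => hx.mono (by simp)
    -- bounds for the states of the loop
    let Q : ℕ → Memory × ℕ → Prop := fun N x =>
      Admissible N (fun j => x.1 (ρ j), fun j => x.1 (ρ' j)) ∧ x.2 < nn x.1 + 1
    have lift : ∀ {u : Memory → ℕ}, PolyBdd (fun N (R : Memory) =>
        Admissible N (fun j => R (ρ j), fun j => R (ρ' j))) u → PolyBdd Q (fun x => u x.1) :=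
      fun ⟨e, he⟩ => ⟨e, fun N hN x hx => he N hN _ hx.1⟩
    have snn : PolyBdd Q (fun x => nn x.1) := lift (key sn)
    have si : PolyBdd Q (fun x => x.2) := by
      obtain ⟨e, he⟩ := snn
      exact ⟨e, fun N hN x hx => (Nat.lt_succ_iff.1 hx.2).trans (he N hN x hx)⟩
    have sacc : PolyBdd Q (fun x => (S x.1 x.2 (base + 1)).size) := by
      obtain ⟨e, he⟩ := hb
      refine ⟨e, fun N hN x hx => ?_⟩
      beta_reduce
      rw [(inv x.1 x.2).2.2.1]
      exact he N hN _ _ hx.1 _ (Nat.lt_succ_iff.1 hx.2)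
    have hC0 : PolyBdd Q (fun x => C0 (S x.1 x.2)) := by
      have : ∀ x : Memory × ℕ, C0 (S x.1 x.2) =
          (1 + (base + 3).size + base.size + (base + 2).size) + (nn x.1).size + (x.2).size +
          ((1 + (base + 3).size + (l + 2 + cF.length + 5).size) + (nn x.1 - x.2).size) := by
        intro x
        obtain ⟨i1, i2, i3, i4⟩ := inv x.1 x.2
        simp only [C0, Instr.cost, M1, Function.update_self, i2, i4, nn]
      simp only [this]
      exact (((PolyBdd.const _).add (snn.mono fun _ => size_le_self _)).add
        (si.mono fun _ => size_le_self _)).add ((PolyBdd.const _).add (snn.mono fun x =>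
          (size_le_self _).trans (Nat.sub_le _ _)))
    have env : ∃ e, ∀ N, 2 ≤ N → ∀ x, Q N x → Admissible (N ^ (e + 1))
        (fun j => M1 (S x.1 x.2) (place (base + 2) ρ j),
          fun j => M1 (S x.1 x.2) (place (base + 1) ρ' j)) := by
      obtain ⟨e1, he1⟩ := si
      obtain ⟨e2, he2⟩ := sacc
      refine ⟨e1 + e2, fun N hN x hx => ?_⟩
      obtain ⟨i1, i2, i3, i4⟩ := inv x.1 x.2
      have b1 : N ^ e1 ≤ N ^ (e1 + e2 + 1) := Nat.pow_le_pow_right (by omega) (by omega)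
      have b2 : N ^ e2 ≤ N ^ (e1 + e2 + 1) := Nat.pow_le_pow_right (by omega) (by omega)
      have b3 : N ≤ N ^ (e1 + e2 + 1) := Nat.le_self_pow (by omega) N
      constructor
      · rintro (_ | j)
        · simp only [place, M1]
          rw [Function.update_of_ne (by omega), i4]
          exact (he1 N hN x hx).trans b1
        · simp only [place, M1]
          have := hρ j
          rw [Function.update_of_ne (by omega), i1 _ this]
          exact (hx.1.1 j).trans b3
      · rintro (_ | j)
        · simp only [place, M1]
          rw [Function.update_of_ne (by omega)]
          exact (he2 N hN x hx).trans b2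
        · simp only [place, M1]
          have := hρ' j
          rw [Function.update_of_ne (by omega), i1 _ this]
          exact (hx.1.2 j).trans b3
    obtain ⟨e, he⟩ := env
    have hB : PolyBdd Q (fun x => B (S x.1 x.2)) := by
      have r1 : PolyBdd Q (fun x => TF (M1 (S x.1 x.2))) :=
        PolyBdd.comp (Q' := fun N M => Admissible N (fun j => M (place (base + 2) ρ j),
          fun j => M (place (base + 1) ρ' j))) F4 he
      have r2 : PolyBdd Q (fun x => (GF (M1 (S x.1 x.2)) (base + 4)).size) := by
        simp only [F3]
        exact PolyBdd.comp (Q' := Admissible) hF.1 (h := fun x : Memory × ℕ =>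
          (fun j => M1 (S x.1 x.2) (place (base + 2) ρ j),
            fun j => M1 (S x.1 x.2) (place (base + 1) ρ' j))) he
      have r3 : PolyBdd Q (fun x => (GF (M1 (S x.1 x.2)) (base + 2)).size) := by
        refine si.mono fun x => ?_
        rw [F2 _ _ (by omega)]
        simp only [M1]
        rw [Function.update_of_ne (by omega), (inv x.1 x.2).2.2.2]
        exact size_le_self _
      simp only [B, Instr.cost]
      exact hC0.add (r1.add (((((PolyBdd.const _).add (((PolyBdd.const _).add r2).add
        (PolyBdd.const _))).add (PolyBdd.const _)).add (((PolyBdd.const _).add r3).add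
        (PolyBdd.const _))).add (PolyBdd.const _)))
    have hE : PolyBdd Q (fun x => E (S x.1 x.2)) := by
      simp only [E, Instr.cost]
      exact hC0.add ((PolyBdd.const _).add (((PolyBdd.const _).add sacc).add (PolyBdd.const _)))
    refine n4.add (PolyBdd.add ?_ (PolyBdd.add (PolyBdd.const _) (PolyBdd.add ?_ ?_)))
    · exact PolyBdd.comp (e := 0) x4 (h := Gn) fun N _ R hR => by
        simp only [n2 _ _ (hρ _), n2 _ _ (hρ' _)]; exact hR.mono (by simp)
    · refine PolyBdd.sum (key sn) (g := fun x => B (S x.1 x.2)) ?_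
      obtain ⟨e, he⟩ := hB
      exact ⟨e, fun N hN x hx => he N hN x ⟨hx.1, hx.2.trans (Nat.lt_succ_self _)⟩⟩
    · obtain ⟨e, he⟩ := hE
      exact ⟨e, fun N hN R hR => he N hN (R, nn R) ⟨hR, Nat.lt_succ_self _⟩⟩

end RAM

namespace RAM

/-! ### Closure properties of feasible functions -/

/-- A feasible function with polynomially bounded values. -/
def SFeas (f : (ℕ → ℕ) → (ℕ → ℕ) → ℕ) : Prop := Feas f ∧ Small f

open scoped Classical in
/-- A predicate with a feasible indicator function. -/
def PFeas (p : (ℕ → ℕ) → (ℕ → ℕ) → Prop) : Prop := Feas (fun s b => if p s b then 1 else 0)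

section closure

variable {f g n x : (ℕ → ℕ) → (ℕ → ℕ) → ℕ} {p q : (ℕ → ℕ) → (ℕ → ℕ) → Prop}

theorem SFeas.ren (h : SFeas f) (r r' : ℕ → ℕ) :
    SFeas (fun s b => f (fun j => s (r j)) (fun j => b (r' j))) := ⟨h.1.ren r r', h.2.ren r r'⟩

theorem PFeas.ren (h : PFeas p) (r r' : ℕ → ℕ) :
    PFeas (fun s b => p (fun j => s (r j)) (fun j => b (r' j))) := Feas.ren h r r'

theorem SFeas.var (j : ℕ) : SFeas (fun s _ => s j) := ⟨Feas.var j, Small.var j⟩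

theorem SFeas.const (k : ℕ) : SFeas (fun _ _ => k) := ⟨Feas.const k, Small.const k⟩

theorem SFeas.of_le (hf : Feas f) (hg : SFeas g) (h : ∀ s b, f s b ≤ g s b) : SFeas f :=
  ⟨hf, PolyBdd.mono hg.2 fun _ => h _ _⟩

theorem SFeas.add (hf : SFeas f) (hg : SFeas g) : SFeas (fun s b => f s b + g s b) :=
  ⟨hf.1.add hg.1, PolyBdd.add hf.2 hg.2⟩

theorem SFeas.mul (hf : SFeas f) (hg : SFeas g) : SFeas (fun s b => f s b * g s b) :=
  ⟨hf.1.mul hg.1, PolyBdd.mul hf.2 hg.2⟩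

theorem SFeas.sub (hf : SFeas f) (hg : SFeas g) : SFeas (fun s b => f s b - g s b) :=
  .of_le (hf.1.sub hg.1) hf fun _ _ => Nat.sub_le _ _

theorem SFeas.div (hf : SFeas f) (hg : SFeas g) : SFeas (fun s b => f s b / g s b) :=
  .of_le (hf.1.div hg.1) hf fun _ _ => Nat.div_le_self _ _

theorem Feas.mod (hf : Feas f) (hg : Feas g) : Feas (fun s b => f s b % g s b) := by
  simpa only [Nat.mod_eq_sub] using hf.sub (hg.mul (hf.div hg))

theorem SFeas.mod (hf : SFeas f) (hg : SFeas g) : SFeas (fun s b => f s b % g s b) :=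
  .of_le (hf.1.mod hg.1) hf fun _ _ => Nat.mod_le _ _

theorem PFeas.le (hf : Feas f) (hg : Feas g) : PFeas (fun s b => f s b ≤ g s b) := by
  have : ∀ a b : ℕ, 1 - (a - b) = if a ≤ b then 1 else 0 := fun a b => by split_ifs <;> omega
  have h := (Feas.const 1).sub (hf.sub hg)
  simp only [this] at h
  unfold PFeas
  convert h

theorem PFeas.and (hp : PFeas p) (hq : PFeas q) : PFeas (fun s b => p s b ∧ q s b) := by
  have := Feas.mul hp hq
  unfold PFeas
  convert this using 4 with s b
  split_ifs <;> simp_all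

theorem PFeas.not (hp : PFeas p) : PFeas (fun s b => ¬ p s b) := by
  have := (Feas.const 1).sub hp
  unfold PFeas
  convert this using 4 with s b
  split_ifs <;> simp_all

theorem PFeas.or (hp : PFeas p) (hq : PFeas q) : PFeas (fun s b => p s b ∨ q s b) := by
  have := (hp.not.and hq.not).not
  simpa only [not_and_or, not_not] using this

theorem PFeas.eq (hf : Feas f) (hg : Feas g) : PFeas (fun s b => f s b = g s b) := by
  simpa only [le_antisymm_iff] using (PFeas.le hf hg).and (.le hg hf)

theorem PFeas.lt (hf : Feas f) (hg : Feas g) : PFeas (fun s b => f s b < g s b) := by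
  simpa only [not_le] using (PFeas.le hg hf).not

theorem Feas.ite {inst : ∀ s b, Decidable (p s b)} (hp : PFeas p) (hf : Feas f) (hg : Feas g) :
    Feas (fun s b => if p s b then f s b else g s b) := by
  have := (Feas.mul hp hf).add (Feas.mul ((Feas.const 1).sub hp) hg)
  convert this using 3 with s b
  split_ifs <;> simp

theorem SFeas.ite {inst : ∀ s b, Decidable (p s b)} (hp : PFeas p) (hf : SFeas f) (hg : SFeas g) :
    SFeas (fun s b => if p s b then f s b else g s b) :=
  .of_le (.ite hp hf.1 hg.1) (hf.add hg) fun s b => by split_ifs <;> omega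

/-- A loop is feasible if all results of its body obey a common bound. -/
theorem Feas.loop_of_size_le {M : (ℕ → ℕ) → (ℕ → ℕ) → ℕ}
    {F : ℕ → ℕ → (ℕ → ℕ) → (ℕ → ℕ) → ℕ} (hn : SFeas n) (hx : Feas x)
    (hF : Feas (fun s b => F (s 0) (b 0) (fun j => s (j + 1)) (fun j => b (j + 1))))
    (hM : Small M) (h : ∀ i a s b, (F i a s b).size ≤ M s b) :
    Feas (fun s b => RAM.loop (fun i a => F i a s b) (x s b) (n s b)) := by
  refine Feas.loop hn.1 hn.2 hx hF ?_
  obtain ⟨e, he⟩ := PolyBdd.add hM hx.1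
  refine ⟨e, fun N hN s b hsb i _ => ?_⟩
  have := he N hN _ hsb
  cases i with
  | zero => exact (Nat.le_add_left _ _).trans this
  | succ i => exact (h _ _ _ _).trans ((Nat.le_add_right _ _).trans this)

theorem Feas.two_pow (hx : SFeas x) : Feas (fun s b => 2 ^ x s b) := by
  have key : ∀ i, RAM.loop (fun _ a => a * 2) 1 i = 2 ^ i := fun i => by
    induction i with
    | zero => rfl
    | succ i ih => rw [RAM.loop, ih, pow_succ]
  have := Feas.loop (F := fun _ a _ _ => a * 2) hx.1 hx.2 (Feas.const 1)
    ((Feas.bigVar 0).mul (Feas.const 2)) (by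
      obtain ⟨e, he⟩ := PolyBdd.add hx.2 (PolyBdd.const 1)
      refine ⟨e, fun N hN s b hsb i hi => ?_⟩
      rw [key, Nat.size_pow]
      exact (Nat.add_le_add_right hi 1).trans (he N hN _ hsb))
  simpa only [key] using this

theorem loop_add (h : ℕ → ℕ) (m : ℕ) : loop (fun i a => a + h i) 0 m = ∑ i ∈ Finset.range m, h i := by
  induction m with
  | zero => rfl
  | succ m ih => rw [loop, ih, Finset.sum_range_succ]

/-- Extending admissible variables by a bounded index. -/
theorem admissible_cons {N e : ℕ} (hN : 2 ≤ N) {s b : ℕ → ℕ} (h : Admissible N (s, b)) {i : ℕ}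
    (hi : i ≤ N ^ e) : Admissible (N ^ (e + 1)) (place i s, b) := by
  have h1 : N ^ e ≤ N ^ (e + 1) := Nat.pow_le_pow_right (by omega) (by omega)
  have h2 : N ≤ N ^ (e + 1) := Nat.le_self_pow (by omega) N
  refine ⟨?_, fun j => (h.2 j).trans h2⟩
  rintro (_ | j)
  · exact hi.trans h1
  · exact (h.1 j).trans h2

theorem Feas.sum {h : ℕ → (ℕ → ℕ) → (ℕ → ℕ) → ℕ} (hn : SFeas n)
    (hf : Feas (fun s b => h (s 0) (fun j => s (j + 1)) b)) :
    Feas (fun s b => ∑ i ∈ Finset.range (n s b), h i s b) := by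
  have := Feas.loop (F := fun i a s b => a + h i s b) hn.1 hn.2 (Feas.const 0)
    ((Feas.bigVar 0).add (hf.ren id (· + 1))) (by
      obtain ⟨e, he⟩ := hn.2
      obtain ⟨e', he'⟩ := hf.1
      refine ⟨(e + 1) * e' + e + 1, fun N hN s b hsb i hi => ?_⟩
      have h1 := he N hN _ hsb
      have key : ∀ m ≤ n s b, ∑ i ∈ Finset.range m, h i s b ≤ m * 2 ^ (N ^ ((e + 1) * e')) := by
        intro m hm
        calc _ ≤ ∑ i ∈ Finset.range m, 2 ^ (N ^ ((e + 1) * e')) := by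
              refine Finset.sum_le_sum fun i hi => ?_
              have hi := Finset.mem_range.1 hi
              have h2 := he' (N ^ (e + 1)) (hN.trans (Nat.le_self_pow (by omega) N)) _
                (admissible_cons hN hsb (i := i) (e := e) (by simp only at h1; omega))
              rw [← pow_mul] at h2
              exact (Nat.lt_size_self _).le.trans (Nat.pow_le_pow_right (by omega) h2)
          _ = _ := by simp
      rw [loop_add]
      refine (Nat.size_le_size (key i hi)).trans ?_
      have h3 : i < 2 ^ N ^ e :=
        (Nat.lt_two_pow_self (n := i)).trans_le (Nat.pow_le_pow_right (by omega) (hi.trans h1))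
      rw [Nat.size_le]
      calc _ < 2 ^ N ^ e * 2 ^ (N ^ ((e + 1) * e')) :=
            Nat.mul_lt_mul_of_pos_right h3 (by positivity)
        _ = 2 ^ (N ^ e + N ^ ((e + 1) * e')) := (pow_add _ _ _).symm
        _ ≤ _ := by
          refine Nat.pow_le_pow_right (by omega) ?_
          have h4 : N ^ e ≤ N ^ ((e + 1) * e' + e) := Nat.pow_le_pow_right (by omega) (by omega)
          have h5 : N ^ ((e + 1) * e') ≤ N ^ ((e + 1) * e' + e) :=
            Nat.pow_le_pow_right (by omega) (by omega)
          have h6 : N ^ ((e + 1) * e' + e) * 2 ≤ N ^ ((e + 1) * e' + e + 1) := by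
            rw [pow_succ]; exact Nat.mul_le_mul_left _ hN
          omega)
  simpa only [loop_add] using this

theorem PFeas.sfeas {inst : ∀ s b, Decidable (p s b)} (hp : PFeas p) :
    SFeas (fun s b => if p s b then 1 else 0) := .ite hp (.const 1) (.const 0)

theorem PFeas.exists_lt {p : ℕ → (ℕ → ℕ) → (ℕ → ℕ) → Prop} (hn : SFeas n)
    (hp : PFeas (fun s b => p (s 0) (fun j => s (j + 1)) b)) :
    PFeas (fun s b => ∃ i < n s b, p i s b) := by
  classical
  have := PFeas.lt (Feas.const 0) (Feas.sum (h := fun i s b => if p i s b then 1 else 0) hn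
    (PFeas.sfeas hp).1)
  convert this using 3 with s b
  rw [Nat.pos_iff_ne_zero, ne_eq, Finset.sum_eq_zero_iff]
  simp

theorem PFeas.forall_lt {p : ℕ → (ℕ → ℕ) → (ℕ → ℕ) → Prop} (hn : SFeas n)
    (hp : PFeas (fun s b => p (s 0) (fun j => s (j + 1)) b)) :
    PFeas (fun s b => ∀ i < n s b, p i s b) := by
  have := (PFeas.exists_lt (p := fun i s b => ¬ p i s b) hn hp.not).not
  simpa using this

theorem PFeas.testBit (hf : Feas f) (hx : SFeas x) : PFeas (fun s b => (f s b).testBit (x s b)) := by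
  have := PFeas.eq ((hf.div (.two_pow hx)).mod (.const 2)) (.const 1)
  simpa [Nat.testBit_eq_decide_div_mod_eq] using this

end closure

end RAM

/-! ### Sets and arrays as numbers -/

namespace Arith

open scoped Classical in
/-- The number whose binary digits describe the set of all `i < n` with `p i`. -/
noncomputable def mask (n : ℕ) (p : ℕ → Prop) : ℕ :=
  ∑ i ∈ Finset.range n, if p i then 2 ^ i else 0

/-- The entry with index `i` of an array with entries of `L` binary digits. -/
def get (L A i : ℕ) : ℕ := A / 2 ^ (L * i) % 2 ^ L

/-- The array with the entries `f 0, …, f (m - 1)`, truncated to `L` binary digits. -/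
def arr (m L : ℕ) (f : ℕ → ℕ) : ℕ := ∑ i ∈ Finset.range m, f i % 2 ^ L * 2 ^ (L * i)

open scoped Classical in
/-- The least `i < m` with `p i`, and `m` if there is none. -/
noncomputable def search (m : ℕ) (p : ℕ → Prop) : ℕ :=
  ∑ i ∈ Finset.range m, if ∃ j < i + 1, p j then 0 else 1

theorem sum_two_pow_lt {n : ℕ} (c : ℕ → ℕ) (hc : ∀ i, c i ≤ 2 ^ i) :
    ∑ i ∈ Finset.range n, c i < 2 ^ n := by
  induction n with
  | zero => simp
  | succ n ih =>
    rw [Finset.sum_range_succ, pow_succ]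
    have := hc n
    omega

theorem mask_lt (n : ℕ) (p : ℕ → Prop) : mask n p < 2 ^ n := by
  classical
  exact sum_two_pow_lt _ fun i => by split_ifs <;> simp

theorem arr_lt (m L : ℕ) (f : ℕ → ℕ) : arr m L f < 2 ^ (L * m) := by
  induction m with
  | zero => simp [arr]
  | succ m ih =>
    rw [arr, Finset.sum_range_succ, Nat.mul_succ, pow_add]
    have h1 : f m % 2 ^ L < 2 ^ L := Nat.mod_lt _ (by positivity)
    have h2 : (f m % 2 ^ L + 1) * 2 ^ (L * m) ≤ 2 ^ L * 2 ^ (L * m) := Nat.mul_le_mul_right _ h1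
    rw [arr] at ih
    nlinarith

theorem size_mask_le (n : ℕ) (p : ℕ → Prop) : (mask n p).size ≤ n := Nat.size_le.2 (mask_lt n p)

theorem size_arr_le (m L : ℕ) (f : ℕ → ℕ) : (arr m L f).size ≤ L * m :=
  Nat.size_le.2 (arr_lt m L f)

theorem search_le (m : ℕ) (p : ℕ → Prop) : search m p ≤ m := by
  classical
  calc search m p ≤ ∑ i ∈ Finset.range m, 1 := Finset.sum_le_sum fun i _ => by split_ifs <;> simp
    _ = m := by simp

theorem testBit_mask {n : ℕ} {p : ℕ → Prop} {i : ℕ} : (mask n p).testBit i ↔ i < n ∧ p i := by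
  classical
  induction n with
  | zero => simp [mask]
  | succ n ih =>
    have hlt := mask_lt n p
    rw [mask, Finset.sum_range_succ, ← mask]
    by_cases hp : p n
    · rw [if_pos hp, add_comm, ← mul_one (2 ^ n), Nat.testBit_two_pow_mul_add _ hlt]
      by_cases hi : i < n
      · rw [if_pos hi, ih]; constructor <;> rintro ⟨_, h⟩ <;> exact ⟨by omega, h⟩
      · rw [if_neg hi, Nat.testBit_one_eq_true_iff_self_eq_zero]
        constructor
        · intro h; obtain rfl : i = n := by omega
          exact ⟨by omega, hp⟩
        · rintro ⟨h, _⟩; omega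
    · rw [if_neg hp, add_zero, ih]
      constructor
      · rintro ⟨h, h'⟩; exact ⟨by omega, h'⟩
      · rintro ⟨h, h'⟩
        exact ⟨lt_of_le_of_ne (by omega) (by rintro rfl; exact hp h'), h'⟩

theorem get_lt (L A i : ℕ) : get L A i < 2 ^ L := Nat.mod_lt _ (by positivity)

theorem get_arr {m L : ℕ} {f : ℕ → ℕ} {i : ℕ} (hi : i < m) : get L (arr m L f) i = f i % 2 ^ L := by
  induction m with
  | zero => omega
  | succ m ih =>
    have e : arr (m + 1) L f = arr m L f + f m % 2 ^ L * 2 ^ (L * m) := Finset.sum_range_succ _ _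
    have hlt := arr_lt m L f
    by_cases him : i = m
    · subst him
      rw [get, e, Nat.add_mul_div_right _ _ (by positivity), Nat.div_eq_of_lt hlt]
      simp
    · rw [← ih (by omega), get, get, e]
      obtain ⟨k, rfl⟩ : ∃ k, m = i + 1 + k := ⟨m - (i + 1), by omega⟩
      have : f (i + 1 + k) % 2 ^ L * 2 ^ (L * (i + 1 + k)) =
          (f (i + 1 + k) % 2 ^ L * 2 ^ (L * k) * 2 ^ L) * 2 ^ (L * i) := by
        rw [Nat.mul_add, Nat.mul_add, pow_add, pow_add]; ring
      rw [this, Nat.add_mul_div_right _ _ (by positivity), Nat.add_mul_mod_self_right]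

theorem get_of_lt {L A m i : ℕ} (hA : A < 2 ^ (L * m)) (hi : m ≤ i) : get L A i = 0 := by
  rw [get, Nat.div_eq_of_lt, Nat.zero_mod]
  exact hA.trans_le (Nat.pow_le_pow_right (by omega) (Nat.mul_le_mul_left _ hi))

theorem search_eq_find {m : ℕ} {p : ℕ → Prop} {i : ℕ} (hi : i < m) (hp : p i)
    (hmin : ∀ j < i, ¬ p j) : search m p = i := by
  classical
  rw [search, ← Finset.sum_subset (s₁ := Finset.range i)]
  · rw [Finset.sum_congr rfl (g := fun _ => 1)]
    · simp
    · intro j hj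
      rw [if_neg]
      rintro ⟨k, hk, hpk⟩
      exact hmin k (by have := Finset.mem_range.1 hj; omega) hpk
  · exact Finset.range_subset_range.2 hi.le
  · intro j _ hj
    rw [if_pos]
    exact ⟨i, by simpa [Nat.lt_succ_iff] using hj, hp⟩

theorem search_spec {m : ℕ} {p : ℕ → Prop} (h : ∃ i < m, p i) :
    search m p < m ∧ p (search m p) := by
  classical
  have h' : ∃ i, i < m ∧ p i := h
  have := Nat.find_spec h'
  rw [search_eq_find this.1 this.2 fun j hj hp => Nat.find_min h' hj ⟨hj.trans this.1, hp⟩]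
  exact this

theorem of_search_lt {m : ℕ} {p : ℕ → Prop} (h : search m p < m) : p (search m p) := by
  classical
  by_cases h' : ∃ i < m, p i
  · exact (search_spec h').2
  · exfalso
    push Not at h'
    rw [search, Finset.sum_congr rfl (g := fun _ => 1)] at h
    · simp at h
    · intro j hj
      rw [if_neg]
      rintro ⟨k, hk, hpk⟩
      exact h' k (by have := Finset.mem_range.1 hj; omega) hpk

theorem search_lt_iff {m : ℕ} {p : ℕ → Prop} : search m p < m ↔ ∃ i < m, p i :=
  ⟨fun h => ⟨_, h, of_search_lt h⟩, fun h => (search_spec h).1⟩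

end Arith

namespace RAM

open Arith

section

variable {n L A x : (ℕ → ℕ) → (ℕ → ℕ) → ℕ} {p : ℕ → (ℕ → ℕ) → (ℕ → ℕ) → Prop}

theorem Feas.mask (hn : SFeas n) (hp : PFeas (fun s b => p (s 0) (fun j => s (j + 1)) b)) :
    Feas (fun s b => mask (n s b) (fun i => p i s b)) := by
  classical
  exact .sum (h := fun i s b => if p i s b then 2 ^ i else 0) hn
    (.ite hp (.two_pow (.var 0)) (.const 0))

theorem Feas.get (hL : SFeas L) (hA : Feas A) (hx : SFeas x) :
    Feas (fun s b => get (L s b) (A s b) (x s b)) :=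
  (hA.div (.two_pow (hL.mul hx))).mod (.two_pow hL)

theorem Feas.arr {f : ℕ → (ℕ → ℕ) → (ℕ → ℕ) → ℕ} (hn : SFeas n) (hL : SFeas L)
    (hf : Feas (fun s b => f (s 0) (fun j => s (j + 1)) b)) :
    Feas (fun s b => arr (n s b) (L s b) (fun i => f i s b)) :=
  .sum (h := fun i s b => f i s b % 2 ^ L s b * 2 ^ (L s b * i)) hn
    ((hf.mod (.two_pow (hL.ren _ _))).mul (.two_pow ((hL.ren _ _).mul (.var 0))))

theorem SFeas.search (hn : SFeas n) (hp : PFeas (fun s b => p (s 0) (fun j => s (j + 1)) b)) :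
    SFeas (fun s b => search (n s b) (fun i => p i s b)) := by
  classical
  refine .of_le ?_ hn fun s b => search_le _ _
  refine .sum (h := fun i s b => if ∃ j < i + 1, p j s b then 0 else 1) hn
    (.ite ?_ (.const 0) (.const 1))
  exact .exists_lt (p := fun i s b => p i (fun j => s (j + 1)) b) ((SFeas.var 0).add (.const 1))
    (hp.ren (fun j => Nat.casesOn j 0 fun j => j + 2) id)

end

end RAM

/-! ### The algorithm -/

namespace Alg

open Arith RAM

/-- Adjacency in the graph on the vertices `0, …, n - 1` that is encoded by `A`. -/
def adj (n A u v : ℕ) : Prop := A.testBit (u * n + v)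

/-- The price of the column `j` in the state `S` of the auction. An entry of a state combines the
price of a column with the row that owns it; the owner is shifted by one, so that `0` stands for
no owner. -/
def price (n S j : ℕ) : ℕ := get (2 * n + 4) S j / (n + 1)

/-- The owner of the column `j` in the state `S` of the auction, shifted by one. -/
def owner (n S j : ℕ) : ℕ := get (2 * n + 4) S j % (n + 1)

/-- The first row that owns no column, and `n` if there is none. -/
noncomputable def freeRow (n S : ℕ) : ℕ := search n fun i => ∀ j < n, owner n S j ≠ i + 1

/-- A cheapest column among those that are adjacent to the row `i`. -/
noncomputable def cheapest (n A S i : ℕ) : ℕ :=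
  search n fun j => adj n A i j ∧ ∀ k < n, ¬ adj n A i k ∨ price n S j ≤ price n S k

open scoped Classical in
/-- One step of the auction: a row without a column takes over a cheapest one and raises its
price. -/
noncomputable def bid (n A S : ℕ) : ℕ :=
  arr n (2 * n + 4) fun j =>
    if freeRow n S < n ∧ j = cheapest n A S (freeRow n S) then
      (price n S j + 1) * (n + 1) + (freeRow n S + 1)
    else get (2 * n + 4) S j

/-- The state after the auction. -/
noncomputable def auction (n A : ℕ) : ℕ := loop (fun _ S => bid n A S) 0 (n * (n + 1) + 1)

/-- The column that the row `v` owns after the auction. -/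
noncomputable def mate (n A v : ℕ) : ℕ := search n fun j => owner n (auction n A) j = v + 1

/-- The arcs of the digraph on the vertices of the graph that arises from the bipartite double cover
by contracting the perfect matching found by the auction. -/
def arc (n A u v : ℕ) : Prop := adj n A u (mate n A v)

/-- The set of the vertices that can be reached from `u` by arcs whose heads are not in `W`. -/
noncomputable def reach (n A W u : ℕ) : ℕ :=
  loop (fun _ m => mask n fun x => m.testBit x ∨
    (¬ W.testBit x ∧ ∃ y < n, m.testBit y ∧ arc n A y x)) (2 ^ u) n

/-- The digit `j` of `c` in base `B`. -/
def digit (B c j : ℕ) : ℕ := loop (fun _ a => a / B) c j % B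

/-- The set with the code `c`: the codes less than `(2 * n + 1) ^ q` represent the subsets of
`{0, …, 2 * n - 1}` with at most `q` elements, by the digits of the code other than `0`. -/
noncomputable def coded (n q c : ℕ) : ℕ :=
  mask (2 * n) fun x => ∃ j < q, digit (2 * n + 1) c j = x + 1

/-- The vertices outside `W` and `W'` that are strongly connected to `v` outside `W` (for `v = n`
this condition is void) and do not come after `x` in the linear preorder of the vertices outside
`W'`. -/
noncomputable def block (n A W v W' x : ℕ) : ℕ :=
  mask n fun u => ¬ W.testBit u ∧ ¬ W'.testBit u ∧ (v = n ∨ reach n A W u = reach n A W v) ∧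
    reach n A W' u ≤ reach n A W' x

/-- The number of the sets in the family. -/
def famNum (n N : ℕ) : ℕ := n + n * N * (n + 1) * N

open scoped Classical in
/-- The family of sets for which the algorithm computes tables: the singletons and the blocks for
sets `W` and `W'` with codes less than `N`. -/
noncomputable def fam (n A w N f : ℕ) : ℕ :=
  if f < n then 2 ^ f else
    block n A (coded n w ((f - n) / n / N / (n + 1))) ((f - n) / n / N % (n + 1))
      (coded n w ((f - n) / n % N)) ((f - n) % n)

/-- The entry of the table `T` for the set `U` of rows (`u` for row `u`) and columns (`n + v` for
column `v`). -/
noncomputable def val (n w N T U : ℕ) : ℕ :=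
  get (n * n + 1) T (search (N ^ 12) fun c => coded n (12 * w) c = U)

open scoped Classical in
/-- The table of the singleton of `u`. -/
noncomputable def baseTable (n w N u : ℕ) : ℕ :=
  arr (N ^ 12) (n * n + 1) fun c =>
    if coded n (12 * w) c = 0 ∨ coded n (12 * w) c = 2 ^ u + 2 ^ (n + u) then 1 else 0

/-- The rows and columns in `U` that belong to vertices in `X`. -/
noncomputable def inter (n U X : ℕ) : ℕ := mask (2 * n) fun x => U.testBit x ∧ X.testBit (x % n)

/-- The table of a disjoint union without the arcs between the two parts. -/
noncomputable def product (n w N X Y S T : ℕ) : ℕ :=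
  arr (N ^ 12) (n * n + 1) fun c =>
    val n w N S (inter n (coded n (12 * w) c) X) * val n w N T (inter n (coded n (12 * w) c) Y)

/-- The arc from `u` to `v` lies inside `Z`, but neither inside `X` nor inside `Y`. -/
def IsCross (n A X Y Z u v : ℕ) : Prop :=
  arc n A u v ∧ Z.testBit u ∧ Z.testBit v ∧ ¬ (X.testBit u ∧ X.testBit v) ∧
    ¬ (Y.testBit u ∧ Y.testBit v)

open scoped Classical in
/-- Add the arc from `u` to `v` to a table, provided that it passes between `X` and `Y`. -/
noncomputable def addArc (n A w N X Y Z u v G : ℕ) : ℕ :=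
  arr (N ^ 12) (n * n + 1) fun c =>
    get (n * n + 1) G c +
      if IsCross n A X Y Z u v ∧ ¬ (coded n (12 * w) c).testBit u ∧
          ¬ (coded n (12 * w) c).testBit (n + v) then
        val n w N G (coded n (12 * w) c + 2 ^ u + 2 ^ (n + v))
      else 0

/-- The table of the disjoint union `Z` of `X` and `Y`. -/
noncomputable def merge (n A w N X Y Z S T : ℕ) : ℕ :=
  loop (fun p G => addArc n A w N X Y Z (p / n) (p % n) G) (product n w N X Y S T) (n * n)

/-- The number of digits that are reserved for the table of one set. -/
def width (n N : ℕ) : ℕ := (n * n + 1) * N ^ 12 + 1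

open scoped Classical in
/-- At the beginning only the singletons have tables. A table `T` is stored as `2 * T + 1`; a missing
table is stored as `0`. -/
noncomputable def tables₀ (n w N : ℕ) : ℕ :=
  arr (famNum n N) (width n N) fun f => if f < n then 2 * baseTable n w N f + 1 else 0

/-- The set `f` is the disjoint union of the sets `xy / famNum n N` and `xy % famNum n N`, which
have tables. -/
def IsSplit (n A w N S f xy : ℕ) : Prop :=
  get (width n N) S (xy / famNum n N) ≠ 0 ∧ get (width n N) S (xy % famNum n N) ≠ 0 ∧
    ∀ u < n, (¬ (fam n A w N f).testBit u ∨ (fam n A w N (xy / famNum n N)).testBit u ∨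
        (fam n A w N (xy % famNum n N)).testBit u) ∧
      ((fam n A w N f).testBit u ∨ ¬ (fam n A w N (xy / famNum n N)).testBit u) ∧
      ((fam n A w N f).testBit u ∨ ¬ (fam n A w N (xy % famNum n N)).testBit u) ∧
      ¬ ((fam n A w N (xy / famNum n N)).testBit u ∧ (fam n A w N (xy % famNum n N)).testBit u)

/-- A way to split the set `f`. -/
noncomputable def split (n A w N S f : ℕ) : ℕ :=
  search (famNum n N * famNum n N) fun xy => IsSplit n A w N S f xy

open scoped Classical in
/-- Compute tables for all sets that are disjoint unions of two sets with tables. -/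
noncomputable def round (n A w N S : ℕ) : ℕ :=
  arr (famNum n N) (width n N) fun f =>
    if get (width n N) S f = 0 ∧ split n A w N S f < famNum n N * famNum n N then
      2 * merge n A w N (fam n A w N (split n A w N S f / famNum n N))
        (fam n A w N (split n A w N S f % famNum n N)) (fam n A w N f)
        (get (width n N) S (split n A w N S f / famNum n N) / 2)
        (get (width n N) S (split n A w N S f % famNum n N) / 2) + 1
    else get (width n N) S f

/-- All tables that are found in `n` rounds. -/
noncomputable def tables (n A w N : ℕ) : ℕ :=
  loop (fun _ S => round n A w N S) (tables₀ n w N) n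

/-- The square root of `P`, digit by digit. -/
def isqrt (L P : ℕ) : ℕ :=
  loop (fun i r => if (r + 2 ^ (L - 1 - i)) * (r + 2 ^ (L - 1 - i)) ≤ P then r + 2 ^ (L - 1 - i)
    else r) 0 L

/-- The index of the set of all vertices, provided that it has a table. -/
noncomputable def full (n A w N : ℕ) : ℕ :=
  search (famNum n N) fun f => fam n A w N f = 2 ^ n - 1 ∧
    get (width n N) (tables n A w N) f ≠ 0

open scoped Classical in
/-- The outcome for the parameter `w`: either `0`, or the number of perfect matchings increased
by one. The parameter `0` is excluded, because even the table of a singleton needs an entry for a set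
of two elements. -/
noncomputable def outcome (n A w N : ℕ) : ℕ :=
  if 0 < w ∧ full n A w N < famNum n N then
    isqrt (n * n + 1) (val n w N (get (width n N) (tables n A w N) (full n A w N) / 2) 0) + 1
  else 0

end Alg

namespace RAM

open Arith Alg

theorem SFeas.s1 {f : (ℕ → ℕ) → (ℕ → ℕ) → ℕ} (h : SFeas f) :
    SFeas (fun s b => f (fun j => s (j + 1)) b) := h.ren (· + 1) id

theorem SFeas.sb1 {f : (ℕ → ℕ) → (ℕ → ℕ) → ℕ} (h : SFeas f) :
    SFeas (fun s b => f (fun j => s (j + 1)) (fun j => b (j + 1))) := h.ren (· + 1) (· + 1)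

theorem Feas.s1 {f : (ℕ → ℕ) → (ℕ → ℕ) → ℕ} (h : Feas f) :
    Feas (fun s b => f (fun j => s (j + 1)) b) := h.ren (· + 1) id

theorem Feas.sb1 {f : (ℕ → ℕ) → (ℕ → ℕ) → ℕ} (h : Feas f) :
    Feas (fun s b => f (fun j => s (j + 1)) (fun j => b (j + 1))) := h.ren (· + 1) (· + 1)

theorem SFeas.pow {f : (ℕ → ℕ) → (ℕ → ℕ) → ℕ} (h : SFeas f) (k : ℕ) :
    SFeas (fun s b => f s b ^ k) := by
  induction k with
  | zero => simpa using SFeas.const 1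
  | succ k ih => simpa only [pow_succ] using ih.mul h

section

variable {n A w N u v W W' x S T X Y Z U f g B c : (ℕ → ℕ) → (ℕ → ℕ) → ℕ}

theorem PFeas.adj (hn : SFeas n) (hA : Feas A) (hu : SFeas u) (hv : SFeas v) :
    PFeas (fun s b => adj (n s b) (A s b) (u s b) (v s b)) :=
  .testBit hA ((hu.mul hn).add hv)

theorem SFeas.stateWidth (hn : SFeas n) : SFeas (fun s b => 2 * n s b + 4) :=
  ((const 2).mul hn).add (const 4)

theorem Feas.price (hn : SFeas n) (hS : Feas S) (hx : SFeas x) :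
    Feas (fun s b => price (n s b) (S s b) (x s b)) :=
  (Feas.get hn.stateWidth hS hx).div (hn.add (.const 1)).1

theorem Feas.owner (hn : SFeas n) (hS : Feas S) (hx : SFeas x) :
    Feas (fun s b => owner (n s b) (S s b) (x s b)) :=
  (Feas.get hn.stateWidth hS hx).mod (hn.add (.const 1)).1

theorem SFeas.freeRow (hn : SFeas n) (hS : Feas S) :
    SFeas (fun s b => freeRow (n s b) (S s b)) :=
  .search (p := fun i s b => ∀ j < n s b, Alg.owner (n s b) (S s b) j ≠ i + 1) hn
    (.forall_lt hn.s1
      (p := fun j s b => Alg.owner (n (fun j => s (j + 1)) b) (S (fun j => s (j + 1)) b) j ≠ s 0 + 1)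
      (PFeas.not (.eq (.owner hn.s1.s1 hS.s1.s1 (.var 0)) ((SFeas.var 1).add (.const 1)).1)))

theorem SFeas.cheapest (hn : SFeas n) (hA : Feas A) (hS : Feas S) (hx : SFeas x) :
    SFeas (fun s b => cheapest (n s b) (A s b) (S s b) (x s b)) :=
  .search (p := fun j s b => Alg.adj (n s b) (A s b) (x s b) j ∧ ∀ k < n s b,
      ¬ Alg.adj (n s b) (A s b) (x s b) k ∨
        Alg.price (n s b) (S s b) j ≤ Alg.price (n s b) (S s b) k) hn
    ((PFeas.adj hn.s1 hA.s1 hx.s1 (.var 0)).and (.forall_lt hn.s1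
      (p := fun k s b => ¬ Alg.adj (n (fun j => s (j + 1)) b) (A (fun j => s (j + 1)) b)
          (x (fun j => s (j + 1)) b) k ∨
        Alg.price (n (fun j => s (j + 1)) b) (S (fun j => s (j + 1)) b) (s 0) ≤
          Alg.price (n (fun j => s (j + 1)) b) (S (fun j => s (j + 1)) b) k)
      ((PFeas.adj hn.s1.s1 hA.s1.s1 hx.s1.s1 (.var 0)).not.or
        (.le (.price hn.s1.s1 hS.s1.s1 (.var 1)) (.price hn.s1.s1 hS.s1.s1 (.var 0))))))

theorem Feas.bid (hn : SFeas n) (hA : Feas A) (hS : Feas S) :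
    Feas (fun s b => bid (n s b) (A s b) (S s b)) := by
  classical
  have hF := SFeas.freeRow hn.s1 hS.s1
  exact .arr hn hn.stateWidth (.ite ((PFeas.lt hF.1 hn.s1.1).and
      (.eq (.var 0) (SFeas.cheapest hn.s1 hA.s1 hS.s1 hF).1))
    ((((Feas.price hn.s1 hS.s1 (.var 0)).add (.const 1)).mul (hn.s1.add (.const 1)).1).add
      (hF.add (.const 1)).1) (.get hn.s1.stateWidth hS.s1 (.var 0)))

theorem Feas.auction (hn : SFeas n) (hA : Feas A) :
    Feas (fun s b => auction (n s b) (A s b)) :=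
  .loop_of_size_le (F := fun _ S s b => Alg.bid (n s b) (A s b) S)
    ((hn.mul (hn.add (.const 1))).add (.const 1)) (.const 0)
    (.bid hn.sb1 hA.sb1 (.bigVar 0)) (hn.stateWidth.mul hn).2 fun _ _ _ _ => size_arr_le _ _ _

theorem SFeas.mate (hn : SFeas n) (hA : Feas A) (hv : SFeas v) :
    SFeas (fun s b => mate (n s b) (A s b) (v s b)) :=
  .search (p := fun j s b => Alg.owner (n s b) (Alg.auction (n s b) (A s b)) j = v s b + 1) hn
    (.eq (.owner hn.s1 (.auction hn.s1 hA.s1) (.var 0)) (hv.s1.add (.const 1)).1)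

theorem PFeas.arc (hn : SFeas n) (hA : Feas A) (hu : SFeas u) (hv : SFeas v) :
    PFeas (fun s b => arc (n s b) (A s b) (u s b) (v s b)) :=
  .adj hn hA hu (.mate hn hA hv)

theorem Feas.reach (hn : SFeas n) (hA : Feas A) (hW : Feas W) (hu : SFeas u) :
    Feas (fun s b => reach (n s b) (A s b) (W s b) (u s b)) :=
  .loop_of_size_le (F := fun _ m s b => Arith.mask (n s b) fun x => m.testBit x ∨
      (¬ (W s b).testBit x ∧ ∃ y < n s b, m.testBit y ∧ Alg.arc (n s b) (A s b) y x))
    hn (.two_pow hu)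
    (.mask hn.sb1 (p := fun x s b => (b 0).testBit x ∨
        (¬ (W (fun j => s (j + 1)) (fun j => b (j + 1))).testBit x ∧
          ∃ y < n (fun j => s (j + 1)) (fun j => b (j + 1)), (b 0).testBit y ∧
            Alg.arc (n (fun j => s (j + 1)) (fun j => b (j + 1)))
              (A (fun j => s (j + 1)) (fun j => b (j + 1))) y x))
      ((PFeas.testBit (.bigVar 0) (.var 0)).or
        ((PFeas.testBit hW.sb1.s1 (.var 0)).not.and
          (.exists_lt (p := fun y s b => (b 0).testBit y ∧
              Alg.arc (n (fun j => s (j + 1 + 1)) (fun j => b (j + 1)))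
                (A (fun j => s (j + 1 + 1)) (fun j => b (j + 1))) y (s 0)) hn.sb1.s1
            ((PFeas.testBit (.bigVar 0) (.var 0)).and
              (.arc hn.sb1.s1.s1 hA.sb1.s1.s1 (.var 0) (.var 1)))))))
    hn.2 fun _ _ _ _ => size_mask_le _ _

theorem SFeas.digit (hB : SFeas B) (hc : SFeas c) (hx : SFeas x) :
    SFeas (fun s b => digit (B s b) (c s b) (x s b)) := by
  have key : ∀ B c j : ℕ, RAM.loop (fun _ a => a / B) c j ≤ c := fun B c j => by
    induction j with
    | zero => exact le_rfl
    | succ j ih => exact (Nat.div_le_self _ _).trans ih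
  have : Feas (fun s b => RAM.loop (fun _ a => a / B s b) (c s b) (x s b)) := by
    refine Feas.loop (F := fun _ a s b => a / B s b) hx.1 hx.2 hc.1 ((Feas.bigVar 0).div hB.sb1.1) ?_
    obtain ⟨e, he⟩ := hc.1.1
    exact ⟨e, fun N hN s b hsb i _ => (Nat.size_le_size (key _ _ _)).trans (he N hN _ hsb)⟩
  exact SFeas.mod (SFeas.of_le this hc fun s b => key _ _ _) hB

theorem SFeas.base (hn : SFeas n) : SFeas (fun s b => 2 * n s b + 1) :=
  ((const 2).mul hn).add (const 1)

theorem Feas.coded (hn : SFeas n) (hw : SFeas w) (hc : SFeas c) :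
    Feas (fun s b => coded (n s b) (w s b) (c s b)) :=
  .mask (p := fun x s b => ∃ j < w s b, Alg.digit (2 * n s b + 1) (c s b) j = x + 1)
    ((SFeas.const 2).mul hn)
    (.exists_lt hw.s1 (p := fun j s b => Alg.digit (2 * n (fun j => s (j + 1)) b + 1)
        (c (fun j => s (j + 1)) b) j = s 0 + 1)
      (.eq (SFeas.digit hn.s1.s1.base hc.s1.s1 (.var 0)).1 ((SFeas.var 1).add (.const 1)).1))

theorem Feas.block (hn : SFeas n) (hA : Feas A) (hW : Feas W) (hv : SFeas v) (hW' : Feas W')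
    (hx : SFeas x) :
    Feas (fun s b => block (n s b) (A s b) (W s b) (v s b) (W' s b) (x s b)) :=
  .mask hn ((PFeas.testBit hW.s1 (.var 0)).not.and ((PFeas.testBit hW'.s1 (.var 0)).not.and
    (((PFeas.eq hv.s1.1 hn.s1.1).or (.eq (.reach hn.s1 hA.s1 hW.s1 (.var 0))
      (.reach hn.s1 hA.s1 hW.s1 hv.s1))).and
        (.le (.reach hn.s1 hA.s1 hW'.s1 (.var 0)) (.reach hn.s1 hA.s1 hW'.s1 hx.s1)))))

theorem SFeas.famNum (hn : SFeas n) (hN : SFeas N) : SFeas (fun s b => famNum (n s b) (N s b)) :=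
  hn.add (((hn.mul hN).mul (hn.add (const 1))).mul hN)

theorem Feas.fam (hn : SFeas n) (hA : Feas A) (hw : SFeas w) (hN : SFeas N) (hf : SFeas f) :
    Feas (fun s b => fam (n s b) (A s b) (w s b) (N s b) (f s b)) := by
  classical
  have h1 := (hf.sub hn).div hn
  have h2 := hn.add (.const 1)
  exact .ite (.lt hf.1 hn.1) (.two_pow hf) (.block hn hA (.coded hn hw ((h1.div hN).div h2))
    ((h1.div hN).mod h2) (.coded hn hw (h1.mod hN)) ((hf.sub hn).mod hn))

theorem SFeas.entryWidth (hn : SFeas n) : SFeas (fun s b => n s b * n s b + 1) :=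
  (hn.mul hn).add (const 1)

theorem SFeas.maxSize (hw : SFeas w) : SFeas (fun s b => 12 * w s b) := (const 12).mul hw

theorem Feas.val (hn : SFeas n) (hw : SFeas w) (hN : SFeas N) (hT : Feas T) (hU : Feas U) :
    Feas (fun s b => val (n s b) (w s b) (N s b) (T s b) (U s b)) :=
  .get hn.entryWidth hT (.search (p := fun c s b => Alg.coded (n s b) (12 * w s b) c = U s b)
    (hN.pow 12) (.eq (.coded hn.s1 hw.s1.maxSize (.var 0)) hU.s1))

theorem Feas.baseTable (hn : SFeas n) (hw : SFeas w) (hN : SFeas N) (hu : SFeas u) :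
    Feas (fun s b => baseTable (n s b) (w s b) (N s b) (u s b)) := by
  classical
  have hc := Feas.coded hn.s1 hw.s1.maxSize (.var 0)
  exact .arr (hN.pow 12) hn.entryWidth (.ite ((PFeas.eq hc (.const 0)).or
    (.eq hc ((Feas.two_pow hu.s1).add (.two_pow (hn.s1.add hu.s1))))) (.const 1) (.const 0))

theorem Feas.inter (hn : SFeas n) (hU : Feas U) (hX : Feas X) :
    Feas (fun s b => inter (n s b) (U s b) (X s b)) :=
  .mask ((SFeas.const 2).mul hn) ((PFeas.testBit hU.s1 (.var 0)).and
    (.testBit hX.s1 ((SFeas.var 0).mod hn.s1)))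

theorem Feas.product (hn : SFeas n) (hw : SFeas w) (hN : SFeas N) (hX : Feas X) (hY : Feas Y)
    (hS : Feas S) (hT : Feas T) :
    Feas (fun s b => product (n s b) (w s b) (N s b) (X s b) (Y s b) (S s b) (T s b)) := by
  have hc := Feas.coded hn.s1 hw.s1.maxSize (.var 0)
  exact .arr (hN.pow 12) hn.entryWidth
    ((Feas.val hn.s1 hw.s1 hN.s1 hS.s1 (.inter hn.s1 hc hX.s1)).mul
      (.val hn.s1 hw.s1 hN.s1 hT.s1 (.inter hn.s1 hc hY.s1)))

theorem PFeas.isCross (hn : SFeas n) (hA : Feas A) (hX : Feas X) (hY : Feas Y) (hZ : Feas Z)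
    (hu : SFeas u) (hv : SFeas v) :
    PFeas (fun s b => IsCross (n s b) (A s b) (X s b) (Y s b) (Z s b) (u s b) (v s b)) :=
  (PFeas.arc hn hA hu hv).and ((PFeas.testBit hZ hu).and ((PFeas.testBit hZ hv).and
    (((PFeas.testBit hX hu).and (.testBit hX hv)).not.and
      ((PFeas.testBit hY hu).and (.testBit hY hv)).not)))

theorem Feas.addArc (hn : SFeas n) (hA : Feas A) (hw : SFeas w) (hN : SFeas N) (hX : Feas X)
    (hY : Feas Y) (hZ : Feas Z) (hu : SFeas u) (hv : SFeas v) (hS : Feas S) :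
    Feas (fun s b => addArc (n s b) (A s b) (w s b) (N s b) (X s b) (Y s b) (Z s b) (u s b) (v s b)
      (S s b)) := by
  classical
  have hc := Feas.coded hn.s1 hw.s1.maxSize (.var 0)
  exact .arr (hN.pow 12) hn.entryWidth ((Feas.get hn.s1.entryWidth hS.s1 (.var 0)).add
    (.ite ((PFeas.isCross hn.s1 hA.s1 hX.s1 hY.s1 hZ.s1 hu.s1 hv.s1).and
      ((PFeas.testBit hc hu.s1).not.and (PFeas.testBit hc (hn.s1.add hv.s1)).not))
      (.val hn.s1 hw.s1 hN.s1 hS.s1 ((hc.add (.two_pow hu.s1)).add (.two_pow (hn.s1.add hv.s1))))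
      (.const 0)))

theorem Feas.merge (hn : SFeas n) (hA : Feas A) (hw : SFeas w) (hN : SFeas N) (hX : Feas X)
    (hY : Feas Y) (hZ : Feas Z) (hS : Feas S) (hT : Feas T) :
    Feas (fun s b => merge (n s b) (A s b) (w s b) (N s b) (X s b) (Y s b) (Z s b) (S s b)
      (T s b)) :=
  .loop_of_size_le (F := fun p G s b => Alg.addArc (n s b) (A s b) (w s b) (N s b) (X s b) (Y s b)
      (Z s b) (p / n s b) (p % n s b) G) (hn.mul hn) (.product hn hw hN hX hY hS hT)
    (.addArc hn.sb1 hA.sb1 hw.sb1 hN.sb1 hX.sb1 hY.sb1 hZ.sb1 ((SFeas.var 0).div hn.sb1)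
      ((SFeas.var 0).mod hn.sb1) (.bigVar 0))
    (hn.entryWidth.mul (hN.pow 12)).2 fun _ _ _ _ => size_arr_le _ _ _

theorem SFeas.width (hn : SFeas n) (hN : SFeas N) : SFeas (fun s b => width (n s b) (N s b)) :=
  (hn.entryWidth.mul (hN.pow 12)).add (const 1)

theorem Feas.tables₀ (hn : SFeas n) (hw : SFeas w) (hN : SFeas N) :
    Feas (fun s b => tables₀ (n s b) (w s b) (N s b)) := by
  classical
  exact .arr (.famNum hn hN) (.width hn hN) (.ite (.lt (.var 0) hn.s1.1)
    (((Feas.const 2).mul (.baseTable hn.s1 hw.s1 hN.s1 (.var 0))).add (.const 1)) (.const 0))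

theorem PFeas.isSplit (hn : SFeas n) (hA : Feas A) (hw : SFeas w) (hN : SFeas N) (hS : Feas S)
    (hf : SFeas f) (hg : SFeas g) :
    PFeas (fun s b => IsSplit (n s b) (A s b) (w s b) (N s b) (S s b) (f s b) (g s b)) := by
  have h1 := hg.div (.famNum hn hN)
  have h2 := hg.mod (.famNum hn hN)
  have hz := PFeas.testBit (Feas.fam hn hA hw hN hf).s1 (.var 0)
  have hx := PFeas.testBit (Feas.fam hn hA hw hN h1).s1 (.var 0)
  have hy := PFeas.testBit (Feas.fam hn hA hw hN h2).s1 (.var 0)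
  exact (PFeas.eq (.get (.width hn hN) hS h1) (.const 0)).not.and
    ((PFeas.eq (.get (.width hn hN) hS h2) (.const 0)).not.and
      (.forall_lt hn ((hz.not.or (hx.or hy)).and ((hz.or hx.not).and ((hz.or hy.not).and
        (hx.and hy).not)))))

theorem SFeas.split (hn : SFeas n) (hA : Feas A) (hw : SFeas w) (hN : SFeas N) (hS : Feas S)
    (hf : SFeas f) :
    SFeas (fun s b => split (n s b) (A s b) (w s b) (N s b) (S s b) (f s b)) :=
  .search ((famNum hn hN).mul (famNum hn hN))
    (.isSplit hn.s1 hA.s1 hw.s1 hN.s1 hS.s1 hf.s1 (.var 0))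

theorem Feas.round (hn : SFeas n) (hA : Feas A) (hw : SFeas w) (hN : SFeas N) (hS : Feas S) :
    Feas (fun s b => round (n s b) (A s b) (w s b) (N s b) (S s b)) := by
  classical
  have hF := SFeas.famNum hn.s1 hN.s1
  have hW := SFeas.width hn.s1 hN.s1
  have h := SFeas.split hn.s1 hA.s1 hw.s1 hN.s1 hS.s1 (.var 0)
  have h1 := h.div hF
  have h2 := h.mod hF
  have h0 := Feas.get hW hS.s1 (.var 0)
  exact .arr (.famNum hn hN) (.width hn hN) (.ite ((PFeas.eq h0 (.const 0)).and
      (.lt h.1 (hF.mul hF).1))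
    (((Feas.const 2).mul (.merge hn.s1 hA.s1 hw.s1 hN.s1 (.fam hn.s1 hA.s1 hw.s1 hN.s1 h1)
      (.fam hn.s1 hA.s1 hw.s1 hN.s1 h2) (.fam hn.s1 hA.s1 hw.s1 hN.s1 (.var 0))
      ((Feas.get hW hS.s1 h1).div (.const 2)) ((Feas.get hW hS.s1 h2).div (.const 2)))).add
        (.const 1)) h0)

theorem Feas.tables (hn : SFeas n) (hA : Feas A) (hw : SFeas w) (hN : SFeas N) :
    Feas (fun s b => tables (n s b) (A s b) (w s b) (N s b)) :=
  .loop_of_size_le (F := fun _ S s b => Alg.round (n s b) (A s b) (w s b) (N s b) S) hn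
    (.tables₀ hn hw hN) (.round hn.sb1 hA.sb1 hw.sb1 hN.sb1 (.bigVar 0))
    ((SFeas.width hn hN).mul (.famNum hn hN)).2 fun _ _ _ _ => size_arr_le _ _ _

theorem Feas.isqrt (hL : SFeas n) (hP : Feas A) : Feas (fun s b => isqrt (n s b) (A s b)) := by
  have key : ∀ L P m : ℕ, RAM.loop (fun i r => if (r + 2 ^ (L - 1 - i)) * (r + 2 ^ (L - 1 - i)) ≤ P
      then r + 2 ^ (L - 1 - i) else r) 0 m ≤ P := fun L P m => by
    induction m with
    | zero => exact Nat.zero_le _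
    | succ m ih =>
      rw [RAM.loop]
      split_ifs with h
      · exact (Nat.le_mul_self _).trans h
      · exact ih
  have hr := (Feas.bigVar 0).add (.two_pow ((hL.sb1.sub (.const 1)).sub (.var 0)))
  refine Feas.loop (F := fun i r s b => if (r + 2 ^ (n s b - 1 - i)) * (r + 2 ^ (n s b - 1 - i)) ≤
    A s b then r + 2 ^ (n s b - 1 - i) else r) hL.1 hL.2 (.const 0)
    (.ite (.le (hr.mul hr) hP.sb1) hr (.bigVar 0)) ?_
  obtain ⟨e, he⟩ := hP.1
  exact ⟨e, fun N hN s b hsb i _ => (Nat.size_le_size (key _ _ _)).trans (he N hN _ hsb)⟩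

theorem SFeas.full (hn : SFeas n) (hA : Feas A) (hw : SFeas w) (hN : SFeas N) :
    SFeas (fun s b => full (n s b) (A s b) (w s b) (N s b)) :=
  .search (famNum hn hN) ((PFeas.eq (.fam hn.s1 hA.s1 hw.s1 hN.s1 (.var 0))
    ((Feas.two_pow hn.s1).sub (.const 1))).and
      (PFeas.eq (.get (.width hn.s1 hN.s1) (.tables hn.s1 hA.s1 hw.s1 hN.s1) (.var 0))
        (.const 0)).not)

theorem Feas.outcome (hn : SFeas n) (hA : Feas A) (hw : SFeas w) (hN : SFeas N) :
    Feas (fun s b => outcome (n s b) (A s b) (w s b) (N s b)) := by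
  classical
  have hF := SFeas.full hn hA hw hN
  exact .ite (.and (.lt (.const 0) hw.1) (.lt hF.1 (SFeas.famNum hn hN).1))
    ((Feas.isqrt hn.entryWidth (.val hn hw hN ((Feas.get (.width hn hN) (.tables hn hA hw hN) hF).div
      (.const 2)) (.const 0))).add (.const 1)) (.const 0)

end

end RAM

namespace RAM

open Alg

/-! ### The program -/

/-- The number whose binary digits are the contents of the cells `1, …, m`. -/
def encode (R : Memory) (m : ℕ) : ℕ := ∑ k ∈ Finset.range m, R (k + 1) * 2 ^ k

theorem encode_succ (R : Memory) (m : ℕ) : encode R (m + 1) = encode R m + R (m + 1) * 2 ^ m :=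
  Finset.sum_range_succ _ _

theorem encode_lt {R : Memory} (h : ∀ k, R (k + 1) ≤ 1) (m : ℕ) : encode R m < 2 ^ m := by
  induction m with
  | zero => simp [encode]
  | succ m ih =>
    rw [encode_succ, pow_succ]
    have := Nat.mul_le_mul_right (2 ^ m) (h m)
    omega

/-- The instructions that collect the contents of the cells `2, …, 5` in the cell `1`. -/
def collect : List Instr :=
  [.add 1 1 1, .add 1 1 5, .add 1 1 1, .add 1 1 4, .add 1 1 1, .add 1 1 3, .add 1 1 1, .add 1 1 2,
    .add 1 1 1, .const 2 6, .const 3 32, .mul 4 0 0, .const 5 6, .add 4 4 5]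

/-- The instructions that collect the contents of the remaining input cells in the cell `1`. -/
def collectRest : List Instr :=
  [.sub 5 4 2, .jumpZero 5 23, .load 5 2, .mul 5 5 3, .add 1 1 5, .add 3 3 3, .const 5 1, .add 2 2 5,
    .jump 14]

/-- The state in which the cells up to `i` have been collected: the cell `1` has the collected digits,
the cells `2` and `3` the index and the place value of the next digit, and the cell `4` the index at
which the input ends. -/
structure Collected (n : ℕ) (R : Memory) (i : ℕ) (M : Memory) : Prop where
  h0 : M 0 = n
  h1 : M 1 = encode R i
  h2 : M 2 = i + 1
  h3 : M 3 = 2 ^ i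
  h4 : M 4 = n * n + 6
  rest : ∀ k, 6 ≤ k → M k = R k

theorem reach_collect {P : Program} (hP : HasCode P 0 collect) {n : ℕ} {R : Memory} (h0 : R 0 = n)
    (h1 : R 1 = 0) (hR : ∀ k, R (k + 1) ≤ 1) :
    ∃ t M, Reach P ⟨0, R⟩ t ⟨14, M⟩ ∧ Collected n R 5 M ∧ t ≤ 1000 + 10 * n * n := by
  obtain ⟨p0, hP⟩ := hP.cons
  obtain ⟨p1, hP⟩ := hP.cons
  obtain ⟨p2, hP⟩ := hP.cons
  obtain ⟨p3, hP⟩ := hP.cons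
  obtain ⟨p4, hP⟩ := hP.cons
  obtain ⟨p5, hP⟩ := hP.cons
  obtain ⟨p6, hP⟩ := hP.cons
  obtain ⟨p7, hP⟩ := hP.cons
  obtain ⟨p8, hP⟩ := hP.cons
  obtain ⟨p9, hP⟩ := hP.cons
  obtain ⟨p10, hP⟩ := hP.cons
  obtain ⟨p11, hP⟩ := hP.cons
  obtain ⟨p12, hP⟩ := hP.cons
  obtain ⟨p13, hP⟩ := hP.cons
  have r := (Reach.one (R := R) p0).trans <| (Reach.one p1).trans <| (Reach.one p2).trans <|
    (Reach.one p3).trans <| (Reach.one p4).trans <| (Reach.one p5).trans <|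
    (Reach.one p6).trans <| (Reach.one p7).trans <| (Reach.one p8).trans <|
    (Reach.one p9).trans <| (Reach.one p10).trans <| (Reach.one p11).trans <|
    (Reach.one p12).trans <| Reach.one p13
  refine ⟨_, _, r, ?_, ?_⟩
  · constructor
    · simp [h0]
    · simp [h1, encode, Finset.sum_range_succ]
      ring
    · simp
    · simp
    · simp [h0]
    · intro k hk
      have e1 : k ≠ 1 := by omega
      have e2 : k ≠ 2 := by omega
      have e3 : k ≠ 3 := by omega
      have e4 : k ≠ 4 := by omega
      have e5 : k ≠ 5 := by omega
      simp [e1, e2, e3, e4, e5]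
  · have b2 := hR 1
    have b3 := hR 2
    have b4 := hR 3
    have b5 := hR 4
    simp only [Instr.cost, Function.update_apply]
    norm_num [h0, h1]
    norm_num at b2 b3 b4 b5
    simp only [← two_mul]
    have s : ∀ x : ℕ, x.size ≤ x := size_le_self
    have hn : n ≤ n * n := Nat.le_mul_self n
    have := s n; have := s (n * n)
    have := s 2; have := s 3; have := s 4; have := s 5; have := s 6
    have h32 : Nat.size 32 ≤ 6 := Nat.size_le.2 (by norm_num)
    have g : ∀ x : ℕ, x ≤ 63 → x.size ≤ 6 := fun x hx => Nat.size_le.2 (by omega)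
    have := g (R 5) (by omega); have := g (2 * R 5) (by omega)
    have := g (R 4) (by omega); have := g (2 * R 5 + R 4) (by omega)
    have := g (2 * (2 * R 5 + R 4)) (by omega)
    have := g (R 3) (by omega); have := g (2 * (2 * R 5 + R 4) + R 3) (by omega)
    have := g (2 * (2 * (2 * R 5 + R 4) + R 3)) (by omega)
    have := g (R 2) (by omega)
    have := g (2 * (2 * (2 * R 5 + R 4) + R 3) + R 2) (by omega)
    have e : 10 * n * n = 10 * (n * n) := by ring
    linarith

theorem reach_collectRest {P : Program} (hP : HasCode P 14 collectRest) {n : ℕ} {R : Memory}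
    (hR : ∀ k, R (k + 1) ≤ 1) {i : ℕ} (hi : i ≤ n * n + 5) (h5 : 5 ≤ i) {M : Memory}
    (hM : Collected n R i M) :
    ∃ t M', Reach P ⟨14, M⟩ t ⟨23, M'⟩ ∧ Collected n R (n * n + 5) M' ∧
      t ≤ (n * n + 6 - i) * (1000 + 10 * (n * n)) := by
  obtain ⟨p0, hP'⟩ := hP.cons
  obtain ⟨p1, hP'⟩ := hP'.cons
  obtain ⟨p2, hP'⟩ := hP'.cons
  obtain ⟨p3, hP'⟩ := hP'.cons
  obtain ⟨p4, hP'⟩ := hP'.cons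
  obtain ⟨p5, hP'⟩ := hP'.cons
  obtain ⟨p6, hP'⟩ := hP'.cons
  obtain ⟨p7, hP'⟩ := hP'.cons
  obtain ⟨p8, hP'⟩ := hP'.cons
  have s : ∀ x : ℕ, x.size ≤ x := size_le_self
  have := s 1; have := s 2; have := s 3; have := s 4; have := s 5
  have := s (n * n + 6)
  have := s (i + 1)
  have h14 : Nat.size 14 ≤ 6 := Nat.size_le.2 (by norm_num)
  have h23 : Nat.size 23 ≤ 6 := Nat.size_le.2 (by norm_num)
  obtain ⟨k, hk⟩ : ∃ k, n * n + 5 = i + k := ⟨n * n + 5 - i, by omega⟩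
  induction k generalizing i M with
  | zero =>
    obtain rfl : i = n * n + 5 := by omega
    have r := (Reach.one (R := M) p0).trans (Reach.one p1)
    have hz : M 4 - M 2 = 0 := by rw [hM.h4, hM.h2]; omega
    simp only [Instr.exec, Function.update_self, hz, if_true] at r
    refine ⟨_, _, r, ?_, ?_⟩
    · obtain ⟨h0, h1, h2, h3, h4, hr⟩ := hM
      exact ⟨by simpa, by simpa, by simpa, by simpa, by simpa, fun k hk => by
        rw [Function.update_of_ne (by omega), hr k hk]⟩
    · simp only [Instr.cost, Function.update_self, hM.h4, hM.h2, Nat.size_zero]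
      rw [show n * n + 6 - (n * n + 5) = 1 by omega]
      omega
  | succ k ih =>
    have r := (Reach.one (R := M) p0).trans (Reach.one p1)
    have hz : M 4 - M 2 ≠ 0 := by rw [hM.h4, hM.h2]; omega
    simp only [Instr.exec, Function.update_self, hz, if_false] at r
    have r' := r.trans <| (Reach.one p2).trans <| (Reach.one p3).trans <|
      (Reach.one p4).trans <| (Reach.one p5).trans <| (Reach.one p6).trans <|
      (Reach.one p7).trans <| Reach.one p8
    have hrd : M (i + 1) = R (i + 1) := hM.rest _ (by omega)
    have hi5 : i + 1 ≠ 5 := by omega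
    obtain ⟨h0, h1, h2, h3, h4, hr⟩ := hM
    obtain ⟨t, M', q1, q2, q3⟩ := ih (i := i + 1) (M := _) (by omega) (by omega) (by
        show Collected n R (i + 1) (Function.update (Function.update (Function.update
          (Function.update (Function.update (Function.update (Function.update M 5 (M 4 - M 2)) 5
            (M (i + 1))) 5 (M (i + 1) * 2 ^ i)) 1 (M 1 + M (i + 1) * 2 ^ i)) 3 (2 ^ i + 2 ^ i)) 5 1)
              2 (i + 1 + 1))
        constructor
        · simp [h0]
        · simp [h1, hrd, encode_succ]
        · simp
        · simp [pow_succ]; ring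
        · simp [h4]
        · intro k hk
          have e1 : k ≠ 1 := by omega
          have e2 : k ≠ 2 := by omega
          have e3 : k ≠ 3 := by omega
          have e5 : k ≠ 5 := by omega
          simp [e1, e2, e3, e5, hr k hk]) (s _) (by omega)
    have r'' := r'.trans (t' := t) (C'' := ⟨23, M'⟩) (by
      convert q1 using 1
      simp [Instr.exec, h2, h3, hi5])
    refine ⟨_, _, r'', q2, ?_⟩
    have e1 := encode_lt hR i
    have e2 : (encode R i).size ≤ i := Nat.size_le.2 e1
    have e3 : (2 ^ i).size = i + 1 := Nat.size_pow
    have e4 : (R (i + 1)).size ≤ 1 := (s _).trans (hR _)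
    have e5 : (R (i + 1) * 2 ^ i).size ≤ i + 1 := by
      refine (Nat.size_le_size (Nat.mul_le_mul_right _ (hR i))).trans ?_
      rw [one_mul, e3]
    have e6 : (n * n + 6 - (i + 1)).size ≤ n * n + 6 := (s _).trans (by omega)
    have e7 : n * n + 6 - i = (n * n + 6 - (i + 1)) + 1 := by omega
    rw [e7, add_mul, one_mul]
    norm_num [Instr.cost, Function.update_apply, Instr.exec, h1, h2, h3, h4, hi5, hrd, e3]
    omega

/-- The placement of the three small variables of the outcome: the number of vertices in the
cell `0`, the parameter in the cell `2` and a power of the base in the cell `3`. -/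
def smallPlace : ℕ → ℕ
  | 0 => 0
  | 1 => 2
  | _ => 3

theorem PolyBdd.pow {α : Type*} {Q : ℕ → α → Prop} {f : α → ℕ} (hf : PolyBdd Q f) (k : ℕ) :
    PolyBdd Q (fun x => f x ^ k) := by
  induction k with
  | zero => simpa using PolyBdd.const 1
  | succ k ih => simpa only [pow_succ] using ih.mul hf

/-- The random access machine that computes the outcomes for the parameters `0, 1, …` until one of
them is not `0`. -/
theorem exists_program : ∃ (P : Program) (E : ℕ), ∀ n, 1 ≤ n → ∀ R : Memory, R 0 = n → R 1 = 0 →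
    (∀ k, R (k + 1) ≤ 1) → ∀ w₀,
      outcome n (encode R (n * n + 5)) w₀ ((2 * n + 1) ^ w₀) ≠ 0 →
      (∀ w < w₀, outcome n (encode R (n * n + 5)) w ((2 * n + 1) ^ w) = 0) →
      OutputsWithin P R (outcome n (encode R (n * n + 5)) w₀ ((2 * n + 1) ^ w₀) - 1)
        ((2 * n + 1) ^ (E * (w₀ + 1))) := by
  have hfeas : Feas (fun s b => outcome (s 0) (b 0) (s 1) (s 2)) :=
    .outcome (.var 0) (.bigVar 0) (.var 1) (.var 2)
  obtain ⟨c, G, T, c1, c2, c3, e, he⟩ := hfeas.2 smallPlace (fun _ => 1) 4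
    (fun j => by unfold smallPlace; split <;> omega) (fun _ => by omega) 25
  obtain ⟨e', he'⟩ := hfeas.1
  obtain ⟨l, hl⟩ : ∃ l, l = 25 + c.length := ⟨_, rfl⟩
  obtain ⟨tail, htail⟩ : ∃ tail : List Instr, tail = [.jumpZero 4 (l + 4), .const 5 1, .sub 0 4 5,
    .jump (l + 10), .const 5 1, .add 2 2 5, .add 5 5 0, .add 5 5 0, .mul 3 3 5, .jump 25] :=
    ⟨_, rfl⟩
  -- a bound for the time of one round
  let C : ℕ → ℕ := fun N => N ^ e + 2 * N ^ e' + 20 * N + (2 * l + 300)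
  obtain ⟨E, hE⟩ : PolyBdd (fun N x => x ≤ N) (fun N => N * (1000 + 10 * N) + 2000 + 10 * N +
      (N + 1) * C N) := by
    have hid : PolyBdd (fun N x => x ≤ N) (fun x => x) := ⟨1, fun N _ x hx => by simpa using hx⟩
    exact (((hid.mul ((PolyBdd.const _).add ((PolyBdd.const _).mul hid))).add
      (PolyBdd.const _)).add ((PolyBdd.const _).mul hid)).add ((hid.add (PolyBdd.const _)).mul
        ((((hid.pow e).add ((PolyBdd.const _).mul (hid.pow e'))).add ((PolyBdd.const _).mul hid)).add (PolyBdd.const _)))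
  obtain ⟨P, hP⟩ : ∃ P : Program, P = collect ++ (collectRest ++
    ([.const 2 0, .const 3 1] ++ (c ++ tail))) := ⟨_, rfl⟩
  refine ⟨P, 3 * E, fun n hn R h0 h1 hR w₀ hw₀ hmin => ?_⟩
  have hcode : HasCode P 0 P := fun i _ => by simp
  have hlen : P.length = l + 10 := by
    rw [hP, htail, hl]; simp [collect, collectRest]; omega
  nth_rewrite 2 [hP] at hcode
  obtain ⟨d1, hcode⟩ := hcode.append
  obtain ⟨d2, hcode⟩ := hcode.append
  obtain ⟨d3, hcode⟩ := hcode.append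
  obtain ⟨d4, hcode⟩ := hcode.append
  obtain ⟨i1, d3⟩ := d3.cons
  obtain ⟨i2, d3⟩ := d3.cons
  simp only [collect, collectRest, List.length_cons, List.length_nil] at i1 i2 d2 d4 hcode
  norm_num at i1 i2 d2 d4 hcode
  rw [← hl, htail] at hcode
  obtain ⟨t0, hcode⟩ := hcode.cons
  obtain ⟨t1, hcode⟩ := hcode.cons
  obtain ⟨t2, hcode⟩ := hcode.cons
  obtain ⟨t3, hcode⟩ := hcode.cons
  obtain ⟨t4, hcode⟩ := hcode.cons
  obtain ⟨t5, hcode⟩ := hcode.cons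
  obtain ⟨t6, hcode⟩ := hcode.cons
  obtain ⟨t7, hcode⟩ := hcode.cons
  obtain ⟨t8, hcode⟩ := hcode.cons
  obtain ⟨t9, hcode⟩ := hcode.cons
  generalize hA : encode R (n * n + 5) = A at *
  -- a bound for all numbers
  obtain ⟨N, hN⟩ : ∃ N, N = (2 * n + 1) ^ (w₀ + 3) := ⟨_, rfl⟩
  have bpow : ∀ k ≤ w₀ + 3, (2 * n + 1) ^ k ≤ N := fun k hk => by
    rw [hN]; exact Nat.pow_le_pow_right (by omega) hk
  have b2 : (2 * n + 1) * (2 * n + 1) ≤ N := by simpa [sq] using bpow 2 (by omega)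
  have b2' : n * n + 6 ≤ N := by nlinarith
  have bn : 2 * n + 1 ≤ N := by simpa using bpow 1 (by omega)
  have bw : w₀ < N := by
    rw [hN]
    exact (Nat.lt_pow_self (by omega)).trans (Nat.pow_lt_pow_right (by omega) (by omega))
  have bA : A.size ≤ N := by
    have : A.size ≤ n * n + 5 := Nat.size_le.2 (by rw [← hA]; exact encode_lt hR _)
    omega
  have s : ∀ x : ℕ, x.size ≤ x := size_le_self
  have main : ∀ k w M, w + k = w₀ → M 0 = n → M 1 = A → M 2 = w → M 3 = (2 * n + 1) ^ w →
      ∃ t M', Reach P ⟨25, M⟩ t ⟨l + 10, M'⟩ ∧ M' 0 = outcome n A w₀ ((2 * n + 1) ^ w₀) - 1 ∧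
        t ≤ (k + 1) * C N := by
    intro k
    induction k with
    | zero =>
      intro w M hw m0 m1 m2 m3
      obtain rfl : w = w₀ := by omega
      have adm : Admissible N (fun j => M (smallPlace j), fun _ => M 1) := by
        refine ⟨fun j => ?_, fun _ => by rw [m1]; exact bA⟩
        show M (smallPlace j) ≤ N
        unfold smallPlace
        split
        · rw [m0]; omega
        · rw [m2]; omega
        · rw [m3]; exact bpow _ (by omega)
      have hG : G M 4 = outcome n A w ((2 * n + 1) ^ w) := by
        rw [c3]; simp only [smallPlace, m0, m1, m2, m3]
      have r := (c1 P d4 M).trans ((Reach.one (R := G M) (by rw [← hl]; exact t0)))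
      simp only [Instr.exec] at r
      rw [if_neg (by rw [hG]; exact hw₀), ← hl] at r
      have r' := r.trans ((Reach.one t1).trans ((Reach.one t2).trans (Reach.one t3)))
      refine ⟨_, _, r', ?_, ?_⟩
      · simp [hG]
      · have q1 := he N (by omega) M adm
        have q2 := he' N (by omega) _ adm
        simp only [smallPlace, m0, m1, m2, m3] at q2
        simp only [Instr.cost, hG, Function.update_apply]
        norm_num [hG]
        have := s 1; have := s 4; have := s 5; have := s (l + 4); have := s (l + 10)
        simp only [C]
        omega
    | succ k ih =>
      intro w M hw m0 m1 m2 m3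
      have adm : Admissible N (fun j => M (smallPlace j), fun _ => M 1) := by
        refine ⟨fun j => ?_, fun _ => by rw [m1]; exact bA⟩
        show M (smallPlace j) ≤ N
        unfold smallPlace
        split
        · rw [m0]; omega
        · rw [m2]; omega
        · rw [m3]; exact bpow _ (by omega)
      have hG : G M 4 = outcome n A w ((2 * n + 1) ^ w) := by
        rw [c3]; simp only [smallPlace, m0, m1, m2, m3]
      have hz := hmin w (by omega)
      have r := (c1 P d4 M).trans ((Reach.one (R := G M) (by rw [← hl]; exact t0)))
      simp only [Instr.exec] at r
      rw [if_pos (by rw [hG]; exact hz)] at r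
      have r' := r.trans ((Reach.one t4).trans ((Reach.one t5).trans ((Reach.one t6).trans
        ((Reach.one t7).trans ((Reach.one t8).trans (Reach.one t9))))))
      have g0 : G M 0 = n := by rw [c2 _ _ (by omega), m0]
      have g1 : G M 1 = A := by rw [c2 _ _ (by omega), m1]
      have g2 : G M 2 = w := by rw [c2 _ _ (by omega), m2]
      have g3 : G M 3 = (2 * n + 1) ^ w := by rw [c2 _ _ (by omega), m3]
      obtain ⟨t, M', u1, u2, u3⟩ := ih (w + 1) (Function.update (Function.update (Function.update
        (Function.update (Function.update (G M) 5 1) 2 (w + 1)) 5 (1 + n)) 5 (1 + n + n)) 3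
          ((2 * n + 1) ^ w * (1 + n + n))) (by omega) (by simp [g0]) (by simp [g1]) (by simp)
          (by simp [pow_succ]; ring)
      have r'' := r'.trans (t' := t) (C'' := ⟨l + 10, M'⟩) (by
        convert u1 using 1
        simp [Instr.exec, g0, g2, g3])
      refine ⟨_, _, r'', u2, ?_⟩
      have q1 := he N (by omega) M adm
      have v1 : (w + 1).size ≤ N := (s _).trans (by omega)
      have v2 : w.size ≤ N := (s _).trans (by omega)
      have v3 : n.size ≤ N := (s _).trans (by omega)
      have v4 : (1 + n).size ≤ N := (s _).trans (by omega)
      have v5 : (1 + n + n).size ≤ N := (s _).trans (by omega)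
      have v6 : ((2 * n + 1) ^ w).size ≤ N := (s _).trans (bpow _ (by omega))
      have := s 1; have := s 2; have := s 3; have := s 4; have := s 5; have := s (l + 4)
      have h25 : Nat.size 25 ≤ 6 := Nat.size_le.2 (by norm_num)
      have e1 : (k + 1 + 1) * C N = (k + 1) * C N + C N := by ring
      rw [e1]
      norm_num [Instr.cost, Function.update_apply, Instr.exec, g0, g2, g3, hG, hz]
      have e2 : C N = N ^ e + 2 * N ^ e' + 20 * N + (2 * l + 300) := rfl
      omega
  obtain ⟨ta, Ma, ra, ha, ta'⟩ := reach_collect d1 h0 h1 hR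
  obtain ⟨tb, Mb, rb, hb, tb'⟩ := reach_collectRest d2 hR (by omega) le_rfl ha
  obtain ⟨tc, Mc, rc, hc, tc'⟩ := main w₀ 0 (Function.update (Function.update Mb 2 0) 3 1)
    (by omega) (by simp [hb.h0]) (by simp [hb.h1, hA]) (by simp) (by simp)
  have hfin : Runs P ⟨l + 10, Mc⟩ 0 ⟨l + 10, Mc⟩ :=
    .halt (List.getElem?_eq_none (by rw [hlen]))
  have r := (ra.trans (rb.trans (((Reach.one i1).trans (Reach.one i2)).trans rc))) _ _ hfin
  refine ⟨_, _, r, hc, ?_⟩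
  have hN2 : (2 * n + 1) ^ (3 * E * (w₀ + 1)) ≥ N ^ E := by
    rw [hN, ← pow_mul]
    refine Nat.pow_le_pow_right (by omega) ?_
    nlinarith
  refine le_trans ?_ ((hE N (by omega) N le_rfl).trans hN2)
  have f1 : (w₀ + 1) * C N ≤ (N + 1) * C N := Nat.mul_le_mul_right _ (by omega)
  have f2 : (n * n + 6 - 5) * (1000 + 10 * (n * n)) ≤ N * (1000 + 10 * N) :=
    Nat.mul_le_mul (by omega) (by omega)
  have f3 : 10 * n * n = 10 * (n * n) := by ring
  have := s 1; have := s 2; have := s 3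
  simp only [Instr.cost, Nat.size_zero]
  omega

end RAM

/-! ### Derivable sets of vertices -/

namespace Dig

open Relation Finset

variable {V : Type*}

/-- The vertex `x` can be reached from `u` by arcs whose heads are not in `W`. -/
def Reaches (a : V → V → Prop) (W : Finset V) : V → V → Prop :=
  ReflTransGen fun y z => a y z ∧ z ∉ W

theorem Reaches.mono {a : V → V → Prop} {W W' : Finset V} (h : W ⊆ W') {u x : V}
    (hr : Reaches a W' u x) : Reaches a W u x :=
  ReflTransGen.mono (fun _ _ h' => ⟨h'.1, fun hz => h'.2 (h hz)⟩) _ _ hr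

/-- For each set `W`, the numbers `key W u` order the vertices linearly, up to ties, such that arcs
outside `W` never go up, and the ties outside `W` are the strong components outside `W`. -/
structure IsKey (a : V → V → Prop) (key : Finset V → V → ℕ) : Prop where
  le : ∀ W u x, Reaches a W u x → key W x ≤ key W u
  reaches : ∀ W u x, key W x = key W u → Reaches a W u x

theorem IsKey.le_of_arc {a : V → V → Prop} {key : Finset V → V → ℕ} (hk : IsKey a key)
    {W : Finset V} {u x : V} (h : a u x) (hx : x ∉ W) : key W x ≤ key W u :=
  hk.le _ _ _ (.single ⟨h, hx⟩)

/-- A closed walk outside `D` through `u` and `y` stays in the strong component of `u` outside the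
smaller set `S`. If that component has no vertex of `W` outside `D`, then the walk avoids `W`, too. -/
theorem Reaches.of_avoid {a : V → V → Prop} {key : Finset V → V → ℕ} (hk : IsKey a key)
    {S W D : Finset V} {u y : V} (hSD : S ⊆ D)
    (h : Reaches a D u y) (h' : Reaches a D y u)
    (hW : ∀ z, z ∉ D → key S z = key S u → z ∉ W) : Reaches a W u y := by
  have aux : ∀ z, Reaches a D u z → Reaches a D z y → Reaches a W u z := by
    intro z hz hzy
    induction hz with
    | refl => exact .refl
    | @tail b c hub hbc ih =>
      refine (ih (ReflTransGen.head hbc hzy)).tail ⟨hbc.1, hW c hbc.2 ?_⟩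
      exact le_antisymm (hk.le _ _ _ (Reaches.mono hSD (hub.tail hbc)))
        (hk.le _ _ _ (Reaches.mono hSD (hzy.trans h')))
  exact aux y h .refl

/-- The sets of vertices that arise from a strong component outside `W` (or from the complement of
`W`) as an initial part of its vertices outside `W'`, for sets `W` and `W'` of size at most `s`. -/
def IsFam (key : Finset V → V → ℕ) (s : ℕ) (Z : Finset V) : Prop :=
  ∃ W W' : Finset V, #W ≤ s ∧ #W' ≤ s ∧ ∃ (v : Option V) (x : V), ∀ u, u ∈ Z ↔
    u ∉ W ∧ u ∉ W' ∧ (∀ v' ∈ v, key W u = key W v') ∧ key W' u ≤ key W' x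

variable [DecidableEq V]

/-- The sets that can be built from singletons by disjoint unions inside the family. -/
inductive Derivable (key : Finset V → V → ℕ) (s : ℕ) : Finset V → Prop
  | single (v : V) : Derivable key s {v}
  | union {X Y : Finset V} (hX : Derivable key s X) (hY : Derivable key s Y) (h : Disjoint X Y)
      (hZ : IsFam key s (X ∪ Y)) : Derivable key s (X ∪ Y)

variable {a : V → V → Prop} {key : Finset V → V → ℕ}

section porosity

variable [Fintype V]

theorem card_entries_eq_card_exits (τ : Equiv.Perm V) (X : Finset V) :
    #{u | u ∉ X ∧ τ u ∈ X} = #{u | u ∈ X ∧ τ u ∉ X} := by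
  have h1 : #{u | τ u ∈ X} = #X := by
    rw [← Finset.card_map τ.toEmbedding]
    congr 1
    ext u
    simp
  have h2 := Finset.card_filter_add_card_filter_not (s := {u | τ u ∈ X}) (fun u => u ∈ X)
  have h3 := Finset.card_filter_add_card_filter_not (s := X) (fun u => τ u ∈ X)
  have e1 : ({u ∈ ({u | τ u ∈ X} : Finset V) | u ∈ X}) = {u ∈ X | τ u ∈ X} := by
    ext; simp [and_comm]
  have e2 : ({u ∈ ({u | τ u ∈ X} : Finset V) | u ∉ X}) = ({u | u ∉ X ∧ τ u ∈ X} : Finset V) := by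
    ext; simp [and_comm]
  have e3 : ({u ∈ X | τ u ∉ X}) = ({u | u ∈ X ∧ τ u ∉ X} : Finset V) := by ext; simp
  rw [e1, e2] at h2
  rw [e3] at h3
  omega

/-- A permutation along arcs leaves a set at most `#W` times if all arcs that leave the set end
in `W`. -/
theorem card_exits_le {τ : Equiv.Perm V} {X W : Finset V} (h : ∀ u ∈ X, τ u ∉ W → τ u ∈ X) :
    #{u | u ∈ X ∧ τ u ∉ X} ≤ #W := by
  refine Finset.card_le_card_of_injOn τ (fun u hu => ?_) τ.injective.injOn
  simp only [coe_filter, mem_univ, true_and, Set.mem_ofPred_eq] at hu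
  by_contra hW
  exact hu.2 (h u hu.1 hW)

/-- A permutation along arcs rarely leaves a set of the family, because such a set is made of three
sets that are closed outside `W` or `W'`. -/
theorem IsFam.card_exits_le (hk : IsKey a key) {s : ℕ} {Z : Finset V} (hZ : IsFam key s Z)
    {τ : Equiv.Perm V} (hτ : ∀ u, a u (τ u)) : #{u | u ∈ Z ∧ τ u ∉ Z} ≤ 3 * s := by
  classical
  obtain ⟨W, W', hW, hW', v, x, hZ⟩ := hZ
  let X : Finset V := {u | u ∉ W ∧ ∀ v' ∈ v, key W u ≤ key W v'}
  let X' : Finset V := {u | u ∉ W ∧ ∃ v' ∈ v, key W u < key W v'}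
  let Y : Finset V := {u | u ∉ W' ∧ key W' u ≤ key W' x}
  have hX : #{u | u ∈ X ∧ τ u ∉ X} ≤ #W := Dig.card_exits_le fun u hu hu' => by
    simp only [X, mem_filter, mem_univ, true_and] at hu ⊢
    exact ⟨hu', fun v' hv' => (hk.le_of_arc (hτ u) hu').trans (hu.2 v' hv')⟩
  have hX' : #{u | u ∈ X' ∧ τ u ∉ X'} ≤ #W := Dig.card_exits_le fun u hu hu' => by
    simp only [X', mem_filter, mem_univ, true_and] at hu ⊢
    obtain ⟨_, v', hv', h⟩ := hu
    exact ⟨hu', v', hv', (hk.le_of_arc (hτ u) hu').trans_lt h⟩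
  have hY : #{u | u ∈ Y ∧ τ u ∉ Y} ≤ #W' := Dig.card_exits_le fun u hu hu' => by
    simp only [Y, mem_filter, mem_univ, true_and] at hu ⊢
    exact ⟨hu', (hk.le_of_arc (hτ u) hu').trans hu.2⟩
  rw [← card_entries_eq_card_exits] at hX'
  have hmem : ∀ u, u ∈ Z ↔ u ∈ X ∧ u ∉ X' ∧ u ∈ Y := by
    intro u
    simp only [hZ, X, X', Y, mem_filter, mem_univ, true_and, not_and, not_exists, not_lt]
    constructor
    · rintro ⟨h1, h2, h3, h4⟩
      exact ⟨⟨h1, fun v' hv' => (h3 v' hv').le⟩, fun _ v' hv' => (h3 v' hv').ge, h2, h4⟩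
    · rintro ⟨⟨h1, h2⟩, h3, h4, h5⟩
      exact ⟨h1, h4, fun v' hv' => le_antisymm (h2 v' hv') (h3 h1 v' hv'), h5⟩
  calc #{u | u ∈ Z ∧ τ u ∉ Z}
      ≤ #((({u | u ∈ X ∧ τ u ∉ X} : Finset V) ∪ ({u | u ∉ X' ∧ τ u ∈ X'} : Finset V)) ∪
          ({u | u ∈ Y ∧ τ u ∉ Y} : Finset V)) := by
        refine card_le_card fun u hu => ?_
        simp only [mem_filter, mem_univ, true_and, mem_union, hmem] at hu ⊢
        tauto
    _ ≤ #W + #W + #W' := by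
        refine (card_union_le _ _).trans (Nat.add_le_add ((card_union_le _ _).trans ?_) hY)
        exact Nat.add_le_add hX hX'
    _ ≤ 3 * s := by omega

end porosity

section derivable

variable [Fintype V]

theorem derivable_of_blocks (hk : IsKey a key) {m : ℕ}
    (hsep : ∀ Y : Finset V, ∃ S : Finset V, #S ≤ m ∧
      ∀ u ∉ S, 2 * #{y ∈ Y | y ∉ S ∧ key S y = key S u} ≤ #Y)
    (K W : Finset V) (v : Option V) (hW : #W ≤ 2 * m)
    (hK : ∀ u, u ∈ K ↔ u ∉ W ∧ ∀ v' ∈ v, key W u = key W v') (hne : K.Nonempty) :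
    Derivable key (3 * m + 1) K := by
  induction hc : #K using Nat.strong_induction_on generalizing K W v with
  | _ c ih =>
  obtain ⟨r, hr⟩ := hne
  obtain ⟨S, hS, hbal⟩ := hsep (insert r W)
  obtain ⟨W', hW'⟩ : ∃ W', W' = insert r W ∪ S := ⟨_, rfl⟩
  have hrW : #(insert r W) ≤ 2 * m + 1 := (card_insert_le _ _).trans (by omega)
  have hW'c : #W' ≤ 3 * m + 1 := by
    rw [hW']; exact (card_union_le _ _).trans (by omega)
  have hWW' : W ⊆ W' := by
    rw [hW']; exact (subset_insert _ _).trans subset_union_left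
  have hrW' : r ∈ W' := by rw [hW']; exact mem_union_left _ (mem_insert_self _ _)
  have hSW' : S ⊆ W' := by rw [hW']; exact subset_union_right
  -- the strong components outside `W'` of vertices in `K` are derivable
  have comp : ∀ u ∈ K, u ∉ W' → ∀ C : Finset V, (∀ y, y ∈ C ↔ y ∉ W' ∧ key W' y = key W' u) →
      C ⊆ K ∧ Derivable key (3 * m + 1) C := by
    intro u hu huW' C hC
    have hCK : C ⊆ K := by
      intro y hy
      obtain ⟨hy1, hy2⟩ := (hC y).1 hy
      refine (hK y).2 ⟨fun h => hy1 (hWW' h), fun v' hv' => ?_⟩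
      rw [← ((hK u).1 hu).2 v' hv']
      exact le_antisymm (hk.le _ _ _ ((hk.reaches _ _ _ hy2).mono hWW'))
        (hk.le _ _ _ ((hk.reaches _ _ _ hy2.symm).mono hWW'))
    refine ⟨hCK, ?_⟩
    have huS : u ∉ S := fun h => huW' (hSW' h)
    obtain ⟨D, hD⟩ : ∃ D, D = S ∪ {y ∈ insert r W | y ∉ S ∧ key S y = key S u} := ⟨_, rfl⟩
    have hSD : S ⊆ D := by rw [hD]; exact subset_union_left
    have hDW' : D ⊆ W' := by
      rw [hD, hW', union_comm S]
      exact union_subset_union_left (filter_subset _ _)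
    have hDc : #D ≤ 2 * m := by
      have := hbal u huS
      rw [hD]
      exact (card_union_le _ _).trans (by omega)
    have hCD : ∀ y, y ∈ C ↔ y ∉ D ∧ ∀ v' ∈ some u, key D y = key D v' := by
      intro y
      simp only [hC, Option.mem_def, Option.some.injEq, forall_eq']
      constructor
      · rintro ⟨h1, h2⟩
        exact ⟨fun h => h1 (hDW' h), le_antisymm
          (hk.le _ _ _ ((hk.reaches _ _ _ h2).mono hDW'))
          (hk.le _ _ _ ((hk.reaches _ _ _ h2.symm).mono hDW'))⟩
      · rintro ⟨h1, h2⟩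
        have huy := hk.reaches _ _ _ h2
        have hyu := hk.reaches _ _ _ h2.symm
        have hSe : key S y = key S u := le_antisymm (hk.le _ _ _ (huy.mono hSD))
          (hk.le _ _ _ (hyu.mono hSD))
        have avoid : ∀ z, z ∉ D → key S z = key S u → z ∉ W' := by
          intro z hz hzu hzW'
          rw [hD, mem_union, mem_filter] at hz
          rw [hW', mem_union] at hzW'
          tauto
        refine ⟨avoid y h1 hSe, le_antisymm (hk.le _ _ _ (huy.of_avoid hk hSD hyu avoid))
          (hk.le _ _ _ (hyu.of_avoid hk hSD huy (fun z hz hzy => avoid z hz (hzy.trans hSe))))⟩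
    refine ih #C ?_ C D (some u) hDc hCD ⟨u, (hC u).2 ⟨huW', rfl⟩⟩ rfl
    rw [← hc]
    exact card_lt_card ⟨hCK, fun h => ((hC r).1 (h hr)).1 hrW'⟩
  have hfam : ∀ (W'' : Finset V) (x : V), W'' ⊆ W' → IsFam key (3 * m + 1)
      {y ∈ K | y ∉ W'' ∧ key W'' y ≤ key W'' x} := by
    intro W'' x hW''
    refine ⟨W, W'', by omega, (card_le_card hW'').trans hW'c, v, x, fun u => ?_⟩
    simp only [mem_filter, hK]
    tauto
  -- initial parts of `K \ W'` are derivable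
  have init : ∀ c, ∀ x ∈ K, x ∉ W' → key W' x = c →
      Derivable key (3 * m + 1) {y ∈ K | y ∉ W' ∧ key W' y ≤ key W' x} := by
    intro c
    induction c using Nat.strong_induction_on with
    | _ c ihc =>
    intro x hx hxW' hxc
    obtain ⟨hCK, hC⟩ := comp x hx hxW' ({y | y ∉ W' ∧ key W' y = key W' x} : Finset V)
      (by simp)
    by_cases hlow : ∃ y ∈ K, y ∉ W' ∧ key W' y < key W' x
    · obtain ⟨y₀, hy₀, hy₀'⟩ := hlow
      obtain ⟨y, hy, hmax⟩ := exists_max_image ({y ∈ K | y ∉ W' ∧ key W' y < key W' x}) (key W')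
        ⟨y₀, mem_filter.2 ⟨hy₀, hy₀'⟩⟩
      rw [mem_filter] at hy
      have hd := ihc (key W' y) (by omega) y hy.1 hy.2.1 rfl
      have hun : ({z ∈ K | z ∉ W' ∧ key W' z ≤ key W' x}) =
          {z ∈ K | z ∉ W' ∧ key W' z ≤ key W' y} ∪
            ({z | z ∉ W' ∧ key W' z = key W' x} : Finset V) := by
        ext z
        simp only [mem_union, mem_filter, mem_univ, true_and]
        constructor
        · rintro ⟨h1, h2, h3⟩
          rcases h3.lt_or_eq with h | h
          · exact Or.inl ⟨h1, h2, hmax z (mem_filter.2 ⟨h1, h2, h⟩)⟩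
          · exact Or.inr ⟨h2, h⟩
        · rintro (⟨h1, h2, h3⟩ | ⟨h1, h2⟩)
          · exact ⟨h1, h2, by omega⟩
          · exact ⟨hCK (by simp [h1, h2]), h1, h2.le⟩
      have hf := hfam W' x Subset.rfl
      rw [hun] at hf ⊢
      refine .union hd hC ?_ hf
      rw [disjoint_left]
      intro z hz hz'
      simp only [mem_filter, mem_univ, true_and] at hz hz'
      omega
    · push Not at hlow
      have : ({y ∈ K | y ∉ W' ∧ key W' y ≤ key W' x}) =
          ({y | y ∉ W' ∧ key W' y = key W' x} : Finset V) := by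
        ext z
        simp only [mem_filter, mem_univ, true_and]
        constructor
        · rintro ⟨h1, h2, h3⟩
          exact ⟨h2, le_antisymm h3 (hlow z h1 h2)⟩
        · rintro ⟨h1, h2⟩
          exact ⟨hCK (by simp [h1, h2]), h1, h2.le⟩
      rw [this]
      exact hC
  have hfam' : ∀ W'' ⊆ W', (K \ W'').Nonempty → IsFam key (3 * m + 1) (K \ W'') := by
    intro W'' hW'' hne
    obtain ⟨x, hx, hmax⟩ := exists_max_image (K \ W'') (key W'') hne
    have : K \ W'' = {y ∈ K | y ∉ W'' ∧ key W'' y ≤ key W'' x} := by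
      ext y
      simp only [mem_sdiff, mem_filter]
      exact ⟨fun h => ⟨h.1, h.2, hmax y (mem_sdiff.2 h)⟩, fun h => ⟨h.1, h.2.1⟩⟩
    rw [this]
    exact hfam W'' x hW''
  -- the vertices of `W'` are added one by one
  have add : ∀ I : Finset V, I ⊆ W' → (K \ (W' \ I)).Nonempty →
      Derivable key (3 * m + 1) (K \ (W' \ I)) := by
    intro I
    induction I using Finset.induction_on with
    | empty =>
      intro _ hne
      rw [sdiff_empty] at hne ⊢
      obtain ⟨x, hx, hmax⟩ := exists_max_image (K \ W') (key W') hne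
      have : K \ W' = {y ∈ K | y ∉ W' ∧ key W' y ≤ key W' x} := by
        ext y
        simp only [mem_sdiff, mem_filter]
        exact ⟨fun h => ⟨h.1, h.2, hmax y (mem_sdiff.2 h)⟩, fun h => ⟨h.1, h.2.1⟩⟩
      rw [this]
      exact init _ x (mem_sdiff.1 hx).1 (mem_sdiff.1 hx).2 rfl
    | insert i I hi ihI =>
      intro hI hne
      have hiW' : i ∈ W' := hI (mem_insert_self _ _)
      have hIW' : I ⊆ W' := (subset_insert _ _).trans hI
      have e : ∀ z, z ∈ K \ (W' \ insert i I) ↔ z ∈ K \ (W' \ I) ∨ (z ∈ K ∧ z = i) := by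
        intro z
        simp only [mem_sdiff, mem_insert, not_and, not_not]
        constructor
        · rintro ⟨h1, h2⟩
          by_cases hz : z = i
          · exact Or.inr ⟨h1, hz⟩
          · exact Or.inl ⟨h1, fun h => (h2 h).resolve_left hz⟩
        · rintro (⟨h1, h2⟩ | ⟨h1, rfl⟩)
          · exact ⟨h1, fun h => Or.inr (h2 h)⟩
          · exact ⟨h1, fun _ => Or.inl rfl⟩
      by_cases hiK : i ∈ K
      · have hun : K \ (W' \ insert i I) = K \ (W' \ I) ∪ {i} := by
          ext z
          rw [e, mem_union, mem_singleton]
          constructor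
          · rintro (h | ⟨_, h⟩) <;> tauto
          · rintro (h | rfl) <;> tauto
        rcases (K \ (W' \ I)).eq_empty_or_nonempty with h0 | h0
        · rw [hun, h0, empty_union]
          exact .single i
        · have hf := hfam' (W' \ insert i I) sdiff_subset hne
          rw [hun] at hf ⊢
          refine .union (ihI hIW' h0) (.single i) ?_ hf
          simp [hiW', hi]
      · have : K \ (W' \ insert i I) = K \ (W' \ I) := by
          ext z
          rw [e]
          constructor
          · rintro (h | ⟨h, rfl⟩) <;> tauto
          · tauto
        rw [this] at hne ⊢
        exact ihI hIW' hne
  have := add W' Subset.rfl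
  rw [Finset.sdiff_self, sdiff_empty] at this
  exact this ⟨r, hr⟩

end derivable

end Dig

/-! ### Duality for weighted perfect matchings -/

namespace Duality

open Finset

/-- Egerváry's theorem: for nonnegative integral weights `w` on the pairs in a relation that contains
a permutation, some integral potentials `r` and `c` cover all weights and have the same sum as the
weights along some permutation in the relation. By Hall's theorem, potentials with the least sum have
enough tight pairs. -/
theorem exists_potentials {V : Type*} [Fintype V] [DecidableEq V] (adj : V → V → Prop)
    (w : V → V → ℕ) (τ₀ : Equiv.Perm V) (hτ₀ : ∀ u, adj u (τ₀ u)) :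
    ∃ (r c : V → ℤ), (∀ u v, adj u v → (w u v : ℤ) ≤ r u + c v) ∧
      ∃ τ : Equiv.Perm V, (∀ u, adj u (τ u)) ∧ ∑ u, r u + ∑ u, c u = ∑ u, (w u (τ u) : ℤ) := by
  classical
  let p : ℕ → Prop := fun k => ∃ (r c : V → ℤ), (∀ u v, adj u v → (w u v : ℤ) ≤ r u + c v) ∧
    ∑ u, r u + ∑ u, c u = k
  have hp : ∃ k, p k := by
    refine ⟨∑ u, ∑ v, w u v, fun u => ∑ v, (w u v : ℤ), fun _ => 0, fun u v _ => ?_, by simp⟩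
    rw [add_zero]
    exact single_le_sum (f := fun v => (w u v : ℤ)) (fun _ _ => by positivity) (mem_univ v)
  obtain ⟨r, c, hrc, hk⟩ := Nat.find_spec hp
  have hmin := fun m => Nat.find_min hp (m := m)
  refine ⟨r, c, hrc, ?_⟩
  let t : V → Finset V := fun u => {v | adj u v ∧ (w u v : ℤ) = r u + c v}
  by_cases hall : ∀ s : Finset V, #s ≤ #(s.biUnion t)
  · obtain ⟨f, hf, hft⟩ := (Finset.all_card_le_biUnion_card_iff_exists_injective t).1 hall
    have hft' : ∀ u, adj u (f u) ∧ (w u (f u) : ℤ) = r u + c (f u) := fun u => by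
      simpa [t] using hft u
    refine ⟨Equiv.ofBijective f (Finite.injective_iff_bijective.1 hf), fun u => (hft' u).1, ?_⟩
    simp only [Equiv.ofBijective_apply, (hft' _).2, sum_add_distrib]
    congr 1
    exact (Equiv.sum_comp (Equiv.ofBijective f (Finite.injective_iff_bijective.1 hf)) c).symm
  · push Not at hall
    obtain ⟨s, hs⟩ := hall
    exfalso
    -- lower the rows in `s` and raise their tight columns
    let r' : V → ℤ := fun u => r u - if u ∈ s then 1 else 0
    let c' : V → ℤ := fun v => c v + if v ∈ s.biUnion t then 1 else 0
    have hrc' : ∀ u v, adj u v → (w u v : ℤ) ≤ r' u + c' v := by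
      intro u v huv
      have h1 := hrc u v huv
      simp only [r', c']
      by_cases hu : u ∈ s
      · by_cases hv : v ∈ s.biUnion t
        · rw [if_pos hu, if_pos hv]; omega
        · rw [if_pos hu, if_neg hv]
          have : (w u v : ℤ) ≠ r u + c v := fun h =>
            hv (mem_biUnion.2 ⟨u, hu, by simp [t, huv, h]⟩)
          omega
      · rw [if_neg hu]
        split_ifs <;> omega
    have hsum : ∑ u, r' u + ∑ u, c' u = (Nat.find hp : ℤ) - #s + #(s.biUnion t) := by
      obtain ⟨N, hN⟩ : ∃ N, N = s.biUnion t := ⟨_, rfl⟩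
      simp only [r', c', sum_sub_distrib, sum_add_distrib, ← hk, ← hN]
      simp
      ring
    have hnn : 0 ≤ ∑ u, r' u + ∑ u, c' u := by
      rw [← Equiv.sum_comp τ₀ c', ← sum_add_distrib]
      exact sum_nonneg fun u _ => (Int.natCast_nonneg _).trans (hrc' u _ (hτ₀ u))
    obtain ⟨k', hk'⟩ := Int.eq_ofNat_of_zero_le hnn
    exact hmin k' (by omega) ⟨r', c', hrc', hk'⟩

end Duality

/-! ### Perfect matchings and the bipartite double cover -/

namespace PMW

open Finset

variable {V : Type*}

/-- The perfect matchings of `G`, as functions that map each vertex to its partner. -/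
def Partner (G : SimpleGraph V) : Type _ := {f : V → V // ∀ u, G.Adj u (f u) ∧ f (f u) = u}

/-- The perfect matching with a given partner function. -/
def Partner.toSubgraph {G : SimpleGraph V} (f : Partner G) : G.Subgraph where
  verts := Set.univ
  Adj u v := f.1 u = v
  adj_sub := by rintro u v rfl; exact (f.2 u).1
  edge_vert _ := Set.mem_univ _
  symm := ⟨by rintro u v rfl; exact (f.2 u).2⟩

theorem Partner.isPerfectMatching {G : SimpleGraph V} (f : Partner G) :
    f.toSubgraph.IsPerfectMatching :=
  SimpleGraph.Subgraph.isPerfectMatching_iff.2 fun v => ⟨f.1 v, rfl, fun _ h => Eq.symm (show f.1 v = _ from h)⟩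

/-- Perfect matchings correspond to partner functions. -/
noncomputable def partnerEquiv (G : SimpleGraph V) :
    Partner G ≃ {M : G.Subgraph // M.IsPerfectMatching} where
  toFun f := ⟨f.toSubgraph, f.isPerfectMatching⟩
  invFun M := ⟨fun v => (SimpleGraph.Subgraph.isPerfectMatching_iff.1 M.2 v).choose, fun u => by
    have h := fun v => (SimpleGraph.Subgraph.isPerfectMatching_iff.1 M.2 v).choose_spec
    exact ⟨(h u).1.adj_sub, ((h _).2 u (h u).1.symm).symm⟩⟩
  left_inv f := Subtype.ext <| funext fun u =>
    ((SimpleGraph.Subgraph.isPerfectMatching_iff.1 f.isPerfectMatching u).choose_spec.2 _ rfl).symm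
  right_inv M := by
    have h := fun v => (SimpleGraph.Subgraph.isPerfectMatching_iff.1 M.2 v).choose_spec
    refine Subtype.ext (SimpleGraph.Subgraph.ext ?_ ?_)
    · exact (SimpleGraph.Subgraph.isSpanning_iff.1 M.2.2).symm
    · ext u v
      exact ⟨fun e => by rw [← show _ = v from e]; exact (h u).1,
        fun e => ((h u).2 v e).symm⟩

theorem numPerfectMatchings_eq (G : SimpleGraph V) : numPerfectMatchings G = Nat.card (Partner G) :=
  (Nat.card_coe_set_eq _).symm.trans (Nat.card_congr (partnerEquiv G)).symm

/-- A perfect matching of the double cover of a bipartite graph consists of two perfect matchings of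
the graph. -/
theorem card_perm_eq_sq [Finite V] {G : SimpleGraph V} (hG : G.IsBipartite) :
    Nat.card {τ : Equiv.Perm V // ∀ u, G.Adj u (τ u)} = numPerfectMatchings G ^ 2 := by
  classical
  obtain ⟨C⟩ := hG
  have hC : ∀ {u v}, G.Adj u v → (C u = 0 ↔ ¬ C v = 0) := fun {u v} h => by
    have := C.valid h
    omega
  rw [numPerfectMatchings_eq, sq, ← Nat.card_prod]
  symm
  refine Nat.card_congr (Equiv.ofBijective (fun fg => ⟨?_, ?_⟩) ⟨?_, ?_⟩)
  · refine Equiv.ofBijective (fun u => if C u = 0 then fg.1.1 u else fg.2.1 u)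
      (Finite.injective_iff_bijective.1 fun u v huv => ?_)
    beta_reduce at huv
    have h1 := hC (fg.1.2 u).1
    have h2 := hC (fg.2.2 u).1
    have h3 := hC (fg.1.2 v).1
    have h4 := hC (fg.2.2 v).1
    split_ifs at huv with hu hv hv
    · rw [← (fg.1.2 u).2, huv, (fg.1.2 v).2]
    · rw [huv] at h1; tauto
    · rw [huv] at h2; tauto
    · rw [← (fg.2.2 u).2, huv, (fg.2.2 v).2]
  · intro u
    simp only [Equiv.ofBijective_apply]
    split_ifs
    · exact (fg.1.2 u).1
    · exact (fg.2.2 u).1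
  · rintro ⟨f, g⟩ ⟨f', g'⟩ h
    have h' : ∀ u, (if C u = 0 then f.1 u else g.1 u) = if C u = 0 then f'.1 u else g'.1 u :=
      fun u => Equiv.congr_fun (congrArg Subtype.val h) u
    have key : ∀ {p p' : Partner G} {P : V → Prop}, (∀ u, P u → p.1 u = p'.1 u) →
        (∀ u, ¬ P u → P (p'.1 u)) → p = p' := by
      intro p p' P h1 h2
      refine Subtype.ext (funext fun u => ?_)
      by_cases hu : P u
      · exact h1 u hu
      · have := h1 _ (h2 u hu)
        rw [(p'.2 u).2] at this
        rw [← (p.2 (p'.1 u)).2, this]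
    have e1 : f = f' := key (P := fun u => C u = 0) (fun u hu => by simpa [hu] using h' u)
      fun u hu => by have := hC (f'.2 u).1; tauto
    have e2 : g = g' := key (P := fun u => ¬ C u = 0) (fun u hu => by simpa [hu] using h' u)
      fun u hu => by have := hC (g'.2 u).1; tauto
    rw [e1, e2]
  · rintro ⟨τ, hτ⟩
    have inv : ∀ u, G.Adj u (τ.symm u) := fun u => by
      simpa using (hτ (τ.symm u)).symm
    have a1 := fun u => hC (hτ u)
    have a2 := fun u => hC (inv u)
    refine ⟨(⟨fun u => if C u = 0 then τ u else τ.symm u, fun u => ?_⟩,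
      ⟨fun u => if C u = 0 then τ.symm u else τ u, fun u => ?_⟩), ?_⟩
    · by_cases hu : C u = 0
      · have h1 := (a1 u).1 hu
        simp [hu, h1, hτ]
      · have h1 : C (τ.symm u) = 0 := by have := a2 u; tauto
        simp [hu, h1, inv]
    · by_cases hu : C u = 0
      · have h1 := (a2 u).1 hu
        simp [hu, h1, inv]
      · have h1 : C (τ u) = 0 := by have := a1 u; tauto
        simp [hu, h1, hτ]
    · refine Subtype.ext (Equiv.ext fun u => ?_)
      simp only [Equiv.ofBijective_apply]
      split_ifs <;> rfl

end PMW

/-! ### Porosity of cuts and separators -/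

namespace PMW

open Finset

variable {V : Type*}

/-- Every perfect matching has at most as many edges in a cut as the matching porosity; here its edges
are counted by one endpoint. -/
theorem card_crossing_le [Fintype V] [DecidableEq V] {G : SimpleGraph V} (f : Partner G)
    {P : V → Prop} [DecidablePred P] (hP : ∀ u, P u → ¬ P (f.1 u)) (X : Set V) [DecidablePred (· ∈ X)] :
    #{u | P u ∧ ¬ (u ∈ X ↔ f.1 u ∈ X)} ≤ matchingPorosity G X := by
  refine le_trans ?_ (le_ciSup (f := fun M : {M : G.Subgraph // M.IsPerfectMatching} =>
    (M.1.edgeSet ∩ edgeCut G X).ncard) (Set.finite_range _).bddAbove ⟨_, f.isPerfectMatching⟩)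
  rw [← Set.ncard_coe_finset]
  refine Set.ncard_le_ncard_of_injOn (fun u => s(u, f.1 u)) ?_ ?_ (Set.toFinite _)
  · intro u hu
    simp only [coe_filter, mem_univ, true_and, Set.mem_ofPred_eq] at hu
    refine ⟨SimpleGraph.Subgraph.mem_edgeSet.2 rfl, (f.2 u).1, ?_⟩
    by_cases h : u ∈ X
    · exact ⟨u, h, f.1 u, by tauto, rfl⟩
    · exact ⟨f.1 u, by tauto, u, h, Sym2.eq_swap⟩
  · intro u hu v hv huv
    simp only [coe_filter, mem_univ, true_and, Set.mem_ofPred_eq] at hu hv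
    rcases Sym2.eq_iff.1 huv with h | h
    · exact h.1
    · exact absurd (h.1 ▸ hu.1) (hP v hv.1)

/-- A perfect matching of the double cover of a bipartite graph has at most twice as many edges in a
cut as the matching porosity. -/
theorem sum_crossing_le [Fintype V] [DecidableEq V] {G : SimpleGraph V} (hG : G.IsBipartite)
    (τ : Equiv.Perm V) (hτ : ∀ u, G.Adj u (τ u)) (X : Set V) [DecidablePred (· ∈ X)] :
    ∑ u, (if (u ∈ X ↔ τ u ∈ X) then 0 else 1) ≤ 2 * matchingPorosity G X := by
  obtain ⟨C⟩ := hG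
  have hC : ∀ {u v}, G.Adj u v → (C u = 0 ↔ ¬ C v = 0) := fun {u v} h => by
    have := C.valid h
    omega
  have inv : ∀ u, G.Adj u (τ.symm u) := fun u => by simpa using (hτ (τ.symm u)).symm
  have a1 := fun u => hC (hτ u)
  have a2 := fun u => hC (inv u)
  let f : Partner G := ⟨fun u => if C u = 0 then τ u else τ.symm u, fun u => by
    by_cases hu : C u = 0
    · have h1 := (a1 u).1 hu
      simp [hu, h1, hτ]
    · have h1 : C (τ.symm u) = 0 := by have := a2 u; tauto
      simp [hu, h1, inv]⟩
  let g : Partner G := ⟨fun u => if C u = 0 then τ.symm u else τ u, fun u => by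
    by_cases hu : C u = 0
    · have h1 := (a2 u).1 hu
      simp [hu, h1, inv]
    · have h1 : C (τ u) = 0 := by have := a1 u; tauto
      simp [hu, h1, hτ]⟩
  have h1 := card_crossing_le f (P := fun u => C u = 0) (fun u hu => (hC (f.2 u).1).1 hu) X
  have h2 := card_crossing_le g (P := fun u => ¬ C u = 0)
    (fun u hu => by have := hC (g.2 u).1; tauto) X
  have e : ∑ u, (if (u ∈ X ↔ τ u ∈ X) then 0 else 1) = #{u | ¬ (u ∈ X ↔ τ u ∈ X)} := by
    rw [card_filter]
    exact sum_congr rfl fun u _ => by split_ifs <;> rfl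
  have e' := card_filter_add_card_filter_not (s := ({u | ¬ (u ∈ X ↔ τ u ∈ X)} : Finset V))
    (fun u => C u = 0)
  rw [filter_filter, filter_filter] at e'
  have e1 : ({u | ¬ (u ∈ X ↔ τ u ∈ X) ∧ C u = 0} : Finset V) =
      ({u | C u = 0 ∧ ¬ (u ∈ X ↔ f.1 u ∈ X)} : Finset V) := by
    refine filter_congr fun u _ => ?_
    rw [and_comm]
    refine and_congr_right fun hu => ?_
    simp [f, hu]
  have e2 : ({u | ¬ (u ∈ X ↔ τ u ∈ X) ∧ ¬ C u = 0} : Finset V) =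
      ({u | ¬ C u = 0 ∧ ¬ (u ∈ X ↔ g.1 u ∈ X)} : Finset V) := by
    refine filter_congr fun u _ => ?_
    rw [and_comm]
    refine and_congr_right fun hu => ?_
    simp [g, hu]
  rw [e1, e2] at e'
  omega

/-- A cut of matching porosity at most `k` has a separator with at most `2 * k` vertices in the
digraph that arises from the double cover by contracting the perfect matching `σ`: potentials for the
cut edges are constant on strong components outside the set of vertices where they are positive on
the edges of `σ`. -/
theorem exists_separator [Fintype V] [DecidableEq V] {G : SimpleGraph V} (hG : G.IsBipartite)
    (σ : Equiv.Perm V) (hσ : ∀ u, G.Adj u (σ u)) {X : Set V} {k : ℕ} (hX : matchingPorosity G X ≤ k) :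
    ∃ S : Finset V, #S ≤ 2 * k ∧ ∀ S', S ⊆ S' → ∀ u v,
      Dig.Reaches (fun u v => G.Adj u (σ v)) S' u v →
      Dig.Reaches (fun u v => G.Adj u (σ v)) S' v u → (u ∈ X ↔ v ∈ X) := by
  classical
  obtain ⟨r, c, hrc, τ, hτ, hsum⟩ := Duality.exists_potentials G.Adj
    (fun u v => if (u ∈ X ↔ v ∈ X) then 0 else 1) σ hσ
  have hnn : ∀ u v, G.Adj u v → 0 ≤ r u + c v := fun u v h =>
    (Int.natCast_nonneg _).trans (hrc u v h)
  have hcross : ∀ u v, G.Adj u v → r u + c v ≤ 0 → (u ∈ X ↔ v ∈ X) := by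
    intro u v h h0
    have := hrc u v h
    by_contra hne
    rw [if_neg hne] at this
    push_cast at this
    omega
  refine ⟨({v | 1 ≤ r v + c (σ v)} : Finset V), ?_, ?_⟩
  · have h1 := sum_crossing_le hG τ hτ X
    have h2 : ∑ u, (r u + c (σ u)) ≤ 2 * k := by
      rw [sum_add_distrib, Equiv.sum_comp σ c, hsum]
      exact_mod_cast h1.trans (Nat.mul_le_mul_left _ hX)
    have h3 : ∑ u, (if 1 ≤ r u + c (σ u) then (1 : ℤ) else 0) ≤ ∑ u, (r u + c (σ u)) :=
      sum_le_sum fun u _ => by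
        split_ifs with h
        · exact h
        · exact hnn _ _ (hσ u)
    rw [← sum_filter, sum_const, nsmul_eq_mul, mul_one] at h3
    exact_mod_cast h3.trans h2
  · intro S' hS' u v huv hvu
    have hout : ∀ z, z ∉ S' → r z + c (σ z) ≤ 0 := fun z hz => by
      by_contra h
      exact hz (hS' (by simp; omega))
    have mono : ∀ u v, Dig.Reaches (fun u v => G.Adj u (σ v)) S' u v → r v ≤ r u := by
      intro u v h
      induction h with
      | refl => exact le_rfl
      | @tail b z _ h ih =>
        have := hnn _ _ h.1
        have := hout z h.2
        omega
    have aux : ∀ z, Dig.Reaches (fun u v => G.Adj u (σ v)) S' u z →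
        Dig.Reaches (fun u v => G.Adj u (σ v)) S' z v → (u ∈ X ↔ z ∈ X) := by
      intro z hz
      induction hz with
      | refl => exact fun _ => Iff.rfl
      | @tail b z hub h ih =>
        intro hzv
        rw [ih (.head h hzv)]
        have h1 := mono _ _ hub
        have h2 := mono _ _ hzv
        have h3 := mono _ _ hvu
        have h4 := hout z h.2
        rw [hcross b (σ z) h.1 (by omega), hcross z (σ z) (hσ z) h4]
    exact aux v huv .refl

/-! ### Cubic trees -/

section tree

variable {T : Type*} {G : SimpleGraph T}

/-- The component that contains `s` after the edge `st` is deleted. -/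
def side (G : SimpleGraph T) (s t : T) : Set T := {x | (G.deleteEdges {s(s, t)}).Reachable s x}

theorem self_mem_side (s t : T) : s ∈ side G s t := SimpleGraph.Reachable.refl _

theorem mem_side_of_adj {s t x y : T} (hx : x ∈ side G s t) (h : G.Adj x y) (hne : s(x, y) ≠ s(s, t)) :
    y ∈ side G s t :=
  SimpleGraph.Reachable.trans hx (SimpleGraph.Adj.reachable (by simp [h, hne]))

theorem side_induction {s t : T} {P : T → Prop} (h0 : P s)
    (h : ∀ x ∈ side G s t, ∀ y ∈ side G s t, P x → G.Adj x y → s(x, y) ≠ s(s, t) → P y) :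
    ∀ x ∈ side G s t, P x := by
  intro x hx
  have hx' := (SimpleGraph.reachable_iff_reflTransGen _ _).1 hx
  induction hx' with
  | refl => exact h0
  | @tail b z hb hbz ih =>
    have hb' : b ∈ side G s t := (SimpleGraph.reachable_iff_reflTransGen _ _).2 hb
    simp only [SimpleGraph.deleteEdges_adj, Set.mem_singleton_iff] at hbz
    exact h b hb' z hx (ih hb') hbz.1 hbz.2

theorem mem_side_or_mem_side (hG : G.Connected) (s t x : T) : x ∈ side G s t ∨ x ∈ side G t s := by
  have hx := (SimpleGraph.reachable_iff_reflTransGen _ _).1 (hG.preconnected s x)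
  induction hx with
  | refl => exact Or.inl (self_mem_side _ _)
  | @tail b z hb hbz ih =>
    by_cases he : s(b, z) = s(s, t)
    · rcases Sym2.eq_iff.1 he with h | h
      · rw [h.2]; exact Or.inr (self_mem_side _ _)
      · rw [h.2]; exact Or.inl (self_mem_side _ _)
    · exact ih.imp (fun h => mem_side_of_adj h hbz he)
        fun h => mem_side_of_adj h hbz (by rwa [Sym2.eq_swap (a := t)])

theorem notMem_side (hG : G.IsAcyclic) {s t : T} (h : G.Adj s t) : t ∉ side G s t := by
  have := SimpleGraph.isAcyclic_iff_forall_adj_isBridge.1 hG h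
  rw [SimpleGraph.isBridge_iff] at this
  exact this

theorem side_ssubset (hG : G.IsAcyclic) {s t a : T} (ha : G.Adj s a) (hat : a ≠ t) :
    side G a s ⊂ side G s t := by
  refine ⟨?_, fun h => notMem_side hG ha.symm (h (self_mem_side _ _))⟩
  refine side_induction ?_ ?_
  · exact mem_side_of_adj (self_mem_side _ _) ha (by simp [hat, ha.ne'])
  · intro x hx y hy hxs hxy _
    refine mem_side_of_adj hxs hxy fun he => ?_
    rcases Sym2.eq_iff.1 he with h | h
    · exact notMem_side hG ha.symm (h.1 ▸ hx)
    · exact notMem_side hG ha.symm (h.2 ▸ hy)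

theorem exists_mem_side {s t x : T} (hx : x ∈ side G s t) (hxs : x ≠ s) :
    ∃ a, G.Adj s a ∧ a ≠ t ∧ x ∈ side G a s := by
  refine (side_induction (P := fun x => x = s ∨ ∃ a, G.Adj s a ∧ a ≠ t ∧ x ∈ side G a s)
    (Or.inl rfl) ?_ x hx).resolve_left hxs
  rintro x _ y _ (rfl | ⟨a, ha, hat, hxa⟩) hxy hne
  · exact Or.inr ⟨y, hxy, fun h => hne (by rw [h]), self_mem_side _ _⟩
  · by_cases he : s(x, y) = s(a, s)
    · rcases Sym2.eq_iff.1 he with h | h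
      · exact Or.inl h.2
      · exact Or.inr ⟨a, ha, hat, by rw [h.2]; exact self_mem_side _ _⟩
    · exact Or.inr ⟨a, ha, hat, mem_side_of_adj hxa hxy he⟩

end tree

theorem Decomposition.mem_shore (D : Decomposition V) {s t : Fin D.m} {v : V} :
    v ∈ D.shore s t ↔ (D.δ.symm v).1 ∈ side D.T s t := Iff.rfl

theorem Decomposition.porosity_le_width [Finite V] (D : Decomposition V) (G : SimpleGraph V)
    {s t : Fin D.m} (h : D.T.Adj s t) : matchingPorosity G (D.shore s t) ≤ D.width G :=
  le_ciSup (f := fun p : {p : Fin D.m × Fin D.m // D.T.Adj p.1 p.2} =>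
    matchingPorosity G (D.shore p.1.1 p.1.2)) (Set.finite_range _).bddAbove ⟨(s, t), h⟩

theorem Decomposition.shore_leaf (D : Decomposition V) {s t : Fin D.m} (h : D.T.Adj s t)
    (hs : (D.T.neighborSet s).ncard = 1) {v : V} : v ∈ D.shore s t ↔ (D.δ.symm v).1 = s := by
  rw [mem_shore]
  constructor
  · intro hv
    by_contra hne
    obtain ⟨a, ha, hat, _⟩ := exists_mem_side hv hne
    obtain ⟨b, hb⟩ := Set.ncard_eq_one.1 hs
    have h1 : a ∈ D.T.neighborSet s := ha
    have h2 : t ∈ D.T.neighborSet s := h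
    rw [hb] at h1 h2
    exact hat (h1.trans h2.symm)
  · rintro h; rw [h]; exact self_mem_side _ _

theorem Decomposition.one_le_width [Finite V] (D : Decomposition V) {G : SimpleGraph V}
    (f : Partner G) (v : V) : 1 ≤ D.width G := by
  classical
  have := Fintype.ofFinite V
  obtain ⟨t, ht⟩ := Set.ncard_eq_one.1 (D.δ.symm v).2
  have hadj : D.T.Adj (D.δ.symm v).1 t := by
    have : t ∈ D.T.neighborSet (D.δ.symm v).1 := by rw [ht]; rfl
    exact this
  refine le_trans ?_ (D.porosity_le_width G hadj)
  refine le_trans ?_ (card_crossing_le f (P := fun u => u = v)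
    (fun u hu h => (f.2 u).1.ne (hu.trans h.symm)) _)
  refine card_pos.2 ⟨v, ?_⟩
  have h1 := D.shore_leaf hadj (D.δ.symm v).2 (v := v)
  have h2 := D.shore_leaf hadj (D.δ.symm v).2 (v := f.1 v)
  simp only [Subtype.val_inj, EmbeddingLike.apply_eq_iff_eq] at h1 h2
  simp only [mem_filter, mem_univ, true_and, h1, h2]
  simp [(f.2 v).1.ne']

/-- A decomposition of width at most `k` provides balanced separators: for a smallest side that has at
least half of `Y`, the three cuts at its end vertex are separated. -/
theorem exists_balanced_separator [Fintype V] [DecidableEq V] {G : SimpleGraph V} (hG : G.IsBipartite)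
    (σ : Equiv.Perm V) (hσ : ∀ u, G.Adj u (σ u)) (D : Decomposition V) {k : ℕ} (hk : 1 ≤ k)
    (hD : D.width G ≤ k) {key : Finset V → V → ℕ}
    (hkey : Dig.IsKey (fun u v => G.Adj u (σ v)) key) (Y : Finset V) :
    ∃ S : Finset V, #S ≤ 6 * k ∧
      ∀ u ∉ S, 2 * #{y ∈ Y | y ∉ S ∧ key S y = key S u} ≤ #Y := by
  classical
  by_cases hY : #Y ≤ 6 * k
  · refine ⟨Y, hY, fun u _ => ?_⟩
    have : ({y ∈ Y | y ∉ Y ∧ key Y y = key Y u}) = ∅ := by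
      ext y; simp only [mem_filter, notMem_empty, iff_false]; tauto
    rw [this]; simp
  have hor : ∀ s t : Fin D.m, #Y ≤ 2 * #{y ∈ Y | y ∈ D.shore s t} ∨
      #Y ≤ 2 * #{y ∈ Y | y ∈ D.shore t s} := by
    intro s t
    have : Y ⊆ ({y ∈ Y | y ∈ D.shore s t}) ∪ {y ∈ Y | y ∈ D.shore t s} := by
      intro y hy
      simp only [mem_union, mem_filter, hy, true_and, D.mem_shore]
      exact mem_side_or_mem_side D.isTree.connected _ _ _
    have := (card_le_card this).trans (card_union_le _ _)
    omega
  obtain ⟨v, hv⟩ : Y.Nonempty := card_pos.1 (by omega)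
  obtain ⟨t, ht⟩ := Set.ncard_eq_one.1 (D.δ.symm v).2
  have hadj : D.T.Adj (D.δ.symm v).1 t := by
    have : t ∈ D.T.neighborSet (D.δ.symm v).1 := by rw [ht]; rfl
    exact this
  obtain ⟨p, hp, hmin⟩ := exists_min_image
    ({p | D.T.Adj p.1 p.2 ∧ #Y ≤ 2 * #{y ∈ Y | y ∈ D.shore p.1 p.2}} : Finset (Fin D.m × Fin D.m))
    (fun p => (side D.T p.1 p.2).ncard) (by
      rcases hor (D.δ.symm v).1 t with h | h
      · exact ⟨(_, _), mem_filter.2 ⟨mem_univ _, hadj, h⟩⟩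
      · exact ⟨(_, _), mem_filter.2 ⟨mem_univ _, hadj.symm, h⟩⟩)
  obtain ⟨s, t⟩ := p
  simp only [mem_filter, mem_univ, true_and, and_imp, Prod.forall] at hp hmin
  obtain ⟨hst, hheavy⟩ := hp
  have light : ∀ a, D.T.Adj s a → a ≠ t → 2 * #{y ∈ Y | y ∈ D.shore a s} < #Y := by
    intro a ha hat
    by_contra h
    have := hmin a s ha.symm (by omega)
    have := Set.ncard_lt_ncard (side_ssubset D.isTree.isAcyclic ha hat) (Set.toFinite _)
    omega
  rcases D.cubic s with hs | hs
  · exfalso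
    have : #{y ∈ Y | y ∈ D.shore s t} ≤ 1 := by
      refine card_le_one.2 fun x hx y hy => ?_
      simp only [mem_filter, D.shore_leaf hst hs] at hx hy
      exact D.δ.symm.injective (Subtype.ext (hx.2.trans hy.2.symm))
    omega
  · have hts : t ∈ D.T.neighborSet s := hst
    have h2 : (D.T.neighborSet s \ {t}).ncard = 2 := by
      rw [Set.ncard_sdiff_singleton_of_mem hts, hs]
    obtain ⟨a, b, _, hab⟩ := Set.ncard_eq_two.1 h2
    have mem : ∀ x, (D.T.Adj s x ∧ x ≠ t) ↔ x = a ∨ x = b := fun x => by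
      have := Set.ext_iff.1 hab x
      simpa using this
    obtain ⟨ha, hat⟩ := (mem a).2 (Or.inl rfl)
    obtain ⟨hb, hbt⟩ := (mem b).2 (Or.inr rfl)
    obtain ⟨S₁, hS₁, h₁⟩ := exists_separator hG σ hσ ((D.porosity_le_width G hst).trans hD)
    obtain ⟨S₂, hS₂, h₂⟩ := exists_separator hG σ hσ ((D.porosity_le_width G ha.symm).trans hD)
    obtain ⟨S₃, hS₃, h₃⟩ := exists_separator hG σ hσ ((D.porosity_le_width G hb.symm).trans hD)
    refine ⟨S₁ ∪ S₂ ∪ S₃, ?_, fun u hu => ?_⟩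
    · have := card_union_le (S₁ ∪ S₂) S₃
      have := card_union_le S₁ S₂
      omega
    set S := S₁ ∪ S₂ ∪ S₃ with hS
    have sub₁ : S₁ ⊆ S := subset_union_left.trans subset_union_left
    have sub₂ : S₂ ⊆ S := subset_union_right.trans subset_union_left
    have sub₃ : S₃ ⊆ S := subset_union_right
    have bound : ∀ Z : Finset V, (∀ y ∈ Y, y ∉ S → key S y = key S u → y ∈ Z) →
        #{y ∈ Y | y ∉ S ∧ key S y = key S u} ≤ #Z := fun Z hZ =>
      card_le_card fun y hy => by
        rw [mem_filter] at hy
        exact hZ y hy.1 hy.2.1 hy.2.2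
    by_cases hua : u ∈ D.shore a s
    · have := bound {y ∈ Y | y ∈ D.shore a s} fun y hy _ h => mem_filter.2 ⟨hy,
        (h₂ S sub₂ y u (hkey.reaches _ _ _ h.symm) (hkey.reaches _ _ _ h)).2 hua⟩
      have := light a ha hat
      omega
    by_cases hub : u ∈ D.shore b s
    · have := bound {y ∈ Y | y ∈ D.shore b s} fun y hy _ h => mem_filter.2 ⟨hy,
        (h₃ S sub₃ y u (hkey.reaches _ _ _ h.symm) (hkey.reaches _ _ _ h)).2 hub⟩
      have := light b hb hbt
      omega
    · have hust : u ∉ D.shore s t := by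
        intro hu
        obtain ⟨c, hc, hct, huc⟩ := exists_mem_side (D.mem_shore.1 hu) fun h => by
          have := (D.δ.symm u).2
          rw [h] at this
          omega
        rcases (mem c).1 ⟨hc, hct⟩ with rfl | rfl
        · exact hua huc
        · exact hub huc
      have := bound {y ∈ Y | y ∉ D.shore s t} fun y hy _ h => mem_filter.2 ⟨hy,
        fun hy' => hust ((h₁ S sub₁ y u (hkey.reaches _ _ _ h.symm) (hkey.reaches _ _ _ h)).1 hy')⟩
      have := card_filter_add_card_filter_not (s := Y) (· ∈ D.shore s t)
      omega

end PMW

/-! ### A perfect matching decomposition -/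

namespace PMW

open Finset

/-- A tree with vertices of degrees one and three only, with `2 * n - 2` vertices, has `n` leaves. -/
theorem card_leaves {n m : ℕ} (hm : m + 2 = 2 * n) {T : SimpleGraph (Fin m)}
    (hT : T.IsTree) (h : ∀ t, (T.neighborSet t).ncard = 1 ∨ (T.neighborSet t).ncard = 3) :
    Nat.card {t : Fin m // (T.neighborSet t).ncard = 1} = n := by
  classical
  have h1 := T.sum_degrees_eq_twice_card_edges
  have h2 := hT.card_edgeFinset
  have h3 : ∀ t, T.degree t = if (T.neighborSet t).ncard = 1 then 1 else 3 := by
    intro t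
    have : T.degree t = (T.neighborSet t).ncard := by
      rw [← SimpleGraph.card_neighborSet_eq_degree, Set.ncard_eq_toFinset_card']
      exact (Set.toFinset_card _).symm
    rw [this]
    rcases h t with h | h <;> simp [h]
  have h4 := card_filter_add_card_filter_not (s := (univ : Finset (Fin m)))
    (fun t => (T.neighborSet t).ncard = 1)
  simp only [h3, sum_ite, sum_const, smul_eq_mul] at h1
  rw [Nat.card_eq_fintype_card, Fintype.card_subtype]
  simp only [card_univ, Fintype.card_fin] at h2 h4
  omega

/-- The parent of a vertex in the caterpillar with the spine `0, 1, 3, 5, …`. -/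
def parent (i : ℕ) : ℕ := 2 * (i / 2) - 1

/-- The caterpillar in which the odd vertices have degree three. -/
def caterpillar (m : ℕ) : SimpleGraph (Fin m) where
  Adj s t := (s.1 ≠ 0 ∧ t.1 = parent s) ∨ (t.1 ≠ 0 ∧ s.1 = parent t)
  symm := ⟨fun _ _ h => h.symm⟩
  loopless := ⟨fun s h => by simp only [parent] at h; omega⟩

theorem isTree_caterpillar {m : ℕ} (hm : 0 < m) : (caterpillar m).IsTree := by
  classical
  have : NeZero m := ⟨hm.ne'⟩
  rw [SimpleGraph.isTree_iff_connected_and_card]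
  constructor
  · have key : ∀ i, ∀ hi : i < m, (caterpillar m).Reachable 0 ⟨i, hi⟩ := by
      intro i
      induction i using Nat.strong_induction_on with
      | _ i ih =>
      intro hi
      by_cases h0 : i = 0
      · subst h0; exact SimpleGraph.Reachable.refl _
      · have hp : parent i < i := by simp only [parent]; omega
        exact (ih _ hp (hp.trans hi)).trans (SimpleGraph.Adj.reachable (Or.inr ⟨h0, rfl⟩))
    exact ⟨fun s t => (key s s.2).symm.trans (key t t.2)⟩
  · have hlt : ∀ i : Fin m, parent i < m := fun i => by simp only [parent]; omega
    have e : (caterpillar m).edgeSet =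
        (fun i : Fin m => s(i, ⟨parent i, hlt i⟩)) '' {i : Fin m | i ≠ 0} := by
      ext x
      induction x using Sym2.ind with
      | _ s t =>
      simp only [SimpleGraph.mem_edgeSet, Set.mem_image, Set.mem_ofPred_eq]
      constructor
      · rintro (⟨h, h'⟩ | ⟨h, h'⟩)
        · exact ⟨s, fun h0 => h (by rw [h0]; rfl), by rw [Sym2.eq_iff]; exact Or.inl ⟨rfl, Fin.ext h'.symm⟩⟩
        · exact ⟨t, fun h0 => h (by rw [h0]; rfl), by rw [Sym2.eq_iff]; exact Or.inr ⟨rfl, Fin.ext h'.symm⟩⟩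
      · rintro ⟨i, hi, he⟩
        have hi' : i.1 ≠ 0 := fun h => hi (Fin.ext h)
        rcases Sym2.eq_iff.1 he with ⟨rfl, rfl⟩ | ⟨rfl, rfl⟩
        · exact Or.inl ⟨hi', rfl⟩
        · exact Or.inr ⟨hi', rfl⟩
    rw [e, Nat.card_coe_set_eq, Set.InjOn.ncard_image]
    · have : {i : Fin m | i ≠ 0} = {0}ᶜ := rfl
      rw [this, Set.ncard_compl, Set.ncard_singleton, Nat.card_fin]
      omega
    · intro i hi j hj h
      rcases Sym2.eq_iff.1 h with h | ⟨h1, h2⟩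
      · exact h.1
      · have hi' : i.1 ≠ 0 := fun h => hi (Fin.ext h)
        have h1 : i.1 = parent j := congrArg Fin.val h1
        have h2 : parent i = j.1 := congrArg Fin.val h2
        simp only [parent] at h1 h2
        omega

theorem caterpillar_cubic {n m : ℕ} (hn : 2 ≤ n) (hm : m + 2 = 2 * n) (t : Fin m) :
    ((caterpillar m).neighborSet t).ncard = 1 ∨ ((caterpillar m).neighborSet t).ncard = 3 := by
  have hlt : parent t < m := by simp only [parent]; omega
  by_cases h0 : t.1 = 0
  · left
    rw [Set.ncard_eq_one]
    refine ⟨⟨1, by omega⟩, Set.ext fun s => ?_⟩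
    simp only [SimpleGraph.mem_neighborSet, caterpillar, parent, Set.mem_singleton_iff, Fin.ext_iff]
    omega
  by_cases h1 : t.1 % 2 = 1 ∧ t.1 + 2 < m
  · right
    rw [Set.ncard_eq_three]
    refine ⟨⟨parent t, hlt⟩, ⟨t.1 + 1, by omega⟩, ⟨t.1 + 2, by omega⟩, ?_, ?_, ?_, Set.ext fun s => ?_⟩
    · simp only [ne_eq, Fin.ext_iff, parent]; omega
    · simp only [ne_eq, Fin.ext_iff, parent]; omega
    · simp only [ne_eq, Fin.ext_iff]; omega
    simp only [SimpleGraph.mem_neighborSet, caterpillar, parent, Set.mem_singleton_iff,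
      Set.mem_insert_iff, Fin.ext_iff]
    omega
  · left
    rw [Set.ncard_eq_one]
    refine ⟨⟨parent t, hlt⟩, Set.ext fun s => ?_⟩
    simp only [SimpleGraph.mem_neighborSet, caterpillar, parent, Set.mem_singleton_iff, Fin.ext_iff]
    omega

theorem nonempty_decomposition {n : ℕ} (hn : 2 ≤ n) : Nonempty (Decomposition (Fin n)) := by
  have hm : 2 * n - 2 + 2 = 2 * n := by omega
  have hT := isTree_caterpillar (m := 2 * n - 2) (by omega)
  exact ⟨⟨_, _, hT, caterpillar_cubic hn hm, Finite.equivFinOfCardEq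
    (card_leaves hm hT (caterpillar_cubic hn hm))⟩⟩

/-- The width of some decomposition is `pmw G`. -/
theorem exists_width_eq_pmw {n : ℕ} (hn : 2 ≤ n) (G : SimpleGraph (Fin n)) :
    ∃ D : Decomposition (Fin n), D.width G = pmw G :=
  have := nonempty_decomposition hn
  Nat.sInf_mem (Set.range_nonempty fun D : Decomposition (Fin n) => D.width G)

end PMW

/-! ### The auction finds a perfect matching -/

namespace Alg

open Arith Finset

/-- The invariant of the auction: a row owns at most one column, columns that were never bid for are
free of charge, and the column of a row is at most one unit more expensive than any other column that
is adjacent to the row. -/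
structure IsAuction (n A S : ℕ) : Prop where
  price_le : ∀ j < n, price n S j ≤ n
  inj : ∀ j < n, ∀ j' < n, owner n S j = owner n S j' → owner n S j ≠ 0 → j = j'
  adj : ∀ j < n, ∀ i, owner n S j = i + 1 → adj n A i j
  slack : ∀ j < n, ∀ i, owner n S j = i + 1 → ∀ k < n, Alg.adj n A i k → price n S j ≤ price n S k + 1
  pos : ∀ j < n, price n S j ≠ 0 → owner n S j ≠ 0

theorem owner_le (n S j : ℕ) : owner n S j ≤ n := Nat.lt_succ_iff.1 (Nat.mod_lt _ (by omega))

variable {n A S : ℕ} {τ : ℕ → ℕ}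

/-- As long as a row is free, some column that is adjacent to it costs less than `n`: the number of
the columns with price at least `t` strictly decreases in `t` up to the least price of these columns,
because the permutation `τ` maps the owners of the columns with price greater than `t` to columns with
price at least `t`, and none of these is the image of the free row. -/
theorem IsAuction.lt_of_free (h : IsAuction n A S) (hτ : ∀ u < n, τ u < n ∧ Alg.adj n A u (τ u))
    (hinj : Set.InjOn τ (Set.Iio n)) {i p : ℕ} (hi : i < n) (hfree : ∀ j < n, owner n S j ≠ i + 1)
    (hp : ∀ k < n, Alg.adj n A i k → p ≤ price n S k) : p < n := by
  have key : ∀ t ≤ p, #{j ∈ range n | t ≤ price n S j} + t ≤ n := by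
    intro t
    induction t with
    | zero => intro _; simp
    | succ t ih =>
      intro ht
      have ih := ih (by omega)
      have : #{j ∈ range n | t + 1 ≤ price n S j} ≤
          #(({j ∈ range n | t ≤ price n S j}).erase (τ i)) := by
        refine card_le_card_of_injOn (fun j => τ (owner n S j - 1)) (fun j hj => ?_) ?_
        · simp only [coe_filter, mem_range, Set.mem_ofPred_eq] at hj
          obtain ⟨k, hk⟩ := Nat.exists_eq_succ_of_ne_zero (h.pos j hj.1 (by omega))
          have hkn : k < n := by have := owner_le n S j; omega
          have hτk := hτ k hkn
          have := h.slack j hj.1 k hk _ hτk.1 hτk.2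
          simp only [hk, Nat.succ_sub_one, coe_erase, coe_filter, mem_range, Set.mem_sdiff,
            Set.mem_ofPred_eq, Set.mem_singleton_iff]
          refine ⟨⟨hτk.1, by omega⟩, fun e => hfree j hj.1 ?_⟩
          rw [hk, hinj hkn hi e]
        · intro j hj j' hj' e
          simp only [coe_filter, mem_range, Set.mem_ofPred_eq] at hj hj'
          have h1 := h.pos j hj.1 (by omega)
          have h2 := h.pos j' hj'.1 (by omega)
          have h3 := owner_le n S j
          have h4 := owner_le n S j'
          have h5 : owner n S j - 1 = owner n S j' - 1 :=
            hinj (show _ < n by omega) (show _ < n by omega) e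
          exact h.inj j hj.1 j' hj'.1 (by omega) h1
      have hmem : τ i ∈ ({j ∈ range n | t ≤ price n S j}) := by
        have := hp _ (hτ i hi).1 (hτ i hi).2
        simp only [mem_filter, mem_range]
        exact ⟨(hτ i hi).1, by omega⟩
      have := card_erase_lt_of_mem hmem
      omega
  have h1 := key p le_rfl
  have h2 : 0 < #{j ∈ range n | p ≤ price n S j} :=
    card_pos.2 ⟨τ i, mem_filter.2 ⟨mem_range.2 (hτ i hi).1, hp _ (hτ i hi).1 (hτ i hi).2⟩⟩
  omega

theorem bid_of_free_eq (h : freeRow n S = n) {j : ℕ} (hj : j < n) :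
    get (2 * n + 4) (bid n A S) j = get (2 * n + 4) S j := by
  rw [bid, get_arr hj, if_neg (by omega), Nat.mod_eq_of_lt (get_lt _ _ _)]

/-- A bid of a free row keeps the invariant and raises the sum of the prices by one. -/
theorem IsAuction.bid (h : IsAuction n A S) (hτ : ∀ u < n, τ u < n ∧ Alg.adj n A u (τ u))
    (hinj : Set.InjOn τ (Set.Iio n)) (hfree : freeRow n S < n) :
    IsAuction n A (bid n A S) ∧
      ∑ j ∈ range n, price n (Alg.bid n A S) j = ∑ j ∈ range n, price n S j + 1 := by
  obtain ⟨i, hi⟩ : ∃ i, i = freeRow n S := ⟨_, rfl⟩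
  have hfr : ∀ j < n, owner n S j ≠ freeRow n S + 1 := of_search_lt hfree
  have hch : cheapest n A S i < n ∧ Alg.adj n A i (cheapest n A S i) ∧
      ∀ k < n, ¬ Alg.adj n A i k ∨ price n S (cheapest n A S i) ≤ price n S k := by
    classical
    refine search_spec ?_
    obtain ⟨j, hj, hmin⟩ := exists_min_image ({j ∈ range n | Alg.adj n A i j}) (price n S)
      ⟨τ i, mem_filter.2 ⟨mem_range.2 (hτ i (hi ▸ hfree)).1, (hτ i (hi ▸ hfree)).2⟩⟩
    rw [mem_filter, mem_range] at hj
    refine ⟨j, hj.1, hj.2, fun k hk => ?_⟩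
    by_cases hik : Alg.adj n A i k
    · exact Or.inr (hmin k (mem_filter.2 ⟨mem_range.2 hk, hik⟩))
    · exact Or.inl hik
  obtain ⟨j₀, hj₀⟩ : ∃ j₀, j₀ = cheapest n A S i := ⟨_, rfl⟩
  rw [← hj₀] at hch
  rw [← hi] at hfree hfr
  obtain ⟨hjn, hadj, hmin⟩ := hch
  have hmin' : ∀ k < n, Alg.adj n A i k → price n S j₀ ≤ price n S k :=
    fun k hk hik => (hmin k hk).resolve_left (not_not.2 hik)
  have hpn : price n S j₀ < n := h.lt_of_free hτ hinj hfree hfr hmin'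
  have hget : ∀ j < n, get (2 * n + 4) (Alg.bid n A S) j =
      if j = j₀ then (price n S j₀ + 1) * (n + 1) + (i + 1) else get (2 * n + 4) S j := by
    intro j hj
    rw [Alg.bid, get_arr hj, ← hi, ← hj₀]
    by_cases hjj : j = j₀
    · rw [if_pos ⟨hfree, hjj⟩, if_pos hjj, hjj, Nat.mod_eq_of_lt]
      have h1 : n + 2 < 2 ^ (n + 2) := Nat.lt_two_pow_self
      have h2 : 2 ^ (2 * n + 4) = 2 ^ (n + 2) * 2 ^ (n + 2) := by rw [← pow_add]; congr 1; omega
      have h3 : (price n S j₀ + 1) * (n + 1) ≤ n * (n + 1) := Nat.mul_le_mul_right _ hpn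
      rw [h2]
      nlinarith
    · rw [if_neg (fun h => hjj h.2), if_neg hjj, Nat.mod_eq_of_lt (get_lt _ _ _)]
  have hprice : ∀ j < n, price n (Alg.bid n A S) j =
      if j = j₀ then price n S j₀ + 1 else price n S j := by
    intro j hj
    rw [price, hget j hj]
    split_ifs with e
    · rw [add_comm, Nat.add_mul_div_right _ _ (by omega), Nat.div_eq_of_lt (by omega), zero_add]
    · rfl
  have howner : ∀ j < n, owner n (Alg.bid n A S) j = if j = j₀ then i + 1 else owner n S j := by
    intro j hj
    rw [owner, hget j hj]
    split_ifs with e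
    · rw [add_comm, Nat.add_mul_mod_self_right, Nat.mod_eq_of_lt (by omega)]
    · rfl
  refine ⟨⟨?_, ?_, ?_, ?_, ?_⟩, ?_⟩
  · intro j hj
    rw [hprice j hj]
    split_ifs
    · exact hpn
    · exact h.price_le j hj
  · intro j hj j' hj'
    rw [howner j hj, howner j' hj']
    split_ifs with e e' e'
    · exact fun _ _ => e.trans e'.symm
    · exact fun h' _ => absurd h'.symm (hfr j' hj')
    · exact fun h' _ => absurd h' (hfr j hj)
    · exact h.inj j hj j' hj'
  · intro j hj k
    rw [howner j hj]
    split_ifs with e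
    · intro hk
      obtain rfl : i = k := by omega
      rw [e]; exact hadj
    · exact h.adj j hj k
  · intro j hj k
    rw [howner j hj]
    split_ifs with e
    · intro hk l hl hkl
      obtain rfl : i = k := by omega
      have := hmin' l hl hkl
      rw [hprice j hj, hprice l hl, if_pos e]
      split_ifs <;> omega
    · intro hk l hl hkl
      have := h.slack j hj k hk l hl hkl
      rw [hprice j hj, hprice l hl, if_neg e]
      split_ifs with e'
      · rw [e'] at this; omega
      · exact this
  · intro j hj
    rw [howner j hj, hprice j hj]
    split_ifs
    · omega
    · exact h.pos j hj
  · have h1 : ∀ j ∈ range n, price n (Alg.bid n A S) j = price n S j + if j = j₀ then 1 else 0 := by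
      intro j hj
      rw [hprice j (mem_range.1 hj)]
      split_ifs with e
      · rw [e]
      · rfl
    rw [sum_congr rfl h1, sum_add_distrib, sum_ite_eq', if_pos (mem_range.2 hjn)]

/-- The prices are bounded, and thus every row owns a column in the end. -/
theorem auction_spec (hτ : ∀ u < n, τ u < n ∧ Alg.adj n A u (τ u)) (hinj : Set.InjOn τ (Set.Iio n)) :
    IsAuction n A (auction n A) ∧ ∀ i < n, ∃ j < n, owner n (auction n A) j = i + 1 := by
  have key : ∀ t, IsAuction n A (RAM.loop (fun _ S => bid n A S) 0 t) ∧
      (freeRow n (RAM.loop (fun _ S => bid n A S) 0 t) = n ∨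
        t ≤ ∑ j ∈ range n, price n (RAM.loop (fun _ S => bid n A S) 0 t) j) := by
    intro t
    induction t with
    | zero =>
      have h0 : ∀ j, get (2 * n + 4) 0 j = 0 := fun j => by simp [Arith.get]
      have h1 : ∀ j, owner n 0 j = 0 := fun j => by rw [owner, h0, Nat.zero_mod]
      have h2 : ∀ j, price n 0 j = 0 := fun j => by rw [price, h0, Nat.zero_div]
      refine ⟨⟨?_, ?_, ?_, ?_, ?_⟩, Or.inr (Nat.zero_le _)⟩ <;> simp [RAM.loop, h1, h2]
    | succ t ih =>
      rw [RAM.loop]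
      obtain ⟨ih, ih'⟩ := ih
      rcases (show freeRow n _ ≤ n from search_le _ _).lt_or_eq with hlt | heq
      · obtain ⟨h1, h2⟩ := ih.bid hτ hinj hlt
        exact ⟨h1, Or.inr (by omega)⟩
      · have hget := fun j (hj : j < n) => bid_of_free_eq (A := A) heq hj
        have ho : ∀ j < n, owner n (bid n A _) j = owner n _ j :=
          fun j hj => congrArg (· % (n + 1)) (hget j hj)
        have hp : ∀ j < n, price n (bid n A _) j = price n _ j :=
          fun j hj => congrArg (· / (n + 1)) (hget j hj)
        refine ⟨⟨fun j hj => ?_, fun j hj j' hj' => ?_, fun j hj i => ?_, fun j hj i h k hk => ?_,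
          fun j hj => ?_⟩, Or.inl ?_⟩
        · rw [hp j hj]; exact ih.price_le j hj
        · rw [ho j hj, ho j' hj']; exact ih.inj j hj j' hj'
        · rw [ho j hj]; exact ih.adj j hj i
        · rw [ho j hj] at h
          rw [hp j hj, hp k hk]; exact ih.slack j hj i h k hk
        · rw [ho j hj, hp j hj]; exact ih.pos j hj
        · refine (search_le _ _).antisymm (not_lt.1 fun hlt => ?_)
          have h1 := of_search_lt hlt
          have h2 : freeRow n (RAM.loop (fun _ S => bid n A S) 0 t) < n :=
            search_lt_iff.2 ⟨_, hlt, fun j hj => by rw [← ho j hj]; exact h1 j hj⟩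
          omega
  obtain ⟨h1, h2⟩ := key (n * (n + 1) + 1)
  refine ⟨h1, fun i hi => ?_⟩
  have hsum : ∑ j ∈ range n, price n (auction n A) j ≤ n * n := by
    calc _ ≤ ∑ j ∈ range n, n := sum_le_sum fun j hj => h1.price_le j (mem_range.1 hj)
      _ = n * n := by simp
  rw [← auction] at h2
  have h3 : freeRow n (auction n A) = n := h2.resolve_right (by nlinarith)
  by_contra hne
  push Not at hne
  have h4 : freeRow n (auction n A) < n := search_lt_iff.2 ⟨i, hi, hne⟩
  omega

theorem mate_spec (hτ : ∀ u < n, τ u < n ∧ Alg.adj n A u (τ u)) (hinj : Set.InjOn τ (Set.Iio n)) :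
    (∀ v < n, mate n A v < n ∧ Alg.adj n A v (mate n A v)) ∧
      Set.InjOn (mate n A) (Set.Iio n) := by
  obtain ⟨h1, h2⟩ := auction_spec hτ hinj
  have h3 : ∀ v < n, mate n A v < n ∧ owner n (auction n A) (mate n A v) = v + 1 :=
    fun v hv => search_spec (h2 v hv)
  refine ⟨fun v hv => ⟨(h3 v hv).1, h1.adj _ (h3 v hv).1 _ (h3 v hv).2⟩, fun u hu v hv e => ?_⟩
  have hu' := (h3 u hu).2
  have hv' := (h3 v hv).2
  rw [e] at hu'
  omega

/-! ### Reachability and codes of sets -/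

theorem testBit_reach_lt {W u x : ℕ} (hu : u < n) (h : (reach n A W u).testBit x) : x < n := by
  rw [reach] at h
  cases n with
  | zero => omega
  | succ m =>
    rw [RAM.loop, testBit_mask] at h
    exact h.1

/-- The loop in `reach` stops to grow after at most `n` rounds. -/
theorem testBit_reach {W : ℕ} {W' : Finset (Fin n)} (hW : ∀ x : Fin n, W.testBit x ↔ x ∈ W')
    (u x : Fin n) : (reach n A W u).testBit x ↔
      Dig.Reaches (fun u v : Fin n => arc n A u v) W' u x := by
  obtain ⟨F, hF⟩ : ∃ F : ℕ → ℕ, F = fun m => mask n fun x => m.testBit x ∨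
    (¬ W.testBit x ∧ ∃ y < n, m.testBit y ∧ arc n A y x) := ⟨_, rfl⟩
  have hr : ∀ t, RAM.loop (fun _ m => F m) (2 ^ u.1) (t + 1) =
    F (RAM.loop (fun _ m => F m) (2 ^ u.1) t) := fun t => rfl
  have hreach : reach n A W u = RAM.loop (fun _ m => F m) (2 ^ u.1) n := by rw [hF]; rfl
  have hFt : ∀ m x, (F m).testBit x ↔ x < n ∧ (m.testBit x ∨
    (¬ W.testBit x ∧ ∃ y < n, m.testBit y ∧ arc n A y x)) := fun m x => by rw [hF]; exact testBit_mask
  have hlt : ∀ t x, (RAM.loop (fun _ m => F m) (2 ^ u.1) t).testBit x → x < n := by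
    intro t x h
    cases t with
    | zero =>
      rw [RAM.loop, Nat.testBit_two_pow] at h
      have := of_decide_eq_true h
      omega
    | succ t => exact ((hFt _ _).1 h).1
  have hstep : ∀ t x, (RAM.loop (fun _ m => F m) (2 ^ u.1) t).testBit x →
      (RAM.loop (fun _ m => F m) (2 ^ u.1) (t + 1)).testBit x := fun t x h =>
    (hFt _ _).2 ⟨hlt t x h, Or.inl h⟩
  have hgrow : ∀ t, RAM.loop (fun _ m => F m) (2 ^ u.1) (t + 1) = RAM.loop (fun _ m => F m) (2 ^ u.1) t ∨
      t + 1 ≤ #{x ∈ range n | (RAM.loop (fun _ m => F m) (2 ^ u.1) t).testBit x} := by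
    intro t
    induction t with
    | zero =>
      refine Or.inr (card_pos.2 ⟨u.1, mem_filter.2 ⟨mem_range.2 u.2, ?_⟩⟩)
      simp [RAM.loop]
    | succ t ih =>
      by_cases he : RAM.loop (fun _ m => F m) (2 ^ u.1) (t + 1) = RAM.loop (fun _ m => F m) (2 ^ u.1) t
      · left; rw [hr, he]; exact (hr t).symm.trans he
      · right
        refine (Nat.succ_le_succ (ih.resolve_left he)).trans (Nat.succ_le_of_lt (card_lt_card ?_))
        rw [Finset.ssubset_iff_of_subset fun x hx => by
          rw [mem_filter] at hx ⊢; exact ⟨hx.1, hstep t x hx.2⟩]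
        by_contra hno
        push Not at hno
        refine he (Nat.eq_of_testBit_eq fun x => Bool.eq_iff_iff.2 ⟨fun h => ?_, hstep t x⟩)
        exact (mem_filter.1 (hno x (mem_filter.2 ⟨mem_range.2 (hlt _ x h), h⟩))).2
  have hfix : F (reach n A W u) = reach n A W u := by
    rw [hreach]
    refine (hgrow n).resolve_right fun h => ?_
    have := card_filter_le (range n)
      fun x => (RAM.loop (fun _ m => F m) (2 ^ u.1) n).testBit x = true
    rw [card_range] at this
    omega
  constructor
  · have : ∀ t, ∀ x : Fin n, (RAM.loop (fun _ m => F m) (2 ^ u.1) t).testBit x →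
        Dig.Reaches (fun u v : Fin n => arc n A u v) W' u x := by
      intro t
      induction t with
      | zero =>
        intro x h
        rw [RAM.loop, Nat.testBit_two_pow] at h
        rw [Fin.ext (of_decide_eq_true h)]
        exact .refl
      | succ t ih =>
        intro x h
        obtain ⟨_, h | ⟨hx, y, hy, hty, hyx⟩⟩ := (hFt _ _).1 h
        · exact ih x h
        · exact (ih ⟨y, hy⟩ hty).tail ⟨hyx, fun h => hx ((hW x).2 h)⟩
    rw [hreach]
    exact this n x
  · intro h
    induction h with
    | refl =>
      have : ∀ t, (RAM.loop (fun _ m => F m) (2 ^ u.1) t).testBit u := by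
        intro t
        induction t with
        | zero => simp [RAM.loop]
        | succ t ih => exact hstep t _ ih
      rw [hreach]; exact this n
    | @tail y z _ hyz ih =>
      rw [← hfix, hFt]
      exact ⟨z.2, Or.inr ⟨fun h => hyz.2 ((hW z).1 h), y, y.2, ih, hyz.1⟩⟩

/-- The number whose binary digits describe a set. -/
noncomputable def code (W : Finset (Fin n)) : ℕ := mask n fun i => ∃ h : i < n, ⟨i, h⟩ ∈ W

theorem testBit_code {W : Finset (Fin n)} (x : Fin n) : (code W).testBit x ↔ x ∈ W := by
  rw [code, testBit_mask]
  exact ⟨fun ⟨_, _, h⟩ => h, fun h => ⟨x.2, x.2, h⟩⟩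

theorem reach_eq_reach_code {W : ℕ} {W' : Finset (Fin n)} (hW : ∀ x : Fin n, W.testBit x ↔ x ∈ W')
    (u : Fin n) : reach n A W u = reach n A (code W') u := by
  refine Nat.eq_of_testBit_eq fun x => Bool.eq_iff_iff.2 ?_
  by_cases hx : x < n
  · exact (testBit_reach hW u ⟨x, hx⟩).trans (testBit_reach testBit_code u ⟨x, hx⟩).symm
  · exact ⟨fun h => absurd (testBit_reach_lt u.2 h) hx, fun h => absurd (testBit_reach_lt u.2 h) hx⟩

variable (n A) in
/-- The number of the set of all vertices that can be reached from `u` outside `W`. -/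
noncomputable def key (W : Finset (Fin n)) (u : Fin n) : ℕ := reach n A (code W) u

theorem isKey : Dig.IsKey (fun u v : Fin n => arc n A u v) (key n A) where
  le W u x h := by
    have : key n A W x = key n A W x &&& key n A W u := by
      refine Nat.eq_of_testBit_eq fun y => Bool.eq_iff_iff.2 ?_
      rw [Nat.testBit_and, Bool.and_eq_true]
      refine ⟨fun hy => ⟨hy, ?_⟩, And.left⟩
      have hyn := testBit_reach_lt x.2 hy
      exact (testBit_reach testBit_code u ⟨y, hyn⟩).2
        (h.trans ((testBit_reach testBit_code x ⟨y, hyn⟩).1 hy))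
    rw [this]
    exact Nat.and_le_right
  reaches W u x h := by
    refine (testBit_reach testBit_code u x).1 ?_
    change (key n A W u).testBit x
    rw [← h]
    exact (testBit_reach testBit_code x x).2 .refl

theorem digit_zero (B c : ℕ) : digit B c 0 = c % B := rfl

theorem digit_succ (B c j : ℕ) : digit B c (j + 1) = digit B (c / B) j := by
  have : RAM.loop (fun _ a => a / B) c (j + 1) = RAM.loop (fun _ a => a / B) (c / B) j := by
    induction j with
    | zero => rfl
    | succ j ih => rw [RAM.loop, ih]; rfl
  rw [digit, this, digit]

theorem testBit_coded {q c x : ℕ} : (coded n q c).testBit x ↔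
    x < 2 * n ∧ ∃ j < q, digit (2 * n + 1) c j = x + 1 := testBit_mask

theorem card_coded_le (n q c : ℕ) : #{x ∈ range (2 * n) | (coded n q c).testBit x} ≤ q := by
  calc _ ≤ #((range q).image fun j => digit (2 * n + 1) c j - 1) := by
        refine card_le_card fun x hx => ?_
        obtain ⟨_, j, hj, h⟩ := testBit_coded.1 (mem_filter.1 hx).2
        exact mem_image.2 ⟨j, mem_range.2 hj, by omega⟩
    _ ≤ q := card_image_le.trans (card_range q).le

theorem exists_coded_eq {q U : ℕ} (hU : U < 2 ^ (2 * n))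
    (h : #{x ∈ range (2 * n) | U.testBit x} ≤ q) : ∃ c < (2 * n + 1) ^ q, coded n q c = U := by
  have key : ∀ q, ∀ s : Finset ℕ, s ⊆ range (2 * n) → #s ≤ q → ∃ c < (2 * n + 1) ^ q,
      ∀ x, x ∈ s ↔ ∃ j < q, digit (2 * n + 1) c j = x + 1 := by
    intro q
    induction q with
    | zero =>
      intro s _ hs
      rw [card_eq_zero.1 (Nat.le_zero.1 hs)]
      exact ⟨0, by simp, by simp⟩
    | succ q ih =>
      intro s hs hsq
      rcases s.eq_empty_or_nonempty with rfl | ⟨y, hy⟩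
      · refine ⟨0, by positivity, fun x => ?_⟩
        have : ∀ j, digit (2 * n + 1) 0 j = 0 := fun j => by
          induction j with
          | zero => simp [digit_zero]
          | succ j ih => rw [digit_succ, Nat.zero_div, ih]
        simp [this]
      · obtain ⟨c, hc, hcs⟩ := ih (s.erase y) ((erase_subset _ _).trans hs)
          (by rw [card_erase_of_mem hy]; omega)
        have hyn := mem_range.1 (hs hy)
        have h1 : ((y + 1) + c * (2 * n + 1)) / (2 * n + 1) = c := by
          rw [Nat.add_mul_div_right _ _ (by omega), Nat.div_eq_of_lt (by omega), zero_add]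
        have h2 : ((y + 1) + c * (2 * n + 1)) % (2 * n + 1) = y + 1 := by
          rw [Nat.add_mul_mod_self_right, Nat.mod_eq_of_lt (by omega)]
        refine ⟨(y + 1) + c * (2 * n + 1), ?_, fun x => ?_⟩
        · rw [pow_succ]
          have := Nat.mul_le_mul_right (2 * n + 1) (Nat.succ_le_of_lt hc)
          rw [Nat.succ_mul] at this
          omega
        · constructor
          · intro hx
            by_cases hxy : x = y
            · exact ⟨0, by omega, by rw [digit_zero, h2, hxy]⟩
            · obtain ⟨j, hj, hd⟩ := (hcs x).1 (mem_erase.2 ⟨hxy, hx⟩)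
              exact ⟨j + 1, by omega, by rw [digit_succ, h1, hd]⟩
          · rintro ⟨j, hj, hd⟩
            cases j with
            | zero =>
              rw [digit_zero, h2] at hd
              obtain rfl : y = x := by omega
              exact hy
            | succ j =>
              rw [digit_succ, h1] at hd
              exact (mem_erase.1 ((hcs x).2 ⟨j, by omega, hd⟩)).2
  obtain ⟨c, hc, hcs⟩ := key q _ (filter_subset _ _) h
  refine ⟨c, hc, Nat.eq_of_testBit_eq fun x => Bool.eq_iff_iff.2 ?_⟩
  rw [testBit_coded, ← hcs, mem_filter, mem_range]
  refine ⟨fun h => h.2.2, fun h => ?_⟩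
  have : x < 2 * n := by
    by_contra hx
    rw [Nat.testBit_lt_two_pow (hU.trans_le (Nat.pow_le_pow_right (by omega) (not_lt.1 hx)))] at h
    exact absurd h (by simp)
  exact ⟨this, this, h⟩

end Alg

/-! ### Tables of partial matchings -/

namespace Alg

open Arith Finset

variable {n A w N X Y Z U u v x : ℕ} {E F M : Finset (ℕ × ℕ)}

/-- The number of arcs in `M` that use the row `x` (for `x < n`) or the column `x - n`. -/
def deg (n : ℕ) (M : Finset (ℕ × ℕ)) (x : ℕ) : ℕ := #{e ∈ M | x = e.1 ∨ x = n + e.2}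

open scoped Classical in
/-- The arcs inside `Z`. -/
noncomputable def arcs (n A Z : ℕ) : Finset (ℕ × ℕ) :=
  {e ∈ range n ×ˢ range n | arc n A e.1 e.2 ∧ Z.testBit e.1 ∧ Z.testBit e.2}

/-- The number of the matchings in `E` that cover the rows and columns of `Z` except for those
in `U`, and no others. -/
def cnt (n Z : ℕ) (E : Finset (ℕ × ℕ)) (U : ℕ) : ℕ :=
  #{M ∈ E.powerset | ∀ x < 2 * n, deg n M x = if Z.testBit (x % n) ∧ ¬ U.testBit x then 1 else 0}

/-- `M` is a set of arcs that covers every row and every column exactly once. -/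
def IsPerfect (n A : ℕ) (M : Finset (ℕ × ℕ)) : Prop :=
  (∀ e ∈ M, e.1 < n ∧ e.2 < n ∧ arc n A e.1 e.2) ∧ ∀ x < 2 * n, deg n M x = 1

/-- The rows and columns of `Z` that are not covered by the arcs of `M` in `E`. -/
noncomputable def miss (n Z : ℕ) (E M : Finset (ℕ × ℕ)) : ℕ :=
  mask (2 * n) fun x => Z.testBit (x % n) ∧ deg n (M ∩ E) x = 0

theorem mem_arcs {e : ℕ × ℕ} : e ∈ arcs n A Z ↔
    e.1 < n ∧ e.2 < n ∧ arc n A e.1 e.2 ∧ Z.testBit e.1 ∧ Z.testBit e.2 := by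
  simp [arcs, and_assoc]

theorem deg_mono (h : M ⊆ F) (x : ℕ) : deg n M x ≤ deg n F x := card_le_card (filter_subset_filter _ h)

theorem deg_union (h : Disjoint M F) (x : ℕ) : deg n (M ∪ F) x = deg n M x + deg n F x := by
  rw [deg, filter_union, card_union_of_disjoint (disjoint_filter_filter h)]
  rfl

theorem deg_insert {e : ℕ × ℕ} (h : e ∉ M) (x : ℕ) :
    deg n (insert e M) x = deg n M x + if x = e.1 ∨ x = n + e.2 then 1 else 0 := by
  rw [insert_eq, union_comm, deg_union (by simpa using h)]
  congr 1
  rw [deg, filter_singleton]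
  split_ifs <;> rfl

theorem mod_of_incident {e : ℕ × ℕ} (h1 : e.1 < n) (h2 : e.2 < n) (h : x = e.1 ∨ x = n + e.2) :
    x % n = e.1 ∨ x % n = e.2 := by
  rcases h with rfl | rfl
  · exact Or.inl (Nat.mod_eq_of_lt h1)
  · exact Or.inr (by rw [Nat.add_mod_left, Nat.mod_eq_of_lt h2])

theorem deg_eq_zero (hM : M ⊆ arcs n A Z) (hx : ¬ Z.testBit (x % n)) : deg n M x = 0 := by
  rw [deg, card_eq_zero, filter_eq_empty_iff]
  intro e he h
  obtain ⟨h1, h2, _, h3, h4⟩ := mem_arcs.1 (hM he)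
  rcases mod_of_incident h1 h2 h with h | h <;> rw [h] at hx <;> tauto

theorem testBit_miss : (miss n Z E M).testBit x ↔
    x < 2 * n ∧ Z.testBit (x % n) ∧ deg n (M ∩ E) x = 0 := testBit_mask

theorem cnt_le (n Z : ℕ) (E : Finset (ℕ × ℕ)) (U : ℕ) : cnt n Z E U ≤ 2 ^ #E :=
  (card_filter_le _ _).trans (card_powerset E).le

theorem cnt_lt (hE : E ⊆ arcs n A Z) (U : ℕ) : cnt n Z E U < 2 ^ (n * n + 1) := by
  refine (cnt_le _ _ _ _).trans_lt (Nat.pow_lt_pow_right (by omega) ?_)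
  have : #E ≤ #(range n ×ˢ range n) := card_le_card fun e he => by
    obtain ⟨h1, h2, _⟩ := mem_arcs.1 (hE he)
    exact mem_product.2 ⟨mem_range.2 h1, mem_range.2 h2⟩
  rw [card_product, card_range] at this
  omega

/-- The part of a perfect set of arcs in `E` is counted by `cnt`. -/
theorem IsPerfect.deg_inter (hM : IsPerfect n A M) (hE : E ⊆ arcs n A Z) (hx : x < 2 * n) :
    deg n (M ∩ E) x = if Z.testBit (x % n) ∧ ¬ (miss n Z E M).testBit x then 1 else 0 := by
  have h1 := deg_mono (n := n) (inter_subset_left (s₁ := M) (s₂ := E)) x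
  rw [hM.2 x hx] at h1
  simp only [testBit_miss]
  by_cases hZ : Z.testBit (x % n) = true
  · split_ifs with h <;> simp only [hZ, hx, true_and] at h <;> omega
  · rw [if_neg (fun h => hZ h.1)]
    exact deg_eq_zero (inter_subset_right.trans hE) hZ

/-- The part of a perfect set of arcs in `F` can be replaced by another set that covers the same rows
and columns. -/
theorem IsPerfect.exchange (hM : IsPerfect n A M) (hF : F ⊆ arcs n A Z) {M₁ : Finset (ℕ × ℕ)}
    (hM₁ : M₁ ⊆ F) (h : ∀ x < 2 * n, deg n M₁ x = deg n (M ∩ F) x) :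
    IsPerfect n A (M \ F ∪ M₁) := by
  constructor
  · intro e he
    rcases mem_union.1 he with he | he
    · exact hM.1 e (mem_sdiff.1 he).1
    · obtain ⟨h1, h2, h3, _⟩ := mem_arcs.1 (hF (hM₁ he))
      exact ⟨h1, h2, h3⟩
  · intro x hx
    rw [deg_union (disjoint_of_subset_right hM₁ sdiff_disjoint), h x hx,
      ← deg_union (disjoint_of_subset_right inter_subset_right sdiff_disjoint),
      sdiff_union_inter, hM.2 x hx]

theorem miss_eq_of_deg (hU : U < 2 ^ (2 * n)) (hUZ : ∀ x, U.testBit x → Z.testBit (x % n))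
    (h : ∀ x < 2 * n, deg n (M ∩ E) x = if Z.testBit (x % n) ∧ ¬ U.testBit x then 1 else 0) :
    miss n Z E M = U := by
  refine Nat.eq_of_testBit_eq fun x => Bool.eq_iff_iff.2 ?_
  rw [testBit_miss]
  constructor
  · rintro ⟨h1, h2, h3⟩
    rw [h x h1] at h3
    by_contra hx
    rw [if_pos ⟨h2, hx⟩] at h3
    omega
  · intro hx
    have hlt : x < 2 * n := by
      by_contra hlt
      rw [Nat.testBit_lt_two_pow (hU.trans_le (Nat.pow_le_pow_right (by omega) (not_lt.1 hlt)))] at hx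
      exact absurd hx (by simp)
    exact ⟨hlt, hUZ x hx, by rw [h x hlt, if_neg (fun h => h.2 hx)]⟩

theorem testBit_add_two_pow {y : ℕ} (h : ¬ U.testBit y) :
    (U + 2 ^ y).testBit x ↔ U.testBit x ∨ x = y := by
  induction y generalizing U x with
  | zero =>
    rw [Nat.testBit_zero, decide_eq_true_eq] at h
    cases x with
    | zero =>
      rw [Nat.testBit_zero, decide_eq_true_eq, pow_zero]
      exact iff_of_true (by omega) (Or.inr rfl)
    | succ x =>
      have e : (U + 1) / 2 = U / 2 := by omega
      rw [Nat.testBit_add_one, Nat.testBit_add_one, pow_zero, e]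
      simp
  | succ y ih =>
    cases x with
    | zero => simp only [Nat.testBit_zero, decide_eq_true_eq]; omega
    | succ x =>
      rw [Nat.testBit_add_one] at h
      rw [Nat.testBit_add_one, Nat.testBit_add_one, show (U + 2 ^ (y + 1)) / 2 = U / 2 + 2 ^ y by omega,
        ih h, Nat.succ_inj]

/-- The bits of `U` together with a row and a column. -/
theorem testBit_add_two_pows (hu : u < n) (h1 : ¬ U.testBit u) (h2 : ¬ U.testBit (n + v)) :
    (U + 2 ^ u + 2 ^ (n + v)).testBit x ↔ U.testBit x ∨ x = u ∨ x = n + v := by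
  rw [testBit_add_two_pow, testBit_add_two_pow h1, or_assoc]
  rw [testBit_add_two_pow h1]
  rintro (h | h)
  · exact h2 h
  · omega

theorem lt_two_pow_of_testBit {m : ℕ} (h : ∀ x, U.testBit x → x < m) : U < 2 ^ m := by
  refine Nat.lt_pow_two_of_testBit U fun x hx => ?_
  by_contra hU
  have := h x (by simpa using hU)
  omega

theorem cnt_insert (hu : u < n) (hv : v < n) (hZu : Z.testBit u) (hZv : Z.testBit v)
    (hE : (u, v) ∉ E) : cnt n Z (insert (u, v) E) U = cnt n Z E U +
      if ¬ U.testBit u ∧ ¬ U.testBit (n + v) then cnt n Z E (U + 2 ^ u + 2 ^ (n + v)) else 0 := by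
  have key : ∀ M ∈ E.powerset, (∀ x < 2 * n, deg n (insert (u, v) M) x =
      if Z.testBit (x % n) ∧ ¬ U.testBit x then 1 else 0) ↔
      ((¬ U.testBit u ∧ ¬ U.testBit (n + v)) ∧ ∀ x < 2 * n, deg n M x =
      if Z.testBit (x % n) ∧ ¬ (U + 2 ^ u + 2 ^ (n + v)).testBit x then 1 else 0) := by
    intro M hM
    have hM' : (u, v) ∉ M := fun h => hE (mem_powerset.1 hM h)
    simp only [deg_insert hM']
    constructor
    · intro h
      have h1 : ¬ U.testBit u := fun hU => by
        have := h u (by omega)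
        rw [if_pos (Or.inl rfl), if_neg (fun h => h.2 hU)] at this
        omega
      have h2 : ¬ U.testBit (n + v) := fun hU => by
        have := h (n + v) (by omega)
        rw [if_pos (Or.inr rfl), if_neg (fun h => h.2 hU)] at this
        omega
      refine ⟨⟨h1, h2⟩, fun x hx => ?_⟩
      have := h x hx
      simp only [testBit_add_two_pows hu h1 h2]
      by_cases hxe : x = u ∨ x = n + v
      · rw [if_pos hxe] at this
        rw [if_neg (fun h => h.2 (Or.inr hxe))]
        (split_ifs at this; omega)
      · rw [if_neg hxe] at this
        simp only [hxe, or_false]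
        omega
    · rintro ⟨⟨h1, h2⟩, h⟩ x hx
      rw [h x hx]
      simp only [testBit_add_two_pows hu h1 h2]
      by_cases hxe : x = u ∨ x = n + v
      · rw [if_neg (fun h => h.2 (Or.inr hxe)), if_pos hxe, if_pos]
        refine ⟨?_, by rcases hxe with rfl | rfl <;> assumption⟩
        rcases mod_of_incident (e := (u, v)) hu hv hxe with h | h <;> rw [h] <;> assumption
      · simp only [hxe, or_false, if_false, add_zero]
  simp only [cnt, card_filter]
  rw [sum_powerset_insert hE]
  congr 1
  by_cases hU : ¬ U.testBit u ∧ ¬ U.testBit (n + v)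
  · rw [if_pos hU]
    refine sum_congr rfl fun M hM => ?_
    refine if_congr ?_ rfl rfl
    rw [key M hM]
    exact and_iff_right hU
  · rw [if_neg hU]
    refine sum_eq_zero fun M hM => ?_
    rw [if_neg]
    rw [key M hM]
    exact fun h => hU h.1

theorem testBit_inter : (inter n U X).testBit x ↔ x < 2 * n ∧ U.testBit x ∧ X.testBit (x % n) :=
  testBit_mask

/-- `Z` is the disjoint union of `X` and `Y`. -/
structure IsUnion (n X Y Z : ℕ) : Prop where
  iff : ∀ u < n, Z.testBit u ↔ X.testBit u ∨ Y.testBit u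
  disj : ∀ u < n, ¬ (X.testBit u ∧ Y.testBit u)

theorem IsUnion.disjoint_arcs (h : IsUnion n X Y Z) : Disjoint (arcs n A X) (arcs n A Y) :=
  disjoint_left.2 fun e h1 h2 => by
    rw [mem_arcs] at h1 h2
    exact h.disj e.1 h1.1 ⟨h1.2.2.2.1, h2.2.2.2.1⟩

theorem IsUnion.arcs_subset (h : IsUnion n X Y Z) : arcs n A X ∪ arcs n A Y ⊆ arcs n A Z := by
  intro e he
  simp only [mem_union, mem_arcs] at he ⊢
  rcases he with ⟨h1, h2, h3, h4, h5⟩ | ⟨h1, h2, h3, h4, h5⟩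
  · exact ⟨h1, h2, h3, (h.iff _ h1).2 (Or.inl h4), (h.iff _ h2).2 (Or.inl h5)⟩
  · exact ⟨h1, h2, h3, (h.iff _ h1).2 (Or.inr h4), (h.iff _ h2).2 (Or.inr h5)⟩

theorem cnt_union (hn : 0 < n) (h : IsUnion n X Y Z) : cnt n Z (arcs n A X ∪ arcs n A Y) U =
    cnt n X (arcs n A X) (inter n U X) * cnt n Y (arcs n A Y) (inter n U Y) := by
  have key : ∀ M₁ M₂, M₁ ⊆ arcs n A X → M₂ ⊆ arcs n A Y →
      ((∀ x < 2 * n, deg n (M₁ ∪ M₂) x = if Z.testBit (x % n) ∧ ¬ U.testBit x then 1 else 0) ↔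
      (∀ x < 2 * n, deg n M₁ x = if X.testBit (x % n) ∧ ¬ (inter n U X).testBit x then 1 else 0) ∧
      (∀ x < 2 * n, deg n M₂ x =
        if Y.testBit (x % n) ∧ ¬ (inter n U Y).testBit x then 1 else 0)) := by
    intro M₁ M₂ h₁ h₂
    rw [← forall_and]
    refine forall_congr' fun x => ?_
    rw [← forall_and]
    refine forall_congr' fun hx => ?_
    have hxn : x % n < n := Nat.mod_lt _ hn
    rw [deg_union (disjoint_of_subset_left h₁ (disjoint_of_subset_right h₂ h.disjoint_arcs))]
    simp only [h.iff _ hxn, testBit_inter]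
    have hd := h.disj _ hxn
    by_cases hX : X.testBit (x % n) = true
    · have hY : ¬ Y.testBit (x % n) = true := fun hY => hd ⟨hX, hY⟩
      rw [deg_eq_zero h₂ hY]
      simp [hX, hY, hx]
    · rw [deg_eq_zero h₁ hX]
      by_cases hY : Y.testBit (x % n) = true <;> simp [hX, hY, hx]
  rw [cnt, cnt, cnt, ← card_product]
  have hi : ∀ M ⊆ arcs n A X ∪ arcs n A Y, M ∩ arcs n A X ∪ M ∩ arcs n A Y = M := fun M hM => by
    rw [← inter_union_distrib_left, inter_eq_left.2 hM]
  refine card_nbij' (fun M => (M ∩ arcs n A X, M ∩ arcs n A Y)) (fun p => p.1 ∪ p.2) ?_ ?_ ?_ ?_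
  · intro M hM
    simp only [coe_filter, mem_powerset, Set.mem_ofPred_eq] at hM
    simp only [coe_product, coe_filter, mem_powerset, Set.mem_prod, Set.mem_ofPred_eq]
    have := (key (M ∩ arcs n A X) (M ∩ arcs n A Y) inter_subset_right inter_subset_right).1
      (by rw [hi M hM.1]; exact hM.2)
    exact ⟨⟨inter_subset_right, this.1⟩, inter_subset_right, this.2⟩
  · rintro ⟨M₁, M₂⟩ hM
    simp only [coe_product, coe_filter, mem_powerset, Set.mem_prod, Set.mem_ofPred_eq] at hM
    simp only [coe_filter, mem_powerset, Set.mem_ofPred_eq]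
    exact ⟨union_subset_union hM.1.1 hM.2.1, (key _ _ hM.1.1 hM.2.1).2 ⟨hM.1.2, hM.2.2⟩⟩
  · intro M hM
    simp only [coe_filter, mem_powerset, Set.mem_ofPred_eq] at hM
    exact hi M hM.1
  · rintro ⟨M₁, M₂⟩ hM
    simp only [coe_product, coe_filter, mem_powerset, Set.mem_prod, Set.mem_ofPred_eq] at hM
    have hd := h.disjoint_arcs (A := A)
    simp only [Prod.mk.injEq]
    rw [union_inter_distrib_right, union_inter_distrib_right, inter_eq_left.2 hM.1.1,
      inter_eq_left.2 hM.2.1,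
      disjoint_iff_inter_eq_empty.1 (disjoint_of_subset_left hM.2.1 hd.symm),
      disjoint_iff_inter_eq_empty.1 (disjoint_of_subset_left hM.1.1 hd), union_empty, empty_union]
    exact ⟨rfl, rfl⟩

/-! ### Correctness of the tables -/

/-- The table `T` is correct for the arcs in `E`: no entry is too large, and the entries for the sets
that are left uncovered by perfect sets of arcs are right. -/
structure IsTable (n A w N Z : ℕ) (E : Finset (ℕ × ℕ)) (T : ℕ) : Prop where
  le : ∀ U, val n w N T U ≤ cnt n Z E U
  eq : ∀ M, IsPerfect n A M → val n w N T (miss n Z E M) = cnt n Z E (miss n Z E M)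

theorem miss_lt (n Z : ℕ) (E M : Finset (ℕ × ℕ)) : miss n Z E M < 2 ^ (2 * n) := mask_lt _ _

theorem val_eq_get {w : ℕ} (h : ∃ c < N ^ 12, coded n (12 * w) c = U) :
    ∃ c < N ^ 12, coded n (12 * w) c = U ∧ ∀ T, val n w N T U = get (n * n + 1) T c :=
  ⟨_, (search_spec h).1, (search_spec h).2, fun _ => rfl⟩

theorem val_arr_le (f : ℕ → ℕ) {b : ℕ}
    (h : ∀ c < N ^ 12, coded n (12 * w) c = U → (∀ T, val n w N T U = get (n * n + 1) T c) → f c ≤ b) :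
    val n w N (arr (N ^ 12) (n * n + 1) f) U ≤ b := by
  by_cases hc : ∃ c < N ^ 12, coded n (12 * w) c = U
  · obtain ⟨c, hcN, hcU, hval⟩ := val_eq_get hc
    rw [hval, get_arr hcN]
    exact (Nat.mod_le _ _).trans (h c hcN hcU hval)
  · rw [val, get_of_lt (arr_lt _ _ _) (not_lt.1 fun hlt => hc (search_lt_iff.1 hlt))]
    exact Nat.zero_le _

theorem val_arr_eq (hN : N = (2 * n + 1) ^ w) (f : ℕ → ℕ) {b : ℕ} (hU : U < 2 ^ (2 * n))
    (hsmall : #{x ∈ range (2 * n) | U.testBit x} ≤ 12 * w) (hb : b < 2 ^ (n * n + 1))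
    (h : ∀ c < N ^ 12, coded n (12 * w) c = U → (∀ T, val n w N T U = get (n * n + 1) T c) → f c = b) :
    val n w N (arr (N ^ 12) (n * n + 1) f) U = b := by
  obtain ⟨c, hcN, hcU, hval⟩ := val_eq_get (N := N) (by
    obtain ⟨c, hc, hcU⟩ := exists_coded_eq hU hsmall
    exact ⟨c, by rwa [hN, ← pow_mul, mul_comm w], hcU⟩)
  rw [hval, get_arr hcN, h c hcN hcU hval, Nat.mod_eq_of_lt hb]

theorem arcs_singleton (hu : u < n) (hrefl : arc n A u u) : arcs n A (2 ^ u) = {(u, u)} := by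
  ext e
  simp only [mem_arcs, mem_singleton, Nat.testBit_two_pow, decide_eq_true_eq]
  constructor
  · rintro ⟨_, _, _, h1, h2⟩
    exact Prod.ext h1.symm h2.symm
  · rintro rfl
    exact ⟨hu, hu, hrefl, rfl, rfl⟩

theorem isTable_baseTable (hN : N = (2 * n + 1) ^ w) (hw : 0 < w) (hu : u < n) (hrefl : arc n A u u) :
    IsTable n A w N (2 ^ u) (arcs n A (2 ^ u)) (baseTable n w N u) := by
  have hbit : ∀ x, (2 ^ u).testBit x ↔ x = u := fun x => by
    rw [Nat.testBit_two_pow, decide_eq_true_eq, eq_comm]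
  have h2 : ∀ x, (2 ^ u + 2 ^ (n + u)).testBit x ↔ x = u ∨ x = n + u := fun x => by
    rw [testBit_add_two_pow (by rw [hbit]; omega), hbit]
  have hmod : ∀ x < 2 * n, x % n = u ↔ x = u ∨ x = n + u := by
    intro x hx
    constructor
    · intro h
      by_cases hxn : x < n
      · rw [Nat.mod_eq_of_lt hxn] at h; exact Or.inl h
      · rw [Nat.mod_eq_sub_mod (by omega), Nat.mod_eq_of_lt (by omega)] at h; omega
    · rintro (rfl | rfl)
      · exact Nat.mod_eq_of_lt hu
      · rw [Nat.add_mod_left, Nat.mod_eq_of_lt hu]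
  have hdeg0 : ∀ x, deg n ∅ x = 0 := fun x => by simp [deg]
  have hdeg1 : ∀ x, deg n {(u, u)} x = if x = u ∨ x = n + u then 1 else 0 := fun x => by
    rw [← insert_empty_eq, deg_insert (by simp), hdeg0, zero_add]
  have hcnt0 : cnt n (2 ^ u) {(u, u)} 0 = 1 := by
    rw [cnt, card_eq_one]
    refine ⟨{(u, u)}, Finset.ext fun M => ?_⟩
    rw [mem_filter, mem_powerset, mem_singleton]
    constructor
    · rintro ⟨h1, h2⟩
      rcases subset_singleton_iff.1 h1 with rfl | rfl
      · have := h2 u (by omega)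
        rw [hdeg0, if_pos (by simp [Nat.mod_eq_of_lt hu])] at this
        omega
      · rfl
    · rintro rfl
      refine ⟨Subset.rfl, fun x hx => ?_⟩
      simp [hdeg1, hbit, hmod x hx]
  have hcnt2 : cnt n (2 ^ u) {(u, u)} (2 ^ u + 2 ^ (n + u)) = 1 := by
    rw [cnt, card_eq_one]
    refine ⟨∅, Finset.ext fun M => ?_⟩
    rw [mem_filter, mem_powerset, mem_singleton]
    constructor
    · rintro ⟨h1, h3⟩
      rcases subset_singleton_iff.1 h1 with rfl | rfl
      · rfl
      · have := h3 u (by omega)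
        rw [hdeg1, if_pos (Or.inl rfl), if_neg (fun h => h.2 ((h2 u).2 (Or.inl rfl)))] at this
        omega
    · rintro rfl
      refine ⟨empty_subset _, fun x hx => ?_⟩
      rw [hdeg0]
      simp only [hbit, hmod x hx, h2]
      rw [if_neg (fun h => h.2 h.1)]
  rw [arcs_singleton hu hrefl]
  constructor
  · intro U
    refine val_arr_le _ fun c _ hcU _ => ?_
    rw [hcU]
    split_ifs with h
    · rcases h with rfl | rfl
      · exact hcnt0.ge
      · exact hcnt2.ge
    · exact Nat.zero_le _
  · intro M hM
    have hcases : miss n (2 ^ u) {(u, u)} M = 0 ∨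
        miss n (2 ^ u) {(u, u)} M = 2 ^ u + 2 ^ (n + u) := by
      have hlt2 : 2 ^ u + 2 ^ (n + u) < 2 ^ (2 * n) := lt_two_pow_of_testBit fun x hx => by
        rcases (h2 x).1 hx with h | h <;> omega
      rcases subset_singleton_iff.1 (inter_subset_right (s₁ := M) (s₂ := {(u, u)})) with h | h
      · refine Or.inr (miss_eq_of_deg hlt2 (fun x hx => ?_) fun x hx => ?_)
        · rw [hbit]
          rcases (h2 x).1 hx with rfl | rfl
          · exact Nat.mod_eq_of_lt hu
          · rw [Nat.add_mod_left, Nat.mod_eq_of_lt hu]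
        · rw [h, hdeg0]
          simp only [hbit, hmod x hx, h2]
          rw [if_neg (fun h => h.2 h.1)]
      · refine Or.inl (miss_eq_of_deg (by positivity) (fun x hx => ?_) fun x hx => ?_)
        · simp at hx
        · rw [h, hdeg1]
          simp [hbit, hmod x hx]
    have hcnt : cnt n (2 ^ u) {(u, u)} (miss n (2 ^ u) {(u, u)} M) = 1 := by
      rcases hcases with h | h <;> rw [h] <;> assumption
    rw [hcnt]
    refine val_arr_eq hN _ (miss_lt _ _ _ _) ?_ (Nat.one_lt_two_pow (by omega)) fun c _ hcU _ => ?_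
    · calc _ ≤ #({u, n + u} : Finset ℕ) := by
            refine card_le_card fun x hx => ?_
            rw [mem_filter] at hx
            rcases hcases with h | h
            · rw [h] at hx; simp at hx
            · rw [h, h2] at hx; simpa using hx.2
        _ ≤ 12 * w := card_le_two.trans (by omega)
    · rw [hcU, if_pos hcases]

theorem filter_miss_subset (h : E ⊆ F) :
    {x ∈ range (2 * n) | (miss n Z F M).testBit x} ⊆ {x ∈ range (2 * n) | (miss n Z E M).testBit x} := by
  intro x hx
  simp only [mem_filter, testBit_miss] at hx ⊢
  have := deg_mono (n := n) (inter_subset_inter_left (s := M) h) x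
  exact ⟨hx.1, hx.2.1, hx.2.2.1, by omega⟩

theorem IsTable.product (hn : 0 < n) (hN : N = (2 * n + 1) ^ w) (h : IsUnion n X Y Z) {S T : ℕ}
    (hS : IsTable n A w N X (arcs n A X) S) (hT : IsTable n A w N Y (arcs n A Y) T)
    (hsmall : ∀ M, IsPerfect n A M →
      #{x ∈ range (2 * n) | (miss n Z (arcs n A X ∪ arcs n A Y) M).testBit x} ≤ 12 * w) :
    IsTable n A w N Z (arcs n A X ∪ arcs n A Y) (product n w N X Y S T) := by
  constructor
  · intro U
    refine val_arr_le _ fun c _ hcU _ => ?_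
    rw [hcU, cnt_union hn h]
    exact Nat.mul_le_mul (hS.le _) (hT.le _)
  · intro M hM
    refine val_arr_eq hN _ (miss_lt _ _ _ _) (hsmall M hM) (cnt_lt h.arcs_subset _) fun c _ hcU _ => ?_
    have hd := h.disjoint_arcs (A := A)
    have e : ∀ x, deg n (M ∩ (arcs n A X ∪ arcs n A Y)) x =
        deg n (M ∩ arcs n A X) x + deg n (M ∩ arcs n A Y) x := fun x => by
      rw [inter_union_distrib_left, deg_union]
      exact disjoint_of_subset_left inter_subset_right (disjoint_of_subset_right inter_subset_right hd)
    have e1 : inter n (miss n Z (arcs n A X ∪ arcs n A Y) M) X = miss n X (arcs n A X) M := by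
      refine Nat.eq_of_testBit_eq fun x => Bool.eq_iff_iff.2 ?_
      have hxn : x % n < n := Nat.mod_lt _ hn
      rw [testBit_inter, testBit_miss, testBit_miss, e, h.iff _ hxn]
      constructor
      · rintro ⟨h1, h2, h3⟩
        exact ⟨h1, h3, by omega⟩
      · rintro ⟨h1, h2, h3⟩
        refine ⟨h1, ⟨h1, Or.inl h2, ?_⟩, h2⟩
        rw [h3, deg_eq_zero inter_subset_right fun hY => h.disj _ hxn ⟨h2, hY⟩]
    have e2 : inter n (miss n Z (arcs n A X ∪ arcs n A Y) M) Y = miss n Y (arcs n A Y) M := by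
      refine Nat.eq_of_testBit_eq fun x => Bool.eq_iff_iff.2 ?_
      have hxn : x % n < n := Nat.mod_lt _ hn
      rw [testBit_inter, testBit_miss, testBit_miss, e, h.iff _ hxn]
      constructor
      · rintro ⟨h1, h2, h3⟩
        exact ⟨h1, h3, by omega⟩
      · rintro ⟨h1, h2, h3⟩
        refine ⟨h1, ⟨h1, Or.inr h2, ?_⟩, h2⟩
        rw [h3, deg_eq_zero inter_subset_right fun hX => h.disj _ hxn ⟨hX, h2⟩]
    rw [hcU, cnt_union hn h, e1, e2, hS.eq M hM, hT.eq M hM]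

/-- If some set counted by `cnt` in `E` exists, then its union with the arcs of a perfect set of arcs
outside `F` is perfect, and thus the table entry is right. -/
theorem IsTable.eq_of_exchange {G : ℕ} (hG : IsTable n A w N Z E G) (hM : IsPerfect n A M)
    (hEF : E ⊆ F) (hF : F ⊆ arcs n A Z) (hU : U < 2 ^ (2 * n))
    (hUZ : ∀ x, U.testBit x → Z.testBit (x % n)) (I : Finset (ℕ × ℕ)) (hI : I ⊆ F) (hIE : Disjoint I E)
    (h : ∀ M' ⊆ E, (∀ x < 2 * n, deg n M' x = if Z.testBit (x % n) ∧ ¬ U.testBit x then 1 else 0) →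
      ∀ x < 2 * n, deg n (M' ∪ I) x = deg n (M ∩ F) x) :
    val n w N G U = cnt n Z E U := by
  by_cases h0 : cnt n Z E U = 0
  · have := hG.le U
    omega
  · obtain ⟨M', hM'⟩ := card_pos.1 (Nat.pos_of_ne_zero h0)
    rw [mem_filter, mem_powerset] at hM'
    have hp := hM.exchange hF (union_subset (hM'.1.trans hEF) hI) (h M' hM'.1 hM'.2)
    have hE : (M \ F ∪ (M' ∪ I)) ∩ E = M' := by
      rw [union_inter_distrib_right, union_inter_distrib_right, inter_eq_left.2 hM'.1,
        disjoint_iff_inter_eq_empty.1 hIE,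
        disjoint_iff_inter_eq_empty.1 (disjoint_of_subset_right hEF sdiff_disjoint),
        union_empty, empty_union]
    have hmiss : miss n Z E (M \ F ∪ (M' ∪ I)) = U :=
      miss_eq_of_deg hU hUZ (by rw [hE]; exact hM'.2)
    have := hG.eq _ hp
    rwa [hmiss] at this

theorem IsTable.addArc (hN : N = (2 * n + 1) ^ w) {G : ℕ} (hG : IsTable n A w N Z E G) (hu : u < n)
    (hv : v < n) (hF : F ⊆ arcs n A Z)
    (hcross : IsCross n A X Y Z u v → (u, v) ∉ E ∧ F = insert (u, v) E)
    (hncross : ¬ IsCross n A X Y Z u v → F = E)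
    (hsmall : ∀ M, IsPerfect n A M →
      #{x ∈ range (2 * n) | (miss n Z E M).testBit x} ≤ 12 * w) :
    IsTable n A w N Z F (addArc n A w N X Y Z u v G) := by
  classical
  by_cases hc : IsCross n A X Y Z u v
  · obtain ⟨hE, rfl⟩ := hcross hc
    have hZu : Z.testBit u := hc.2.1
    have hZv : Z.testBit v := hc.2.2.1
    constructor
    · intro U
      refine val_arr_le _ fun c _ hcU hval => ?_
      rw [hcU, ← hval, cnt_insert hu hv hZu hZv hE]
      simp only [hc, true_and]
      refine Nat.add_le_add (hG.le _) ?_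
      split_ifs with hU
      · exact hG.le _
      · exact le_rfl
    · intro M hM
      obtain ⟨U, hU⟩ : ∃ U, U = miss n Z (insert (u, v) E) M := ⟨_, rfl⟩
      rw [← hU]
      have hUlt : U < 2 ^ (2 * n) := hU ▸ miss_lt _ _ _ _
      have hbits : ∀ x, U.testBit x → x < 2 * n ∧ Z.testBit (x % n) := fun x hx => by
        rw [hU, testBit_miss] at hx
        exact ⟨hx.1, hx.2.1⟩
      have hdeg : ∀ x < 2 * n, deg n (M ∩ insert (u, v) E) x =
          if Z.testBit (x % n) ∧ ¬ U.testBit x then 1 else 0 := fun x hx => by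
        rw [hU]; exact hM.deg_inter hF hx
      refine val_arr_eq hN _ hUlt ?_ (cnt_lt hF _) fun c _ hcU hval => ?_
      · rw [hU]
        exact (card_le_card (filter_miss_subset (subset_insert _ _))).trans (hsmall M hM)
      rw [hcU, ← hval, cnt_insert hu hv hZu hZv hE]
      simp only [hc, true_and]
      congr 1
      · refine hG.eq_of_exchange hM (subset_insert _ _) hF hUlt (fun x hx => (hbits x hx).2) ∅
          (empty_subset _) (disjoint_empty_left _) fun M' _ h x hx => ?_
        rw [union_empty, h x hx, hdeg x hx]
      · split_ifs with h
        · have hb := fun x => testBit_add_two_pows (x := x) hu h.1 h.2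
          have hmod : ∀ x, x = u ∨ x = n + v → Z.testBit (x % n) := fun x hx => by
            rcases mod_of_incident (e := (u, v)) hu hv hx with h | h <;> rw [h] <;> assumption
          refine hG.eq_of_exchange hM (subset_insert _ _) hF (lt_two_pow_of_testBit fun x hx => ?_)
            (fun x hx => ?_) {(u, v)} (by simp) (by simpa using hE) fun M' hM' h' x hx => ?_
          · rcases (hb x).1 hx with h | h | h
            · exact (hbits x h).1
            · omega
            · omega
          · rcases (hb x).1 hx with h | h
            · exact (hbits x h).2
            · exact hmod x h
          · rw [union_comm, ← insert_eq, deg_insert (fun h => hE (hM' h)), h' x hx, hdeg x hx]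
            simp only [hb]
            by_cases hxe : x = u ∨ x = n + v
            · rw [if_neg (fun h => h.2 (Or.inr hxe)), if_pos hxe, if_pos]
              exact ⟨hmod x hxe, by rcases hxe with rfl | rfl; exacts [h.1, h.2]⟩
            · simp only [hxe, or_false, if_false, add_zero]
        · rfl
  · rw [hncross hc] at hF ⊢
    constructor
    · intro U
      refine val_arr_le _ fun c _ hcU hval => ?_
      rw [← hval, if_neg (fun h => hc h.1), add_zero]
      exact hG.le U
    · intro M hM
      refine val_arr_eq hN _ (miss_lt _ _ _ _) (hsmall M hM) (cnt_lt hF _) fun c _ hcU hval => ?_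
      rw [← hval, if_neg (fun h => hc h.1), add_zero]
      exact hG.eq M hM

theorem IsTable.merge (hn : 0 < n) (hN : N = (2 * n + 1) ^ w) (h : IsUnion n X Y Z) {S T : ℕ}
    (hS : IsTable n A w N X (arcs n A X) S) (hT : IsTable n A w N Y (arcs n A Y) T)
    (hX : ∀ M, IsPerfect n A M →
      #{x ∈ range (2 * n) | (miss n X (arcs n A X) M).testBit x} ≤ 6 * w)
    (hY : ∀ M, IsPerfect n A M →
      #{x ∈ range (2 * n) | (miss n Y (arcs n A Y) M).testBit x} ≤ 6 * w) :
    IsTable n A w N Z (arcs n A Z) (merge n A w N X Y Z S T) := by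
  classical
  have hsmall : ∀ M, IsPerfect n A M →
      #{x ∈ range (2 * n) | (miss n Z (arcs n A X ∪ arcs n A Y) M).testBit x} ≤ 12 * w := by
    intro M hM
    calc _ ≤ #({x ∈ range (2 * n) | (miss n X (arcs n A X) M).testBit x} ∪
          {x ∈ range (2 * n) | (miss n Y (arcs n A Y) M).testBit x}) := by
          refine card_le_card fun x hx => ?_
          simp only [mem_filter, mem_union, testBit_miss] at hx ⊢
          obtain ⟨h1, h2, h3, h4⟩ := hx
          have h5 := deg_mono (n := n)
            (inter_subset_inter_left (s := M) (subset_union_left (s₁ := arcs n A X) (s₂ := arcs n A Y))) x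
          have h6 := deg_mono (n := n)
            (inter_subset_inter_left (s := M) (subset_union_right (s₁ := arcs n A X) (s₂ := arcs n A Y))) x
          rcases (h.iff _ (Nat.mod_lt _ hn)).1 h3 with h7 | h7
          · exact Or.inl ⟨h1, h2, h7, by omega⟩
          · exact Or.inr ⟨h1, h2, h7, by omega⟩
      _ ≤ 6 * w + 6 * w := (card_union_le _ _).trans (Nat.add_le_add (hX M hM) (hY M hM))
      _ = 12 * w := by omega
  let E : ℕ → Finset (ℕ × ℕ) := fun p =>
    (arcs n A X ∪ arcs n A Y) ∪ {e ∈ arcs n A Z | e.1 * n + e.2 < p}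
  have hE : ∀ p, E p ⊆ arcs n A Z := fun p => union_subset h.arcs_subset (filter_subset _ _)
  have key : ∀ p ≤ n * n, IsTable n A w N Z (E p)
      (RAM.loop (fun p G => Alg.addArc n A w N X Y Z (p / n) (p % n) G)
        (Alg.product n w N X Y S T) p) := by
    intro p
    induction p with
    | zero =>
      intro _
      have : E 0 = arcs n A X ∪ arcs n A Y := by simp [E]
      rw [this]
      exact .product hn hN h hS hT hsmall
    | succ p ih =>
      intro hp
      have hpv : p % n < n := Nat.mod_lt _ hn
      have hpu : p / n < n := Nat.div_lt_of_lt_mul (by omega)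
      have hdm : p / n * n + p % n = p := Nat.div_add_mod' p n
      have huniq : ∀ e : ℕ × ℕ, e.2 < n → e.1 * n + e.2 = p → e = (p / n, p % n) := by
        rintro ⟨a, b⟩ hb rfl
        dsimp only at hb ⊢
        rw [add_comm, Nat.add_mul_div_right _ _ hn, Nat.add_mul_mod_self_right, Nat.mod_eq_of_lt hb,
          Nat.div_eq_of_lt hb, zero_add]
      refine (ih (by omega)).addArc hN hpu hpv (hE _) ?_ ?_ fun M hM =>
        (card_le_card (filter_miss_subset subset_union_left)).trans (hsmall M hM)
      · rintro ⟨h1, h2, h3, h4, h5⟩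
        constructor
        · simp only [E, mem_union, mem_filter, mem_arcs, not_or]
          exact ⟨⟨fun h => h4 h.2.2.2, fun h => h5 h.2.2.2⟩, fun h => by omega⟩
        · ext e
          simp only [E, mem_union, mem_filter, mem_insert]
          constructor
          · rintro (he | ⟨he, he'⟩)
            · exact Or.inr (Or.inl he)
            · by_cases hep : e.1 * n + e.2 = p
              · exact Or.inl (huniq e (mem_arcs.1 he).2.1 hep)
              · exact Or.inr (Or.inr ⟨he, by omega⟩)
          · rintro (rfl | he | ⟨he, he'⟩)
            · exact Or.inr ⟨mem_arcs.2 ⟨hpu, hpv, h1, h2, h3⟩, by dsimp only; omega⟩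
            · exact Or.inl he
            · exact Or.inr ⟨he, by omega⟩
      · intro hc
        ext e
        simp only [E, mem_union, mem_filter]
        constructor
        · rintro (he | ⟨he, he'⟩)
          · exact Or.inl he
          · by_cases hep : e.1 * n + e.2 = p
            · left
              obtain rfl := huniq e (mem_arcs.1 he).2.1 hep
              obtain ⟨h1, h2, h3, h4, h5⟩ := mem_arcs.1 he
              by_contra hno
              simp only [mem_arcs, not_or] at hno
              exact hc ⟨h3, h4, h5, fun h => hno.1 ⟨h1, h2, h3, h⟩, fun h => hno.2 ⟨h1, h2, h3, h⟩⟩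
            · exact Or.inr ⟨he, by omega⟩
        · rintro (he | ⟨he, he'⟩)
          · exact Or.inl he
          · exact Or.inr ⟨he, by omega⟩
  have hEn : E (n * n) = arcs n A Z := by
    refine Subset.antisymm (hE _) fun e he => mem_union_right _ (mem_filter.2 ⟨he, ?_⟩)
    obtain ⟨h1, h2, _⟩ := mem_arcs.1 he
    have := Nat.mul_le_mul_right n (Nat.succ_le_of_lt h1)
    rw [Nat.succ_mul] at this
    omega
  have := key (n * n) le_rfl
  rwa [hEn] at this

end Alg

/-! ### Perfect sets of arcs as permutations -/

namespace Alg

open Arith Finset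

variable {n A w N X Y Z U u v x f : ℕ} {E F M : Finset (ℕ × ℕ)}

/-- The arcs of a permutation. -/
def permArcs (τ : Equiv.Perm (Fin n)) : Finset (ℕ × ℕ) := univ.image fun u : Fin n => (u.1, (τ u).1)

theorem mem_permArcs {τ : Equiv.Perm (Fin n)} {e : ℕ × ℕ} :
    e ∈ permArcs τ ↔ ∃ u : Fin n, (u.1, (τ u).1) = e := by
  simp [permArcs]

theorem isPerfect_permArcs {τ : Equiv.Perm (Fin n)} (hτ : ∀ u : Fin n, arc n A u (τ u)) :
    IsPerfect n A (permArcs τ) := by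
  constructor
  · intro e he
    obtain ⟨u, rfl⟩ := mem_permArcs.1 he
    exact ⟨u.2, (τ u).2, hτ u⟩
  · intro x hx
    rw [deg, card_eq_one]
    by_cases hxn : x < n
    · refine ⟨(x, τ ⟨x, hxn⟩), Finset.ext fun e => ?_⟩
      rw [mem_filter, mem_permArcs, mem_singleton]
      constructor
      · rintro ⟨⟨u, rfl⟩, h | h⟩
        · dsimp only at h; subst h; rfl
        · dsimp only at h; omega
      · rintro rfl
        exact ⟨⟨⟨x, hxn⟩, rfl⟩, Or.inl rfl⟩
    · obtain ⟨v, rfl⟩ : ∃ v, x = n + v := ⟨x - n, by omega⟩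
      have hv : v < n := by omega
      refine ⟨(τ.symm ⟨v, hv⟩, v), Finset.ext fun e => ?_⟩
      rw [mem_filter, mem_permArcs, mem_singleton]
      constructor
      · rintro ⟨⟨u, rfl⟩, h | h⟩
        · have := u.2
          dsimp only at h; omega
        · have h' : τ u = ⟨v, hv⟩ := Fin.ext (by dsimp only at h ⊢; omega)
          rw [← h', τ.symm_apply_apply]
          exact Prod.ext rfl (congrArg Fin.val h')
      · rintro rfl
        exact ⟨⟨τ.symm ⟨v, hv⟩, by simp⟩, Or.inr rfl⟩

theorem IsPerfect.exists_perm (hM : IsPerfect n A M) :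
    ∃ τ : Equiv.Perm (Fin n), (∀ u : Fin n, arc n A u (τ u)) ∧ permArcs τ = M := by
  have hrow : ∀ u : Fin n, ∃ v : Fin n, (u.1, v.1) ∈ M ∧ ∀ e ∈ M, e.1 = u.1 → e.2 = v.1 := by
    intro u
    obtain ⟨e, he⟩ := card_eq_one.1 (hM.2 u (by omega))
    have hmem : ∀ e', e' ∈ M ∧ (u.1 = e'.1 ∨ u.1 = n + e'.2) ↔ e' = e := fun e' => by
      have := Finset.ext_iff.1 he e'
      rwa [mem_filter, mem_singleton] at this
    obtain ⟨h1, h2⟩ := (hmem e).2 rfl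
    obtain ⟨h3, h4, _⟩ := hM.1 e h1
    have h5 : u.1 = e.1 := h2.resolve_right (by omega)
    refine ⟨⟨e.2, h4⟩, ?_, fun e' he' h => ?_⟩
    · rw [h5]; exact h1
    · rw [(hmem e').1 ⟨he', Or.inl h.symm⟩]
  choose g hg hg' using hrow
  have hinj : Function.Injective g := by
    intro u u' h
    have := hM.2 (n + (g u).1) (by omega)
    rw [deg, card_eq_one] at this
    obtain ⟨e, he⟩ := this
    have h1 : (u.1, (g u).1) ∈ ({e} : Finset (ℕ × ℕ)) := by
      rw [← he, mem_filter]; exact ⟨hg u, Or.inr rfl⟩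
    have h2 : (u'.1, (g u').1) ∈ ({e} : Finset (ℕ × ℕ)) := by
      rw [← he, mem_filter]; exact ⟨hg u', Or.inr (by rw [h])⟩
    rw [mem_singleton] at h1 h2
    exact Fin.ext (congrArg Prod.fst (h1.trans h2.symm))
  refine ⟨Equiv.ofBijective g (Finite.injective_iff_bijective.1 hinj),
    fun u => (hM.1 _ (hg u)).2.2, Finset.ext fun e => ?_⟩
  rw [mem_permArcs]
  constructor
  · rintro ⟨u, rfl⟩
    exact hg u
  · intro he
    obtain ⟨h1, _, _⟩ := hM.1 e he
    exact ⟨⟨e.1, h1⟩, Prod.ext rfl (hg' ⟨e.1, h1⟩ e he rfl).symm⟩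

theorem permArcs_injective : Function.Injective (permArcs (n := n)) := by
  intro τ τ' h
  refine Equiv.ext fun u => ?_
  obtain ⟨u', hu'⟩ := mem_permArcs.1 (h ▸ mem_permArcs.2 ⟨u, rfl⟩ : (u.1, (τ u).1) ∈ permArcs τ')
  rw [Prod.mk.injEq] at hu'
  obtain rfl : u' = u := Fin.ext hu'.1
  exact (Fin.ext hu'.2).symm

theorem cnt_full (hn : 0 < n) : cnt n (2 ^ n - 1) (arcs n A (2 ^ n - 1)) 0 =
    Nat.card {τ : Equiv.Perm (Fin n) // ∀ u : Fin n, arc n A u (τ u)} := by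
  classical
  have hiff : ∀ M : Finset (ℕ × ℕ), M ∈ ({M ∈ (arcs n A (2 ^ n - 1)).powerset | ∀ x < 2 * n,
      deg n M x = if (2 ^ n - 1).testBit (x % n) ∧ ¬ (0 : ℕ).testBit x then 1 else 0} :
      Finset (Finset (ℕ × ℕ))) ↔ IsPerfect n A M := by
    intro M
    have h1 : ∀ x, (2 ^ n - 1).testBit (x % n) := fun x => by
      simpa using Nat.mod_lt x hn
    have h2 : ∀ u < n, (2 ^ n - 1).testBit u := fun u hu => by simpa using hu
    simp only [mem_filter, mem_powerset, h1, Nat.zero_testBit, true_and, IsPerfect]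
    refine and_congr ⟨fun h e he => ?_, fun h e he => ?_⟩ (by simp)
    · obtain ⟨h1, h2, h3, _⟩ := mem_arcs.1 (h he)
      exact ⟨h1, h2, h3⟩
    · obtain ⟨h3, h4, h5⟩ := h e he
      exact mem_arcs.2 ⟨h3, h4, h5, h2 _ h3, h2 _ h4⟩
  rw [Nat.card_eq_fintype_card, ← card_univ, cnt]
  symm
  refine card_bij (fun τ _ => permArcs τ.1) (fun τ _ => (hiff _).2 (isPerfect_permArcs τ.2))
    (fun τ _ τ' _ h => Subtype.ext (permArcs_injective h)) fun M hM => ?_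
  obtain ⟨τ, hτ, h⟩ := ((hiff M).1 hM).exists_perm
  exact ⟨⟨τ, hτ⟩, mem_univ _, h⟩

/-- The rows of `Z` that are not covered inside `Z` are the places where the permutation leaves `Z`, and
the columns are the places where it enters `Z`; there are as many of the latter as of the former. -/
theorem card_miss_le {Z' : Finset (Fin n)} (hZ : ∀ u : Fin n, Z.testBit u ↔ u ∈ Z')
    {τ : Equiv.Perm (Fin n)} (hτ : ∀ u : Fin n, arc n A u (τ u)) :
    #{x ∈ range (2 * n) | (miss n Z (arcs n A Z) (permArcs τ)).testBit x} ≤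
      2 * #{u | u ∈ Z' ∧ τ u ∉ Z'} := by
  have key : ∀ u : Fin n, ∀ x, x = u.1 ∨ x = n + (τ u).1 →
      deg n (permArcs τ ∩ arcs n A Z) x = 0 → ¬ (u ∈ Z' ∧ τ u ∈ Z') := by
    intro u x hx h ⟨h1, h2⟩
    rw [deg, card_eq_zero, filter_eq_empty_iff] at h
    exact h (mem_inter.2 ⟨mem_permArcs.2 ⟨u, rfl⟩,
      mem_arcs.2 ⟨u.2, (τ u).2, hτ u, (hZ u).2 h1, (hZ _).2 h2⟩⟩) hx
  calc _ ≤ #(({u | u ∈ Z' ∧ τ u ∉ Z'} : Finset (Fin n)).image (fun u => u.1) ∪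
        ({u | u ∉ Z' ∧ τ u ∈ Z'} : Finset (Fin n)).image (fun u => n + (τ u).1)) := by
        refine card_le_card fun x hx => ?_
        simp only [mem_filter, mem_range, testBit_miss] at hx
        obtain ⟨hx, _, hxZ, hdeg⟩ := hx
        simp only [mem_union, mem_image, mem_filter, mem_univ, true_and]
        by_cases hxn : x < n
        · rw [Nat.mod_eq_of_lt hxn] at hxZ
          have h1 := (hZ ⟨x, hxn⟩).1 hxZ
          exact Or.inl ⟨⟨x, hxn⟩, ⟨h1, fun h => key ⟨x, hxn⟩ x (Or.inl rfl) hdeg ⟨h1, h⟩⟩, rfl⟩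
        · obtain ⟨v, rfl⟩ : ∃ v, x = n + v := ⟨x - n, by omega⟩
          have hv : v < n := by omega
          rw [Nat.add_mod_left, Nat.mod_eq_of_lt hv] at hxZ
          have h1 := (hZ ⟨v, hv⟩).1 hxZ
          have h2 : τ (τ.symm ⟨v, hv⟩) = ⟨v, hv⟩ := τ.apply_symm_apply _
          refine Or.inr ⟨τ.symm ⟨v, hv⟩, ⟨fun h => ?_, by rw [h2]; exact h1⟩, by rw [h2]⟩
          exact key _ (n + v) (Or.inr (by rw [h2])) hdeg ⟨h, by rw [h2]; exact h1⟩
    _ ≤ #{u | u ∈ Z' ∧ τ u ∉ Z'} + #{u | u ∉ Z' ∧ τ u ∈ Z'} :=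
        (card_union_le _ _).trans (Nat.add_le_add card_image_le card_image_le)
    _ = _ := by rw [Dig.card_entries_eq_card_exits, two_mul]

/-! ### The family of sets -/

theorem fam_lt : fam n A w N f < 2 ^ n := by
  rw [fam]
  split_ifs with h
  · exact Nat.pow_lt_pow_right (by omega) h
  · exact mask_lt _ _

theorem le_famNum : n ≤ famNum n N := Nat.le_add_right _ _

theorem testBit_block {W W' : ℕ} {W₁ W₁' : Finset (Fin n)} (hW : ∀ x : Fin n, W.testBit x ↔ x ∈ W₁)
    (hW' : ∀ x : Fin n, W'.testBit x ↔ x ∈ W₁') (hv : v ≤ n) (x u : Fin n) :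
    (block n A W v W' x).testBit u ↔ u ∉ W₁ ∧ u ∉ W₁' ∧
      (∀ v' ∈ (if h : v < n then some (⟨v, h⟩ : Fin n) else none), key n A W₁ u = key n A W₁ v') ∧
      key n A W₁' u ≤ key n A W₁' x := by
  rw [block, testBit_mask, hW, hW', reach_eq_reach_code hW', reach_eq_reach_code hW',
    reach_eq_reach_code hW]
  simp only [u.2, true_and]
  refine and_congr_right fun _ => and_congr_right fun _ => and_congr_left fun _ => ?_
  by_cases h : v < n
  · rw [dif_pos h, show reach n A W v = reach n A (code W₁) v from reach_eq_reach_code hW ⟨v, h⟩]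
    simp only [Option.mem_def, Option.some.injEq, forall_eq', key]
    exact or_iff_right (by omega)
  · rw [dif_neg h]
    simp only [Option.mem_def, reduceCtorEq, false_imp_iff, implies_true, iff_true]
    omega

theorem isFam_fam (hn : 0 < n) (hf : ¬ f < n) : ∃ Z : Finset (Fin n),
    Dig.IsFam (key n A) w Z ∧ ∀ u : Fin n, (fam n A w N f).testBit u ↔ u ∈ Z := by
  classical
  have hx : (f - n) % n < n := Nat.mod_lt _ hn
  have hv : (f - n) / n / N % (n + 1) ≤ n := Nat.lt_succ_iff.1 (Nat.mod_lt _ (by omega))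
  let W : ℕ → Finset (Fin n) := fun c => {u | (coded n w c).testBit u}
  have hW : ∀ c, ∀ x : Fin n, (coded n w c).testBit x ↔ x ∈ W c := fun c x => by simp [W]
  have hWc : ∀ c, #(W c) ≤ w := fun c => by
    refine le_trans (card_le_card_of_injOn (fun u => u.1) (fun u hu => ?_)
      Fin.val_injective.injOn) (card_coded_le n w c)
    rw [coe_filter]
    exact ⟨mem_range.2 (show u.1 < 2 * n by omega), (hW c u).2 hu⟩
  have hb := testBit_block (A := A) (hW ((f - n) / n / N / (n + 1))) (hW ((f - n) / n % N)) hv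
    ⟨(f - n) % n, hx⟩
  rw [fam, if_neg hf]
  exact ⟨({u | (block n A (coded n w ((f - n) / n / N / (n + 1))) ((f - n) / n / N % (n + 1))
      (coded n w ((f - n) / n % N)) ((f - n) % n)).testBit u} : Finset (Fin n)),
    ⟨_, _, hWc _, hWc _, _, _, fun u => Iff.trans (by simp) (hb u)⟩, fun u => by simp⟩

theorem exists_fam (hN : N = (2 * n + 1) ^ w) {Z : Finset (Fin n)} (hZ : Dig.IsFam (key n A) w Z) :
    ∃ f < famNum n N, ∀ u : Fin n, (fam n A w N f).testBit u ↔ u ∈ Z := by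
  classical
  obtain ⟨W, W', hWc, hWc', v, x, hZ⟩ := hZ
  have hcode : ∀ W : Finset (Fin n), #W ≤ w → ∃ c < N, coded n w c = code W := by
    intro W hW
    rw [hN]
    refine exists_coded_eq ((mask_lt _ _).trans_le (Nat.pow_le_pow_right (by omega) (by omega))) ?_
    calc _ ≤ #(W.image fun u => u.1) := card_le_card fun x hx => by
          obtain ⟨_, h, h'⟩ := testBit_mask.1 (mem_filter.1 hx).2
          exact mem_image.2 ⟨⟨x, h⟩, h', rfl⟩
      _ ≤ w := card_image_le.trans hW
  obtain ⟨c, hc, hcW⟩ := hcode W hWc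
  obtain ⟨c', hc', hcW'⟩ := hcode W' hWc'
  obtain ⟨v₁, hv₁, hv⟩ : ∃ v₁ ≤ n, v = if h : v₁ < n then some (⟨v₁, h⟩ : Fin n) else none := by
    cases v with
    | none => exact ⟨n, le_rfl, by simp⟩
    | some v => exact ⟨v, v.2.le, by simp⟩
  have hx := x.2
  obtain ⟨g, hg⟩ : ∃ g, g = ((c * (n + 1) + v₁) * N + c') * n + x.1 := ⟨_, rfl⟩
  have g1 : g % n = x := by
    rw [hg, add_comm, Nat.add_mul_mod_self_right, Nat.mod_eq_of_lt hx]
  have g2 : g / n = (c * (n + 1) + v₁) * N + c' := by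
    rw [hg, add_comm, Nat.add_mul_div_right _ _ (by omega), Nat.div_eq_of_lt hx, zero_add]
  have g3 : g / n % N = c' := by
    rw [g2, add_comm, Nat.add_mul_mod_self_right, Nat.mod_eq_of_lt hc']
  have g4 : g / n / N = c * (n + 1) + v₁ := by
    rw [g2, add_comm, Nat.add_mul_div_right _ _ (by omega), Nat.div_eq_of_lt hc', zero_add]
  have g5 : g / n / N % (n + 1) = v₁ := by
    rw [g4, add_comm, Nat.add_mul_mod_self_right, Nat.mod_eq_of_lt (by omega)]
  have g6 : g / n / N / (n + 1) = c := by
    rw [g4, add_comm, Nat.add_mul_div_right _ _ (by omega), Nat.div_eq_of_lt (by omega), zero_add]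
  refine ⟨n + g, ?_, fun u => ?_⟩
  · have h1 : g / n / N / (n + 1) < N := by rw [g6]; exact hc
    rw [Nat.div_lt_iff_lt_mul (by omega), Nat.div_lt_iff_lt_mul (by omega),
      Nat.div_lt_iff_lt_mul (by omega)] at h1
    have h2 : N * (n + 1) * N * n = n * N * (n + 1) * N := by ring
    rw [famNum]
    omega
  · rw [fam, if_neg (by omega), Nat.add_sub_cancel_left, g1, g3, g5, g6, hcW, hcW',
      testBit_block testBit_code testBit_code hv₁, hZ, hv]

theorem card_miss_fam_le (hn : 0 < n) (hw : 0 < w) (hM : IsPerfect n A M) :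
    #{x ∈ range (2 * n) | (miss n (fam n A w N f) (arcs n A (fam n A w N f)) M).testBit x} ≤
      6 * w := by
  classical
  obtain ⟨τ, hτ, rfl⟩ := hM.exists_perm
  by_cases hf : f < n
  · have hZ : ∀ u : Fin n, (fam n A w N f).testBit u ↔ u ∈ ({⟨f, hf⟩} : Finset (Fin n)) := fun u => by
      rw [fam, if_pos hf, Nat.testBit_two_pow, decide_eq_true_eq, mem_singleton, Fin.ext_iff, eq_comm]
    refine (card_miss_le hZ hτ).trans ?_
    have : #{u | u ∈ ({⟨f, hf⟩} : Finset (Fin n)) ∧ τ u ∉ ({⟨f, hf⟩} : Finset (Fin n))} ≤ 1 := by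
      rw [← card_singleton (⟨f, hf⟩ : Fin n)]
      exact card_le_card fun u hu => (mem_filter.1 hu).2.1
    omega
  · obtain ⟨Z, hZ, hbit⟩ := isFam_fam (A := A) (w := w) (N := N) hn hf
    have h1 := card_miss_le hbit hτ
    have h2 := hZ.card_exits_le isKey hτ
    omega

/-! ### Soundness and completeness of the search for tables -/

theorem IsSplit.isUnion {S g : ℕ} (h : IsSplit n A w N S f g) : IsUnion n
    (fam n A w N (g / famNum n N)) (fam n A w N (g % famNum n N)) (fam n A w N f) where
  iff u hu := by
    obtain ⟨h1, h2, h3, _⟩ := h.2.2 u hu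
    tauto
  disj u hu := (h.2.2 u hu).2.2.2

theorem merge_lt (hn : 0 < n) (S T : ℕ) :
    merge n A w N X Y Z S T < 2 ^ ((n * n + 1) * N ^ 12) := by
  obtain ⟨m, hm⟩ := Nat.exists_eq_succ_of_ne_zero (Nat.mul_pos hn hn).ne'
  rw [merge, hm, RAM.loop]
  rw [← hm]
  exact arr_lt _ _ _

theorem lt_width {T : ℕ} (hT : T < 2 ^ ((n * n + 1) * N ^ 12)) : 2 * T + 1 < 2 ^ width n N := by
  rw [width, pow_succ]
  omega

theorem get_tables₀ (hf : f < famNum n N) : get (width n N) (tables₀ n w N) f =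
    if f < n then 2 * baseTable n w N f + 1 else 0 := by
  rw [tables₀, get_arr hf, Nat.mod_eq_of_lt]
  split_ifs
  · exact lt_width (arr_lt _ _ _)
  · positivity

open scoped Classical in
theorem get_round (hn : 0 < n) {S : ℕ} (hf : f < famNum n N) : get (width n N) (round n A w N S) f =
    if get (width n N) S f = 0 ∧ split n A w N S f < famNum n N * famNum n N then
      2 * merge n A w N (fam n A w N (split n A w N S f / famNum n N))
        (fam n A w N (split n A w N S f % famNum n N)) (fam n A w N f)
        (get (width n N) S (split n A w N S f / famNum n N) / 2)
        (get (width n N) S (split n A w N S f % famNum n N) / 2) + 1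
    else get (width n N) S f := by
  rw [round, get_arr hf, Nat.mod_eq_of_lt]
  split_ifs
  · exact lt_width (merge_lt hn _ _)
  · exact get_lt _ _ _

/-- All tables that are found are correct. -/
theorem isTable_tables (hn : 0 < n) (hN : N = (2 * n + 1) ^ w) (hw : 0 < w)
    (hrefl : ∀ u < n, arc n A u u) (t : ℕ) : ∀ f < famNum n N,
    get (width n N) (RAM.loop (fun _ S => round n A w N S) (tables₀ n w N) t) f ≠ 0 →
      IsTable n A w N (fam n A w N f) (arcs n A (fam n A w N f))
        (get (width n N) (RAM.loop (fun _ S => round n A w N S) (tables₀ n w N) t) f / 2) := by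
  have hhalf : ∀ T, (2 * T + 1) / 2 = T := fun T => by omega
  induction t with
  | zero =>
    intro f hf h
    rw [RAM.loop, get_tables₀ hf] at h ⊢
    by_cases hfn : f < n
    · rw [if_pos hfn, hhalf, fam, if_pos hfn]
      exact isTable_baseTable hN hw hfn (hrefl f hfn)
    · rw [if_neg hfn] at h
      exact absurd rfl h
  | succ t ih =>
    intro f hf h
    rw [RAM.loop, get_round hn hf] at h ⊢
    generalize RAM.loop (fun _ S => round n A w N S) (tables₀ n w N) t = S at *
    by_cases hc : get (width n N) S f = 0 ∧ split n A w N S f < famNum n N * famNum n N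
    · rw [if_pos hc, hhalf]
      have hs : IsSplit n A w N S f (split n A w N S f) := of_search_lt hc.2
      have hF : 0 < famNum n N := hn.trans_le le_famNum
      exact .merge hn hN hs.isUnion (ih _ (Nat.div_lt_of_lt_mul hc.2) hs.1)
        (ih _ (Nat.mod_lt _ hF) hs.2.1) (fun M hM => card_miss_fam_le hn hw hM)
        (fun M hM => card_miss_fam_le hn hw hM)
    · rw [if_neg hc] at h ⊢
      exact ih f hf h

theorem get_round_ne_zero (hn : 0 < n) {S : ℕ} (hf : f < famNum n N)
    (h : get (width n N) S f ≠ 0 ∨ split n A w N S f < famNum n N * famNum n N) :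
    get (width n N) (round n A w N S) f ≠ 0 := by
  rw [get_round hn hf]
  split_ifs with hc
  · omega
  · tauto

theorem _root_.Dig.Derivable.nonempty {V : Type*} [DecidableEq V] {key : Finset V → V → ℕ} {s : ℕ}
    {Z : Finset V} (h : Dig.Derivable key s Z) : Z.Nonempty := by
  induction h with
  | single v => exact singleton_nonempty v
  | union _ _ _ _ ih _ => exact ih.mono subset_union_left

/-- Every derivable set with at most `r + 1` elements has a table after `r` rounds. -/
theorem exists_table (hn : 0 < n) (hN : N = (2 * n + 1) ^ w) {Z : Finset (Fin n)}
    (hZ : Dig.Derivable (key n A) w Z) : ∃ f < famNum n N,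
      (∀ u : Fin n, (fam n A w N f).testBit u ↔ u ∈ Z) ∧ ∀ r, #Z ≤ r + 1 →
        get (width n N) (RAM.loop (fun _ S => round n A w N S) (tables₀ n w N) r) f ≠ 0 := by
  induction hZ with
  | single v =>
    have hf : v.1 < famNum n N := v.2.trans_le le_famNum
    refine ⟨v, hf, fun u => ?_, fun r _ => ?_⟩
    · rw [fam, if_pos v.2, Nat.testBit_two_pow, decide_eq_true_eq, mem_singleton, Fin.ext_iff, eq_comm]
    · induction r with
      | zero => rw [RAM.loop, get_tables₀ hf, if_pos v.2]; omega
      | succ r ih => exact get_round_ne_zero hn hf (Or.inl (ih (by simp)))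
  | @union X Y hX hY hd hZ ihX ihY =>
    obtain ⟨f, hf, hfZ⟩ := exists_fam hN hZ
    obtain ⟨g, hg, hgX, htX⟩ := ihX
    obtain ⟨h, hh, hhY, htY⟩ := ihY
    refine ⟨f, hf, hfZ, fun r hr => ?_⟩
    have hXc := hX.nonempty.card_pos
    have hYc := hY.nonempty.card_pos
    rw [card_union_of_disjoint hd] at hr
    obtain ⟨r, rfl⟩ : ∃ r', r = r' + 1 := ⟨r - 1, by omega⟩
    refine get_round_ne_zero hn hf (Or.inr (search_lt_iff.2 ⟨g * famNum n N + h, ?_, ?_⟩))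
    · have := Nat.mul_le_mul_right (famNum n N) (Nat.succ_le_of_lt hg)
      rw [Nat.succ_mul] at this
      omega
    · have e1 : (g * famNum n N + h) / famNum n N = g := by
        rw [add_comm, Nat.add_mul_div_right _ _ (by omega), Nat.div_eq_of_lt hh, zero_add]
      have e2 : (g * famNum n N + h) % famNum n N = h := by
        rw [add_comm, Nat.add_mul_mod_self_right, Nat.mod_eq_of_lt hh]
      rw [IsSplit, e1, e2]
      refine ⟨htX r (by omega), htY r (by omega), fun u hu => ?_⟩
      have h1 := hfZ ⟨u, hu⟩
      have h2 := hgX ⟨u, hu⟩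
      have h3 := hhY ⟨u, hu⟩
      have h4 : (⟨u, hu⟩ : Fin n) ∈ X → (⟨u, hu⟩ : Fin n) ∉ Y := fun h => disjoint_left.1 hd h
      rw [mem_union] at h1
      dsimp only at h1 h2 h3
      rw [h1, h2, h3]
      tauto

/-- After `i` steps, `r` is determined up to an error less than `2 ^ (L - i)`. -/
theorem isqrt_sq {L r : ℕ} (hr : r < 2 ^ L) : isqrt L (r ^ 2) = r := by
  have key : ∀ i ≤ L, RAM.loop (fun i a => if (a + 2 ^ (L - 1 - i)) * (a + 2 ^ (L - 1 - i)) ≤ r ^ 2 then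
      a + 2 ^ (L - 1 - i) else a) 0 i ≤ r ∧
      r < RAM.loop (fun i a => if (a + 2 ^ (L - 1 - i)) * (a + 2 ^ (L - 1 - i)) ≤ r ^ 2 then
        a + 2 ^ (L - 1 - i) else a) 0 i + 2 ^ (L - i) := by
    intro i
    induction i with
    | zero => intro _; simpa [RAM.loop] using hr
    | succ i ih =>
      intro hi
      obtain ⟨ih1, ih2⟩ := ih (by omega)
      have e : 2 ^ (L - i) = 2 ^ (L - 1 - i) * 2 := by
        rw [← pow_succ]; congr 1; omega
      have e' : L - (i + 1) = L - 1 - i := by omega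
      rw [e] at ih2
      rw [RAM.loop, e']
      split_ifs with h
      · rw [← sq, Nat.pow_le_pow_iff_left (by omega)] at h
        omega
      · rw [← sq, Nat.pow_le_pow_iff_left (by omega)] at h
        omega
  obtain ⟨h1, h2⟩ := key L le_rfl
  rw [Nat.sub_self, pow_zero] at h2
  rw [isqrt]
  omega

/-- An outcome other than `0` is right. -/
theorem outcome_eq (hn : 0 < n) (hN : N = (2 * n + 1) ^ w) (hrefl : ∀ u < n, arc n A u u) {p : ℕ}
    (hp : Nat.card {τ : Equiv.Perm (Fin n) // ∀ u : Fin n, arc n A u (τ u)} = p ^ 2)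
    (h : outcome n A w N ≠ 0) : outcome n A w N = p + 1 := by
  classical
  rw [outcome] at h ⊢
  by_cases hc : 0 < w ∧ full n A w N < famNum n N
  · rw [if_pos hc]
    obtain ⟨h1, h2⟩ : fam n A w N (full n A w N) = 2 ^ n - 1 ∧
        get (width n N) (tables n A w N) (full n A w N) ≠ 0 := of_search_lt hc.2
    have hT := isTable_tables hn hN hc.1 hrefl n _ hc.2 h2
    rw [h1] at hT
    have hM := isPerfect_permArcs (A := A) (τ := 1) fun u => hrefl u u.2
    have hmiss : miss n (2 ^ n - 1) (arcs n A (2 ^ n - 1)) (permArcs (1 : Equiv.Perm (Fin n))) = 0 := by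
      refine miss_eq_of_deg (by positivity) (fun x hx => by simp at hx) fun x hx => ?_
      have : permArcs (1 : Equiv.Perm (Fin n)) ∩ arcs n A (2 ^ n - 1) = permArcs 1 := inter_eq_left.2 fun e he => by
        obtain ⟨u, rfl⟩ := mem_permArcs.1 he
        exact mem_arcs.2 ⟨u.2, u.2, hrefl u u.2, by simp, by simp⟩
      rw [this, hM.2 x hx, if_pos]
      simpa using Nat.mod_lt x hn
    have heq := hT.eq _ hM
    rw [hmiss, cnt_full hn, hp, ← tables] at heq
    rw [heq, isqrt_sq]
    have hlt := cnt_lt (Subset.refl (arcs n A (2 ^ n - 1))) 0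
    rw [cnt_full hn, hp] at hlt
    exact (Nat.le_self_pow (by omega) p).trans_lt hlt
  · rw [if_neg hc] at h
    exact absurd rfl h

/-- The algorithm succeeds if the set of all vertices is derivable. -/
theorem outcome_ne_zero (hn : 0 < n) (hw : 0 < w) (hN : N = (2 * n + 1) ^ w)
    (h : Dig.Derivable (key n A) w univ) : outcome n A w N ≠ 0 := by
  obtain ⟨f, hf, hfZ, ht⟩ := exists_table hn hN h
  have hfull : full n A w N < famNum n N := by
    refine search_lt_iff.2 ⟨f, hf, Nat.eq_of_testBit_eq fun x => Bool.eq_iff_iff.2 ?_, ht n (by simp)⟩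
    rw [Nat.testBit_two_pow_sub_one, decide_eq_true_eq]
    constructor
    · intro hx
      by_contra hxn
      rw [Nat.testBit_lt_two_pow (fam_lt.trans_le (Nat.pow_le_pow_right (by omega)
        (not_lt.1 hxn)))] at hx
      exact absurd hx (by simp)
    · exact fun hx => (hfZ ⟨x, hx⟩).2 (mem_univ _)
  rw [outcome, if_pos ⟨hw, hfull⟩]
  omega

end Alg

/-! ### The input and the running time -/

namespace RAM

open Arith

theorem testBit_encode {R : Memory} (h : ∀ k, R (k + 1) ≤ 1) (m k : ℕ) :
    (encode R m).testBit k ↔ k < m ∧ R (k + 1) = 1 := by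
  classical
  have : encode R m = mask m fun k => R (k + 1) = 1 := by
    refine Finset.sum_congr rfl fun k _ => ?_
    have := h k
    split_ifs with h1
    · rw [h1, one_mul]
    · rw [show R (k + 1) = 0 by omega, zero_mul]
  rw [this, testBit_mask]

variable {n : ℕ} (G : SimpleGraph (Fin n))

theorem graphInput_le (k : ℕ) : graphInput G (k + 1) ≤ 1 := by
  rw [graphInput, if_neg (by omega)]
  split_ifs <;> omega

theorem graphInput_one : graphInput G 1 = 0 := by
  rw [graphInput, if_neg (by omega), if_neg]
  rintro ⟨i, j, h, e⟩
  have hi : i.1 * n = 0 := by omega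
  rcases Nat.mul_eq_zero.1 hi with h0 | h0
  · exact h.ne (Fin.ext (by omega))
  · have := i.2
    omega

theorem adj_encode_graphInput (u v : Fin n) :
    Alg.adj n (encode (graphInput G) (n * n + 5)) u v ↔ G.Adj u v := by
  rw [Alg.adj, testBit_encode (graphInput_le G), graphInput, if_neg (by omega)]
  have hv := v.2
  have hlt : u.1 * n + v.1 < n * n + 5 := by
    have := Nat.mul_le_mul_right n (Nat.succ_le_of_lt u.2)
    rw [Nat.succ_mul] at this
    omega
  constructor
  · rintro ⟨_, h⟩
    split_ifs at h with h'
    obtain ⟨i, j, hij, e⟩ := h'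
    have e' : u.1 * n + v.1 = i.1 * n + j.1 := by omega
    have h1 : u.1 = i.1 := by
      have := congrArg (· / n) e'
      rwa [add_comm, Nat.add_mul_div_right _ _ (by omega), Nat.div_eq_of_lt hv, zero_add, add_comm,
        Nat.add_mul_div_right _ _ (by omega), Nat.div_eq_of_lt j.2, zero_add] at this
    rw [h1] at e'
    rw [show u = i from Fin.ext h1, show v = j from Fin.ext (by omega)]
    exact hij
  · exact fun h => ⟨hlt, if_pos ⟨u, v, h, by omega⟩⟩

end RAM

/-- For every `w` that is large compared to the perfect matching width, the algorithm finds the number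
of perfect matchings. -/
theorem PMW.exists_outcome {n : ℕ} (hn : 2 ≤ n) {B : SimpleGraph (Fin n)} (hB : B.IsBipartite)
    (f : PMW.Partner B) {A : ℕ} (hA : ∀ u v : Fin n, Alg.adj n A u v ↔ B.Adj u v) :
    (∀ w, Alg.outcome n A w ((2 * n + 1) ^ w) ≠ 0 →
      Alg.outcome n A w ((2 * n + 1) ^ w) = numPerfectMatchings B + 1) ∧
    Alg.outcome n A (18 * pmw B + 1) ((2 * n + 1) ^ (18 * pmw B + 1)) ≠ 0 := by
  classical
  obtain ⟨τ, hτ⟩ : ∃ τ : ℕ → ℕ, ∀ u : Fin n, τ u = (f.1 u).1 :=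
    ⟨fun u => if h : u < n then (f.1 ⟨u, h⟩).1 else 0, fun u => by simp⟩
  have hf : Function.Injective f.1 := fun u v h => by rw [← (f.2 u).2, h, (f.2 v).2]
  obtain ⟨h1, h2⟩ := Alg.mate_spec (n := n) (A := A) (τ := τ)
    (fun u hu => by
      rw [hτ ⟨u, hu⟩]
      exact ⟨(f.1 ⟨u, hu⟩).2, (hA ⟨u, hu⟩ _).2 (f.2 _).1⟩)
    (fun u hu v hv h => by
      rw [hτ ⟨u, hu⟩, hτ ⟨v, hv⟩] at h
      exact congrArg Fin.val (hf (Fin.ext h)))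
  let g : Fin n → Fin n := fun v => ⟨Alg.mate n A v, (h1 v v.2).1⟩
  have hg : Function.Injective g := fun u v h => Fin.ext (h2 u.2 v.2 (congrArg Fin.val h))
  let σ : Equiv.Perm (Fin n) := Equiv.ofBijective g (Finite.injective_iff_bijective.1 hg)
  have hσ : ∀ v, B.Adj v (σ v) := fun v => (hA v (σ v)).1 (h1 v v.2).2
  have harc : ∀ u v : Fin n, Alg.arc n A u v ↔ B.Adj u (σ v) := fun u v => hA u (σ v)
  have hrefl : ∀ u < n, Alg.arc n A u u := fun u hu => (harc ⟨u, hu⟩ ⟨u, hu⟩).2 (hσ _)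
  constructor
  · intro w h
    refine Alg.outcome_eq (by omega) rfl hrefl ?_ h
    rw [← PMW.card_perm_eq_sq hB]
    refine Nat.card_congr ((Equiv.mulLeft σ).subtypeEquiv fun τ => ?_)
    exact forall_congr' fun u => harc u (τ u)
  · obtain ⟨D, hD⟩ := PMW.exists_width_eq_pmw hn B
    have hk : 1 ≤ pmw B := hD ▸ D.one_le_width f ⟨0, by omega⟩
    have hkey : Dig.IsKey (fun u v => B.Adj u (σ v)) (Alg.key n A) := by
      have := Alg.isKey (n := n) (A := A)
      simpa only [harc] using this
    refine Alg.outcome_ne_zero (by omega) (by omega) rfl ?_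
    have := Dig.derivable_of_blocks hkey (m := 6 * pmw B)
      (PMW.exists_balanced_separator hB σ hσ D hk hD.le hkey) Finset.univ ∅ none (by simp) (by simp)
      ⟨⟨0, by omega⟩, Finset.mem_univ _⟩
    rwa [show 3 * (6 * pmw B) + 1 = 18 * pmw B + 1 by omega] at this

theorem mainTheorem8 :
    ∃ (P : RAM.Program) (c : ℕ), ∀ (n : ℕ) (B : SimpleGraph (Fin n)),
      0 < n → B.IsBipartite → (∃ M : B.Subgraph, M.IsPerfectMatching) →
        RAM.OutputsWithin P (RAM.graphInput B) (PMW.numPerfectMatchings B)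
          (n ^ (c * PMW.pmw B ^ 2)) := by
  classical
  obtain ⟨P, E, hP⟩ := RAM.exists_program
  refine ⟨P, 60 * E, fun n B hn hB hM => ?_⟩
  obtain ⟨M, hM⟩ := hM
  have f := (PMW.partnerEquiv B).symm ⟨M, hM⟩
  have hn2 : 2 ≤ n := by
    by_contra h
    obtain rfl : n = 1 := by omega
    exact (f.2 0).1.ne (Subsingleton.elim _ _)
  obtain ⟨hsound, hcomplete⟩ := PMW.exists_outcome hn2 hB f (RAM.adj_encode_graphInput B)
  have hex : ∃ w, Alg.outcome n (RAM.encode (RAM.graphInput B) (n * n + 5)) w ((2 * n + 1) ^ w) ≠ 0 :=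
    ⟨_, hcomplete⟩
  have hout := hP n hn (RAM.graphInput B) (by simp [RAM.graphInput]) (RAM.graphInput_one B)
    (RAM.graphInput_le B) (Nat.find hex) (Nat.find_spec hex)
    fun w hw => not_not.1 (Nat.find_min hex hw)
  rw [hsound _ (Nat.find_spec hex), Nat.add_sub_cancel] at hout
  obtain ⟨t, C, hrun, hC, ht⟩ := hout
  refine ⟨t, C, hrun, hC, ht.trans ?_⟩
  obtain ⟨D, hD⟩ := PMW.exists_width_eq_pmw hn2 B
  have hk : 1 ≤ PMW.pmw B := hD ▸ D.one_le_width f ⟨0, by omega⟩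
  have hw : Nat.find hex ≤ 18 * PMW.pmw B + 1 := Nat.find_min' hex hcomplete
  have hbase : 2 * n + 1 ≤ n ^ 3 := by nlinarith [Nat.mul_le_mul hn2 hn2]
  calc (2 * n + 1) ^ (E * (Nat.find hex + 1)) ≤ (n ^ 3) ^ (E * (Nat.find hex + 1)) :=
        Nat.pow_le_pow_left hbase _
    _ = n ^ (3 * (E * (Nat.find hex + 1))) := (pow_mul _ _ _).symm
    _ ≤ n ^ (60 * E * PMW.pmw B ^ 2) := by
        refine Nat.pow_le_pow_right hn ?_
        have h1 : Nat.find hex + 1 ≤ 20 * PMW.pmw B ^ 2 := by nlinarith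
        calc 3 * (E * (Nat.find hex + 1)) ≤ 3 * (E * (20 * PMW.pmw B ^ 2)) := by gcongr
          _ = 60 * E * PMW.pmw B ^ 2 := by ring
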